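/- Let $K$ be a field, let $X$ be a free abelian group of finite rank with a fixed basis $I$, write $\mathbb{N}I \subset X$ for the submonoid generated by $I$, and let $A=\bigoplus_{x\in X}A_x$ be a finite-dimensional $X$-graded $K$-algebra. For a graded subspace $V$ put $\operatorname{Supp} V=\{x\in X : V_x\neq 0\}$. Let $(A^-,T,A^+)$ be a triangular decomposition of $A$, that is, a triple of graded subalgebras such that 1. multiplication $A^-\otimes_K T\otimes_K A^+\to A$ is an isomorphism of vector spaces; 2. $T$ is concentrated in degree $0$, $\operatorname{Supp}A^+\subset \mathbb{N}I$ and $\operatorname{Supp}A^-\subset -\mathbb{N}I$; 3. $A^-_0=K=A^+_0$; 4. $A^+T=TA^+$ and $A^-T=TA^-$; 5. $T$ is split, i.e. $\operatorname{End}_T(\lambda)=K$ for every simple $T$-module $\lambda$. Let $\mathcal{G}_X(A)$ be the category of finitely generated $X$-graded left $A$-modules with degree-preserving $A$-linear maps. Let $\Lambda=\operatorname{Irr}T\times X$, and for $(\lambda,w)\in\Lambda$ let $L(\lambda,w)$ be the head of $A\otimes_{B^+}\lambda[w]$, where $B^+=A^+T$, $\lambda[w]$ is $\lambda$ placed in degree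 $w$, and $B^+$ acts on it through the projection $B^+\to B^+_0=T$. Order $X$ by $v\le w$ iff $w-v\in\mathbb{N}I$, let $d:\Lambda\to X$, $d(\lambda,w)=w$, and order $\Lambda$ by $(\mu,v)\prec(\lambda,w)$ iff $v<w$, i.e. iff $w-v\in\mathbb{N}I\setminus\{0\}$. Then $\mathcal{C}=\mathcal{G}_X(A)$ is a standardly stratified category with respect to $(\Lambda,\preceq)$ and $d$. This means: $\mathcal{C}$ is a $K$-linear finite length abelian category with enough projectives; the $L(\lambda)$, $\lambda\in\Lambda$, are simple and represent each isomorphism class of simple objects exactly once, and every simple object has endomorphism ring $K$; the poset $X$ is interval finite and $d$ has finite fibres; for $\xi\in X$, with $\mathcal{C}_{\le\xi}$, $\mathcal{C}_{<\xi}$ the Serre subcategories spanned by the $L(\lambda)$ with $d(\lambda)\le\xi$, respectively $d(\lambda)<\xi$, the quotient functor $\pi_\xi:\mathcal{C}_{\le\xi}\to\mathcal{C}_\xi:=\mathcal{C}_{\le\xi}/\mathcal{C}_{<\xi}$ has an exact left adjoint $\Delta_\xi$; for $\lambda\in\Lambda$ and $\xi=d(\lambda)$, the object $L_\xi(\lambda)=\pi_\xi(L(\lambda))$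 has a projective cover $P_\xi(\lambda)$ in $\mathcal{C}_\xi$, and $L(\lambda)$ has a projective cover $P(\lambda)$ in $\mathcal{C}$; and, with $\Delta(\lambda)=\Delta_\xi(P_\xi(\lambda))$, there is an epimorphism $P(\lambda)\twoheadrightarrow\Delta(\lambda)$ whose kernel has a finite filtration with subquotients isomorphic to objects $\Delta(\mu)$ with $\mu\succ\lambda$. If moreover $T$ is semisimple, then the canonical maps $\Delta(\lambda)\to\overline{\Delta}(\lambda):=\Delta_\xi(L_\xi(\lambda))$ are isomorphisms and $\mathcal{C}$ is a highest weight category with poset $(\Lambda,\preceq)$ and standard objects $\Delta(\lambda)$: it is a finite length abelian category with enough projectives, $(\Lambda,\preceq)$ is interval finite and labels the simple objects as above, the spaces $\operatorname{Hom}(\Delta(\lambda),\Delta(\mu))$ are finite-dimensional, there is an epimorphism $\Delta(\lambda)\twoheadrightarrow L(\lambda)$ whose kernel has only composition factors $L(\mu)$ with $\mu\prec\lambda$, and an epimorphism $P(\lambda)\twoheadrightarrow\Delta(\lambda)$ whose kernel has a finite filtration with subquotients isomorphic to objects $\Delta(\mu)$ with $\mu\succ\lambda$. -/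

import Mathlib

open CategoryTheory CategoryTheory.Limits
open scoped TensorProduct DirectSum

universe u v w

/-! ### Gradings -/

/-- The linear projection of `M = ⨁ i, ℳ i` onto the homogeneous component of degree `i`. -/
noncomputable def gradingProj {K M X : Type*} [Field K] [AddCommGroup M] [Module K M]
    [DecidableEq X] (ℳ : X → Submodule K M) (h : DirectSum.IsInternal ℳ) (i : X) : M →ₗ[K] M :=
  letI := h.chooseDecomposition
  (ℳ i).subtype ∘ₗ DirectSum.component K X (fun j => ℳ j) i ∘ₗ
    (DirectSum.decomposeLinearEquiv ℳ).toLinearMap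

section grading

variable {K M X : Type*} [Field K] [AddCommGroup M] [Module K M] [DecidableEq X]
  {ℳ : X → Submodule K M} (h : DirectSum.IsInternal ℳ)

theorem gradingProj_mem (i : X) (m : M) : gradingProj ℳ h i m ∈ ℳ i := by
  simp [gradingProj]

theorem gradingProj_of_mem {i : X} {m : M} (hm : m ∈ ℳ i) : gradingProj ℳ h i m = m := by
  let _ := h.chooseDecomposition
  exact DirectSum.decompose_of_mem_same ℳ hm

theorem gradingProj_of_mem_ne {i j : X} (hij : i ≠ j) {m : M} (hm : m ∈ ℳ i) :
    gradingProj ℳ h j m = 0 := by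
  let _ := h.chooseDecomposition
  exact DirectSum.decompose_of_mem_ne ℳ hm hij

theorem sum_gradingProj (m : M) : ∃ s : Finset X, ∑ i ∈ s, gradingProj ℳ h i m = m := by
  let _ := h.chooseDecomposition
  classical
  exact ⟨_, DirectSum.sum_support_decompose ℳ m⟩

theorem mem_iSup_grading (h : DirectSum.IsInternal ℳ) (m : M) : m ∈ ⨆ i, ℳ i := by
  rw [h.submodule_iSup_eq_top]; trivial

theorem grading_induction (h : DirectSum.IsInternal ℳ) {p : M → Prop} (h0 : p 0) (hadd : ∀ x y, p x → p y → p (x + y))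
    (hom : ∀ i, ∀ x ∈ ℳ i, p x) (m : M) : p m :=
  Submodule.iSup_induction ℳ (motive := p) (mem_iSup_grading h m) hom h0 hadd

/-- A family of submodules that spans and is separated by projections is a grading. -/
theorem isInternal_of_proj (p : X → M →ₗ[K] M) (h1 : ∀ i, ∀ m ∈ ℳ i, p i m = m)
    (h2 : ∀ i j, i ≠ j → ∀ m ∈ ℳ i, p j m = 0) (h3 : ∀ m, m ∈ ⨆ i, ℳ i) :
    DirectSum.IsInternal ℳ := by
  refine DirectSum.isInternal_submodule_of_iSupIndep_of_iSup_eq_top ?_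
    (eq_top_iff.2 fun m _ => h3 m)
  intro i
  rw [Submodule.disjoint_def]
  intro x hx hx'
  have hle : (⨆ j, ⨆ (_ : j ≠ i), ℳ j) ≤ LinearMap.ker (p i) :=
    iSup_le fun j => iSup_le fun hj m hm => h2 j i hj m hm
  rw [← h1 i x hx]
  exact hle hx'

end grading

/-! ### The category of graded modules -/

/-- A finitely generated `X`-graded left module over the `X`-graded `K`-algebra `A = ⨁ x, 𝒜 x`. -/
structure GrMod {K : Type u} [Field K] {A : Type v} [Ring A] [Algebra K A] {X : Type w}
    [AddCommGroup X] [DecidableEq X] (𝒜 : X → Submodule K A) : Type (max u (v + 1) w) where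
  carrier : Type v
  [addCommGroup : AddCommGroup carrier]
  [moduleK : Module K carrier]
  [module : Module A carrier]
  [isScalarTower : IsScalarTower K A carrier]
  [finite : Module.Finite A carrier]
  /-- The homogeneous component of a given degree. -/
  comp : X → Submodule K carrier
  isInternal : DirectSum.IsInternal comp
  smul_mem : ∀ (x y : X), ∀ a ∈ 𝒜 x, ∀ m ∈ comp y, a • m ∈ comp (x + y)

attribute [instance] GrMod.addCommGroup GrMod.moduleK GrMod.module GrMod.isScalarTower
  GrMod.finite

namespace GrMod

variable {K : Type u} [Field K] {A : Type v} [Ring A] [Algebra K A] {X : Type w}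
  [AddCommGroup X] [DecidableEq X] {𝒜 : X → Submodule K A}

/-- Morphisms of graded modules: `A`-linear maps preserving the grading. -/
@[ext]
structure Hom (M N : GrMod 𝒜) where
  toLin : M.carrier →ₗ[A] N.carrier
  map_mem : ∀ x, ∀ m ∈ M.comp x, toLin m ∈ N.comp x

instance : Category (GrMod 𝒜) where
  Hom M N := Hom M N
  id M := ⟨LinearMap.id, fun _ _ h => h⟩
  comp f g := ⟨g.toLin ∘ₗ f.toLin, fun x m h => g.map_mem x _ (f.map_mem x m h)⟩

@[ext]
theorem hom_ext {M N : GrMod 𝒜} {f g : M ⟶ N} (h : ∀ m, f.toLin m = g.toLin m) : f = g :=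
  Hom.ext (LinearMap.ext h)

@[simp] theorem id_toLin (M : GrMod 𝒜) : (𝟙 M : M ⟶ M).toLin = LinearMap.id := rfl

@[simp] theorem comp_toLin {M N P : GrMod 𝒜} (f : M ⟶ N) (g : N ⟶ P) :
    (f ≫ g).toLin = g.toLin ∘ₗ f.toLin := rfl

section homgroup

variable {M N : GrMod 𝒜}

instance : Zero (M ⟶ N) := ⟨⟨0, fun x _ _ => (N.comp x).zero_mem⟩⟩
instance : Add (M ⟶ N) :=
  ⟨fun f g => ⟨f.toLin + g.toLin,
    fun x m h => (N.comp x).add_mem (f.map_mem x m h) (g.map_mem x m h)⟩⟩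
instance : Neg (M ⟶ N) := ⟨fun f => ⟨-f.toLin, fun x m h => (N.comp x).neg_mem (f.map_mem x m h)⟩⟩
instance : Sub (M ⟶ N) :=
  ⟨fun f g => ⟨f.toLin - g.toLin,
    fun x m h => (N.comp x).sub_mem (f.map_mem x m h) (g.map_mem x m h)⟩⟩
instance : SMul K (M ⟶ N) :=
  ⟨fun r f => ⟨r • f.toLin, fun x m h => (N.comp x).smul_mem r (f.map_mem x m h)⟩⟩

@[simp] theorem zero_toLin : (0 : M ⟶ N).toLin = 0 := rfl
@[simp] theorem add_toLin (f g : M ⟶ N) : (f + g).toLin = f.toLin + g.toLin := rfl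
@[simp] theorem neg_toLin (f : M ⟶ N) : (-f).toLin = -f.toLin := rfl
@[simp] theorem sub_toLin (f g : M ⟶ N) : (f - g).toLin = f.toLin - g.toLin := rfl
@[simp] theorem smul_toLin (k : K) (f : M ⟶ N) : (k • f).toLin = k • f.toLin := rfl

instance : AddCommGroup (M ⟶ N) where
  add_assoc f g h := by ext m; simp [add_assoc]
  zero_add f := by ext m; simp
  add_zero f := by ext m; simp
  add_comm f g := by ext m; simp [add_comm]
  neg_add_cancel f := by ext m; simp
  sub_eq_add_neg f g := by ext m; simp [sub_eq_add_neg]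
  nsmul := nsmulRec
  zsmul := zsmulRec

end homgroup

instance : Preadditive (GrMod 𝒜) where
  add_comp _ _ _ f f' g := by ext m; simp
  comp_add _ _ _ f g g' := by ext m; simp

instance : Linear K (GrMod 𝒜) where
  homModule M N :=
    { one_smul := fun f => by ext m; simp
      mul_smul := fun r s f => by ext m; simp [mul_smul]
      smul_zero := fun r => by ext m; simp
      smul_add := fun r f g => by ext m; simp
      add_smul := fun r s f => by ext m; simp [add_smul]
      zero_smul := fun f => by ext m; simp }
  smul_comp _ _ _ r f g := by ext m; simp [LinearMap.map_smul_of_tower]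
  comp_smul _ _ _ f r g := by ext m; simp

/-- Projection onto a homogeneous component. -/
noncomputable def proj (M : GrMod 𝒜) (x : X) : M.carrier →ₗ[K] M.carrier :=
  gradingProj M.comp M.isInternal x

theorem proj_mem (M : GrMod 𝒜) (x : X) (m : M.carrier) : M.proj x m ∈ M.comp x :=
  gradingProj_mem _ _ _

theorem proj_of_mem (M : GrMod 𝒜) {x : X} {m : M.carrier} (hm : m ∈ M.comp x) :
    M.proj x m = m := gradingProj_of_mem _ hm

theorem proj_of_mem_ne (M : GrMod 𝒜) {x y : X} (hxy : x ≠ y) {m : M.carrier}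
    (hm : m ∈ M.comp x) : M.proj y m = 0 := gradingProj_of_mem_ne _ hxy hm

theorem hom_proj {M N : GrMod 𝒜} (f : M ⟶ N) (x : X) (m : M.carrier) :
    f.toLin (M.proj x m) = N.proj x (f.toLin m) := by
  refine grading_induction M.isInternal (p := fun m => f.toLin (M.proj x m) = N.proj x (f.toLin m))
    (by simp) (fun a b ha hb => by simp [ha, hb]) (fun y a ha => ?_) m
  by_cases h : y = x
  · subst h; rw [M.proj_of_mem ha, N.proj_of_mem (f.map_mem _ _ ha)]
  · rw [M.proj_of_mem_ne h ha, N.proj_of_mem_ne h (f.map_mem _ _ ha), map_zero]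

theorem proj_smul (M : GrMod 𝒜) {x : X} {a : A} (ha : a ∈ 𝒜 x) (y : X) (m : M.carrier) :
    M.proj y (a • m) = a • M.proj (y - x) m := by
  refine grading_induction M.isInternal
    (p := fun m => M.proj y (a • m) = a • M.proj (y - x) m)
    (by simp) (fun b c hb hc => by simp [hb, hc]) (fun z b hb => ?_) m
  by_cases h : z = y - x
  · subst h
    have := M.smul_mem _ _ a ha b hb
    rw [add_sub_cancel] at this
    rw [M.proj_of_mem hb, M.proj_of_mem this]
  · have := M.smul_mem _ _ a ha b hb
    rw [M.proj_of_mem_ne h hb, M.proj_of_mem_ne (fun e => h (by rw [← e]; abel)) this, smul_zero]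

/-- A submodule is homogeneous if it contains the homogeneous components of its elements. -/
def IsHomogeneous (M : GrMod 𝒜) (N : Submodule A M.carrier) : Prop :=
  ∀ m ∈ N, ∀ x, M.proj x m ∈ N

theorem isHomogeneous_ker {M N : GrMod 𝒜} (f : M ⟶ N) :
    M.IsHomogeneous (LinearMap.ker f.toLin) := by
  intro m hm x
  rw [LinearMap.mem_ker] at hm ⊢
  rw [hom_proj, hm, map_zero]

theorem isHomogeneous_range {M N : GrMod 𝒜} (f : M ⟶ N) :
    N.IsHomogeneous (LinearMap.range f.toLin) := by
  rintro _ ⟨m, rfl⟩ x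
  exact ⟨M.proj x m, hom_proj f x m⟩

/-- The quotient of a graded module by a homogeneous submodule. -/
noncomputable def quot (M : GrMod 𝒜) (N : Submodule A M.carrier) (hN : M.IsHomogeneous N) :
    GrMod 𝒜 where
  carrier := M.carrier ⧸ N
  comp x := (M.comp x).map (N.mkQ.restrictScalars K)
  isInternal := by
    refine isInternal_of_proj
      (fun x => (N.restrictScalars K).mapQ (N.restrictScalars K) (M.proj x)
        (fun m hm => hN m hm x)) ?_ ?_ ?_
    · rintro x _ ⟨m, hm, rfl⟩
      exact congrArg N.mkQ (M.proj_of_mem hm)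
    · rintro x y hxy _ ⟨m, hm, rfl⟩
      exact (congrArg N.mkQ (M.proj_of_mem_ne hxy hm)).trans (map_zero _)
    · intro m
      obtain ⟨m, rfl⟩ := N.mkQ_surjective m
      rw [← Submodule.map_iSup]
      exact ⟨m, mem_iSup_grading M.isInternal m, rfl⟩
  smul_mem := by
    rintro x y a ha _ ⟨m, hm, rfl⟩
    exact ⟨a • m, M.smul_mem x y a ha m hm, rfl⟩

/-- The projection onto the quotient by a homogeneous submodule. -/
noncomputable def quotπ (M : GrMod 𝒜) (N : Submodule A M.carrier) (hN : M.IsHomogeneous N) :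
    M ⟶ M.quot N hN :=
  ⟨N.mkQ, fun _ m hm => ⟨m, hm, rfl⟩⟩

/-- The zero module. -/
def zeroObj : GrMod 𝒜 where
  carrier := PUnit.{v + 1}
  comp _ := ⊤
  isInternal := isInternal_of_proj (fun _ => 0) (fun _ _ _ => rfl) (fun _ _ _ _ _ => rfl)
    (fun m => by rw [Subsingleton.elim m 0]; exact Submodule.zero_mem _)
  smul_mem _ _ _ _ _ _ := trivial

instance : HasZeroObject (GrMod 𝒜) :=
  ⟨zeroObj, (IsZero.iff_id_eq_zero _).2 (by ext m; rfl)⟩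

/-- The direct sum of two graded modules. -/
def prodObj (M N : GrMod 𝒜) : GrMod 𝒜 where
  carrier := M.carrier × N.carrier
  comp x := (M.comp x).prod (N.comp x)
  isInternal := by
    refine isInternal_of_proj (fun x => (M.proj x).prodMap (N.proj x)) ?_ ?_ ?_
    · rintro x ⟨m, n⟩ ⟨hm, hn⟩
      exact Prod.ext (M.proj_of_mem hm) (N.proj_of_mem hn)
    · rintro x y hxy ⟨m, n⟩ ⟨hm, hn⟩
      exact Prod.ext (M.proj_of_mem_ne hxy hm) (N.proj_of_mem_ne hxy hn)
    · have key : ∀ m n, (m, n) ∈ ⨆ x, (M.comp x).prod (N.comp x) := by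
        intro m n
        have h1 : (m, (0 : N.carrier)) ∈ ⨆ x, (M.comp x).prod (N.comp x) :=
          grading_induction M.isInternal
            (p := fun m => (m, (0 : N.carrier)) ∈ ⨆ x, (M.comp x).prod (N.comp x))
            (Submodule.zero_mem _)
            (fun a b ha hb => by simpa using Submodule.add_mem _ ha hb)
            (fun x a ha => Submodule.mem_iSup_of_mem x ⟨ha, Submodule.zero_mem _⟩) m
        have h2 : ((0 : M.carrier), n) ∈ ⨆ x, (M.comp x).prod (N.comp x) :=
          grading_induction N.isInternal
            (p := fun n => ((0 : M.carrier), n) ∈ ⨆ x, (M.comp x).prod (N.comp x))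
            (Submodule.zero_mem _)
            (fun a b ha hb => by simpa using Submodule.add_mem _ ha hb)
            (fun x a ha => Submodule.mem_iSup_of_mem x ⟨Submodule.zero_mem _, ha⟩) n
        simpa using Submodule.add_mem _ h1 h2
      exact fun p => key p.1 p.2
  smul_mem x y a ha p hp := ⟨M.smul_mem x y a ha _ hp.1, N.smul_mem x y a ha _ hp.2⟩

instance : HasBinaryBiproducts (GrMod 𝒜) where
  has_binary_biproduct M N := hasBinaryBiproduct_of_total
    { pt := prodObj M N
      fst := ⟨LinearMap.fst A _ _, fun _ _ h => h.1⟩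
      snd := ⟨LinearMap.snd A _ _, fun _ _ h => h.2⟩
      inl := ⟨LinearMap.inl A _ _, fun _ _ h => ⟨h, Submodule.zero_mem _⟩⟩
      inr := ⟨LinearMap.inr A _ _, fun _ _ h => ⟨Submodule.zero_mem _, h⟩⟩
      inl_fst := by ext m; rfl
      inl_snd := by ext m; rfl
      inr_fst := by ext m; rfl
      inr_snd := by ext m; rfl }
    (by
      ext m
      exact Prod.ext (add_zero _) (zero_add _))

instance : HasFiniteProducts (GrMod 𝒜) :=
  hasFiniteProducts_of_has_binary_and_terminal

instance : HasCokernels (GrMod 𝒜) where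
  has_colimit {M N} f := ⟨⟨⟨CokernelCofork.ofπ (f := f)
      (N.quotπ _ (isHomogeneous_range f))
      (by ext m; exact (Submodule.Quotient.mk_eq_zero _).2 ⟨m, rfl⟩),
    CokernelCofork.IsColimit.ofπ _ _
      (fun {P} g hg => (⟨(LinearMap.range f.toLin).liftQ g.toLin (by
          rintro _ ⟨m, rfl⟩
          exact LinearMap.congr_fun (congrArg Hom.toLin hg) m), by
          rintro x _ ⟨m, hm, rfl⟩
          exact g.map_mem x m hm⟩ : N.quot _ (isHomogeneous_range f) ⟶ P))
      (fun g hg => by ext m; rfl)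
      (fun g hg b hb => by
        ext m
        obtain ⟨m, rfl⟩ := Submodule.mkQ_surjective _ m
        exact LinearMap.congr_fun (congrArg Hom.toLin hb) m)⟩⟩⟩

theorem surjective_of_epi {M N : GrMod 𝒜} (f : M ⟶ N) [Epi f] :
    Function.Surjective f.toLin := by
  have h : N.quotπ _ (isHomogeneous_range f) = 0 := by
    rw [← cancel_epi f, comp_zero]
    ext m
    exact (Submodule.Quotient.mk_eq_zero _).2 ⟨m, rfl⟩
  intro n
  have := LinearMap.congr_fun (congrArg Hom.toLin h) n
  exact (Submodule.Quotient.mk_eq_zero _).1 this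

theorem exists_desc {M N P : GrMod 𝒜} (f : M ⟶ N) [Epi f] (g : M ⟶ P)
    (hr : LinearMap.ker f.toLin ≤ LinearMap.ker g.toLin) : ∃ l : N ⟶ P, f ≫ l = g := by
  let e := f.toLin.quotKerEquivOfSurjective (surjective_of_epi f)
  have h1 : ∀ m, e.symm (f.toLin m) = Submodule.Quotient.mk m := fun m =>
    (LinearEquiv.symm_apply_eq e).2 rfl
  have h2 : ∀ m, (LinearMap.ker f.toLin).liftQ g.toLin hr (e.symm (f.toLin m)) = g.toLin m :=
    fun m => by rw [h1]; rfl
  refine ⟨⟨(LinearMap.ker f.toLin).liftQ g.toLin hr ∘ₗ e.symm.toLinearMap, fun x n hn => ?_⟩,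
    by ext m; exact h2 m⟩
  obtain ⟨m, rfl⟩ := surjective_of_epi f n
  change (LinearMap.ker f.toLin).liftQ g.toLin hr (e.symm (f.toLin m)) ∈ P.comp x
  rw [← N.proj_of_mem hn, ← hom_proj, h2]
  exact g.map_mem x _ (M.proj_mem x m)

/-- The radical: the intersection of all maximal proper homogeneous submodules. -/
def rad (M : GrMod 𝒜) : Submodule A M.carrier :=
  sInf {N | Maximal (fun N' => M.IsHomogeneous N' ∧ N' ≠ ⊤) N}

theorem isHomogeneous_rad (M : GrMod 𝒜) : M.IsHomogeneous M.rad := by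
  intro m hm x
  rw [rad, Submodule.mem_sInf] at hm ⊢
  exact fun N hN => hN.1.1 m (hm N hN) x

/-- The head of a graded module. -/
noncomputable def head (M : GrMod 𝒜) : GrMod 𝒜 := M.quot M.rad M.isHomogeneous_rad

section abelian

variable [FiniteDimensional K A]

/-- A homogeneous submodule as a graded module. -/
noncomputable def sub (M : GrMod 𝒜) (N : Submodule A M.carrier) (hN : M.IsHomogeneous N) :
    GrMod 𝒜 where
  carrier := N
  finite := by
    have : IsNoetherianRing A := isNoetherian_of_tower K inferInstance
    infer_instance
  comp x := (M.comp x).comap (N.subtype.restrictScalars K)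
  isInternal := by
    refine isInternal_of_proj
      (fun x => (M.proj x).restrict (p := N.restrictScalars K) (q := N.restrictScalars K)
        (fun m hm => hN m hm x)) ?_ ?_ ?_
    · rintro x ⟨m, hm'⟩ hm
      exact Subtype.ext (M.proj_of_mem hm)
    · rintro x y hxy ⟨m, hm'⟩ hm
      exact Subtype.ext (M.proj_of_mem_ne hxy hm)
    · rintro ⟨m, hm⟩
      obtain ⟨s, hs⟩ := sum_gradingProj M.isInternal m
      have : (⟨m, hm⟩ : N) = ∑ x ∈ s, (⟨M.proj x m, hN m hm x⟩ : N) := by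
        apply Subtype.ext
        simpa [proj] using hs.symm
      rw [this]
      exact Submodule.sum_mem _ fun x _ => Submodule.mem_iSup_of_mem x (M.proj_mem x m)
  smul_mem x y a ha m hm := M.smul_mem x y a ha m hm

/-- The inclusion of a homogeneous submodule. -/
noncomputable def subι (M : GrMod 𝒜) (N : Submodule A M.carrier) (hN : M.IsHomogeneous N) :
    M.sub N hN ⟶ M :=
  ⟨N.subtype, fun _ _ hm => hm⟩

instance : HasKernels (GrMod 𝒜) where
  has_limit {M N} f := ⟨⟨⟨KernelFork.ofι (f := f)
      (M.subι _ (isHomogeneous_ker f)) (by ext m; exact m.2),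
    KernelFork.IsLimit.ofι _ _
      (fun {P} g hg => (⟨g.toLin.codRestrict _ (fun m =>
          LinearMap.congr_fun (congrArg Hom.toLin hg) m), fun x m hm => g.map_mem x m hm⟩ :
          P ⟶ M.sub _ (isHomogeneous_ker f)))
      (fun g hg => by ext m; rfl)
      (fun g hg b hb => by
        ext m
        exact Subtype.ext (LinearMap.congr_fun (congrArg Hom.toLin hb) m))⟩⟩⟩

theorem injective_of_mono {M N : GrMod 𝒜} (f : M ⟶ N) [Mono f] :
    Function.Injective f.toLin := by
  have h : M.subι _ (isHomogeneous_ker f) = 0 := by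
    rw [← cancel_mono f, zero_comp]
    ext m
    exact m.2
  rw [← LinearMap.ker_eq_bot, eq_bot_iff]
  intro m hm
  exact LinearMap.congr_fun (congrArg Hom.toLin h) ⟨m, hm⟩

theorem exists_lift {M N P : GrMod 𝒜} (f : M ⟶ N) [Mono f] (g : P ⟶ N)
    (hr : ∀ m, g.toLin m ∈ LinearMap.range f.toLin) : ∃ l : P ⟶ M, l ≫ f = g := by
  let e := LinearEquiv.ofInjective f.toLin (injective_of_mono f)
  have h1 : ∀ m, f.toLin (e.symm (g.toLin.codRestrict _ hr m)) = g.toLin m := fun m =>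
    congrArg Subtype.val (e.apply_symm_apply (g.toLin.codRestrict _ hr m))
  refine ⟨⟨e.symm.toLinearMap ∘ₗ g.toLin.codRestrict _ hr, fun x m hm => ?_⟩, by ext m; exact h1 m⟩
  have h2 : M.proj x (e.symm (g.toLin.codRestrict _ hr m)) =
      e.symm (g.toLin.codRestrict _ hr m) := by
    apply injective_of_mono f
    rw [hom_proj, h1, N.proj_of_mem (g.map_mem x m hm)]
  change e.symm (g.toLin.codRestrict _ hr m) ∈ M.comp x
  rw [← h2]
  exact M.proj_mem x _

instance : IsNormalMonoCategory (GrMod 𝒜) where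
  normalMonoOfMono {M N} f _ :=
    have key {P : GrMod 𝒜} (g : P ⟶ N) (hg : g ≫ N.quotπ _ (isHomogeneous_range f) = 0) :
        ∃ l : P ⟶ M, l ≫ f = g := exists_lift f g fun m =>
      (Submodule.Quotient.mk_eq_zero _).1 (LinearMap.congr_fun (congrArg Hom.toLin hg) m)
    ⟨{ Z := N.quot _ (isHomogeneous_range f)
       g := N.quotπ _ (isHomogeneous_range f)
       w := by ext m; exact (Submodule.Quotient.mk_eq_zero _).2 ⟨m, rfl⟩
       isLimit := KernelFork.IsLimit.ofι _ _ (fun g hg => (key g hg).choose)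
        (fun g hg => (key g hg).choose_spec)
        (fun g hg b hb => by rw [← cancel_mono f, hb, (key g hg).choose_spec]) }⟩

instance : IsNormalEpiCategory (GrMod 𝒜) where
  normalEpiOfEpi {M N} f _ :=
    have key {P : GrMod 𝒜} (g : M ⟶ P) (hg : M.subι _ (isHomogeneous_ker f) ≫ g = 0) :
        ∃ l : N ⟶ P, f ≫ l = g := exists_desc f g fun m hm =>
      LinearMap.congr_fun (congrArg Hom.toLin hg) ⟨m, hm⟩
    ⟨{ W := M.sub _ (isHomogeneous_ker f)
       g := M.subι _ (isHomogeneous_ker f)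
       w := by ext m; exact m.2
       isColimit := CokernelCofork.IsColimit.ofπ _ _ (fun g hg => (key g hg).choose)
        (fun g hg => (key g hg).choose_spec)
        (fun g hg b hb => by rw [← cancel_epi f, hb, (key g hg).choose_spec]) }⟩

instance : Abelian (GrMod 𝒜) where

end abelian

end GrMod

/-! ### Simple modules up to isomorphism -/

/-- A simple left module over the `K`-algebra `R`. -/
structure SimpleMod (K : Type u) [Field K] (R : Type v) [Ring R] [Algebra K R] :
    Type (max u (v + 1)) where
  carrier : Type v
  [addCommGroup : AddCommGroup carrier]
  [moduleK : Module K carrier]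
  [module : Module R carrier]
  [isScalarTower : IsScalarTower K R carrier]
  [isSimple : IsSimpleModule R carrier]

attribute [instance] SimpleMod.addCommGroup SimpleMod.moduleK SimpleMod.module
  SimpleMod.isScalarTower SimpleMod.isSimple

instance simpleModSetoid (K : Type u) [Field K] (R : Type v) [Ring R] [Algebra K R] :
    Setoid (SimpleMod K R) where
  r S S' := Nonempty (S.carrier ≃ₗ[R] S'.carrier)
  iseqv := ⟨fun _ => ⟨LinearEquiv.refl _ _⟩, fun ⟨e⟩ => ⟨e.symm⟩, fun ⟨e⟩ ⟨e'⟩ => ⟨e.trans e'⟩⟩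

/-- The set of isomorphism classes of simple left `R`-modules. -/
def Irr (K : Type u) [Field K] (R : Type v) [Ring R] [Algebra K R] : Type (max u (v + 1)) :=
  Quotient (simpleModSetoid K R)

/-- A representative of an isomorphism class of simple modules. -/
noncomputable def Irr.rep {K : Type u} [Field K] {R : Type v} [Ring R] [Algebra K R]
    (lam : Irr K R) : SimpleMod K R := Quotient.out lam

/-! ### The weight poset -/

/-- The submonoid `ℕ I` of `X` generated by the basis `I`. -/
def natCone {X : Type w} [AddCommGroup X] {ι : Type*} (I : Module.Basis ι ℤ X) : AddSubmonoid X :=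
  AddSubmonoid.closure (Set.range I)

theorem natCone_repr_nonneg {X : Type w} [AddCommGroup X] {ι : Type*} (I : Module.Basis ι ℤ X)
    {x : X} (hx : x ∈ natCone I) (i : ι) : 0 ≤ I.repr x i := by
  induction hx using AddSubmonoid.closure_induction with
  | mem x hx =>
    classical
    obtain ⟨j, rfl⟩ := hx
    rw [I.repr_self, Finsupp.single_apply]
    split_ifs <;> simp
  | zero => simp
  | add x y _ _ hx hy => rw [map_add]; exact add_nonneg hx hy

/-- The group `X`, ordered by `v ≤ w` if and only if `w - v ∈ ℕ I`. -/
def Weight {X : Type w} [AddCommGroup X] {ι : Type*} (_ : Module.Basis ι ℤ X) : Type w := X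

instance {X : Type w} [AddCommGroup X] {ι : Type*} (I : Module.Basis ι ℤ X) :
    PartialOrder (Weight I) where
  le v w := (show X from w) - (show X from v) ∈ natCone I
  le_refl v := by
    rw [sub_self]
    exact AddSubmonoid.zero_mem _
  le_trans a b c h1 h2 := by
    have := AddSubmonoid.add_mem _ h2 h1
    rwa [sub_add_sub_cancel] at this
  le_antisymm a b h1 h2 := by
    apply I.repr.injective
    ext i
    have h3 := natCone_repr_nonneg I h1 i
    have h4 := natCone_repr_nonneg I h2 i
    rw [map_sub, Finsupp.sub_apply] at h3 h4
    exact le_antisymm (by linarith) (by linarith)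

/-! ### Triangular decompositions -/

/-- A triangular decomposition `(A⁻, T, A⁺)` of the `X`-graded `K`-algebra `A`, relative to the
basis `I` of `X`. -/
structure TriangularDecomposition {K : Type u} [Field K] {A : Type v} [Ring A] [Algebra K A]
    {X : Type w} [AddCommGroup X] [DecidableEq X] {ι : Type*} (I : Module.Basis ι ℤ X)
    (𝒜 : X → Submodule K A) [GradedAlgebra 𝒜] where
  neg : Subalgebra K A
  T : Subalgebra K A
  pos : Subalgebra K A
  neg_graded : ∀ a ∈ neg, ∀ x, (DirectSum.decompose 𝒜 a x : A) ∈ neg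
  T_graded : ∀ a ∈ T, ∀ x, (DirectSum.decompose 𝒜 a x : A) ∈ T
  pos_graded : ∀ a ∈ pos, ∀ x, (DirectSum.decompose 𝒜 a x : A) ∈ pos
  /-- Multiplication `A⁻ ⊗ T ⊗ A⁺ → A` is an isomorphism of vector spaces. -/
  mul_bijective : Function.Bijective
    (LinearMap.mul' K A ∘ₗ TensorProduct.map
      (LinearMap.mul' K A ∘ₗ TensorProduct.map neg.val.toLinearMap T.val.toLinearMap)
      pos.val.toLinearMap)
  T_degree_zero : ∀ t ∈ T, t ∈ 𝒜 0
  pos_supp : ∀ x, ∀ a ∈ pos, a ∈ 𝒜 x → a ≠ 0 → x ∈ natCone I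
  neg_supp : ∀ x, ∀ a ∈ neg, a ∈ 𝒜 x → a ≠ 0 → -x ∈ natCone I
  neg_zero : Subalgebra.toSubmodule neg ⊓ 𝒜 0 = 1
  pos_zero : Subalgebra.toSubmodule pos ⊓ 𝒜 0 = 1
  pos_mul_T : Subalgebra.toSubmodule pos * Subalgebra.toSubmodule T =
    Subalgebra.toSubmodule T * Subalgebra.toSubmodule pos
  neg_mul_T : Subalgebra.toSubmodule neg * Subalgebra.toSubmodule T =
    Subalgebra.toSubmodule T * Subalgebra.toSubmodule neg
  /-- `T` is split: `End_T(S) = K` for every simple `T`-module `S`. -/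
  T_split : ∀ S : SimpleMod K T,
    Function.Bijective (algebraMap K (Module.End T S.carrier))

namespace TriangularDecomposition

variable {K : Type u} [Field K] {A : Type v} [Ring A] [Algebra K A]
  {X : Type w} [AddCommGroup X] [DecidableEq X] {ι : Type*} {I : Module.Basis ι ℤ X}
  {𝒜 : X → Submodule K A} [GradedAlgebra 𝒜] (𝒯 : TriangularDecomposition I 𝒜)

/-- The positive Borel subalgebra `B⁺ = A⁺ T`. -/
def posBorel : Submodule K A := Subalgebra.toSubmodule 𝒯.pos * Subalgebra.toSubmodule 𝒯.T

section properStandard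

variable (V : Type v) [AddCommGroup V] [Module K V] [Module 𝒯.T V]

/-- The elements `t ⊗ m - 1 ⊗ t m` for `t ∈ T` and `b ⊗ m` for `b ∈ B⁺` homogeneous of nonzero
degree. As `B⁺` is the direct sum of `T` and of its components of nonzero degree, and as the
inflation of `V` to `B⁺` is the action through the projection `B⁺ → T`, the quotient of `A ⊗[K] V`
by the left `A`-submodule generated by these elements is the tensor product over `B⁺` of `A` with
the inflation of `V`. -/
def balancing : Set (A ⊗[K] V) :=
  {z | ∃ (t : 𝒯.T) (m : V), z = (t : A) ⊗ₜ[K] m - (1 : A) ⊗ₜ[K] (t • m)} ∪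
  {z | ∃ x : X, x ≠ 0 ∧ ∃ b ∈ 𝒯.posBorel, b ∈ 𝒜 x ∧ ∃ m : V, z = b ⊗ₜ[K] m}

/-- `A ⊗[K] V` as a graded module, with `V` in degree `d`. -/
noncomputable def inducedMod [FiniteDimensional K V] (d : X) : GrMod 𝒜 where
  carrier := A ⊗[K] V
  comp x := LinearMap.range (LinearMap.rTensor V (𝒜 (x - d)).subtype)
  isInternal := by
    have h := DirectSum.Decomposition.isInternal 𝒜
    refine isInternal_of_proj (fun x => LinearMap.rTensor V (gradingProj 𝒜 h (x - d))) ?_ ?_ ?_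
    · rintro x _ ⟨z, rfl⟩
      induction z with
      | zero => simp
      | tmul a m => simp [gradingProj_of_mem h a.2]
      | add a b ha hb => rw [map_add, map_add, ha, hb]
    · rintro x y hxy _ ⟨z, rfl⟩
      induction z with
      | zero => simp
      | tmul a m =>
        simp [gradingProj_of_mem_ne h (fun e => hxy (sub_left_injective e)) a.2]
      | add a b ha hb => rw [map_add, map_add, ha, hb, add_zero]
    · intro z
      induction z with
      | zero => exact Submodule.zero_mem _
      | tmul a m =>
        refine grading_induction h (p := fun a => a ⊗ₜ[K] m ∈ _) ?_ ?_ ?_ a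
        · rw [TensorProduct.zero_tmul]; exact Submodule.zero_mem _
        · intro a b ha hb
          rw [TensorProduct.add_tmul]
          exact Submodule.add_mem _ ha hb
        · intro x a ha
          refine Submodule.mem_iSup_of_mem (x + d) ⟨(⟨a, ?_⟩ : 𝒜 (x + d - d)) ⊗ₜ[K] m, rfl⟩
          rwa [add_sub_cancel_right]
      | add a b ha hb => exact Submodule.add_mem _ ha hb
  smul_mem := by
    rintro x y a ha _ ⟨z, rfl⟩
    induction z with
    | zero => rw [map_zero, smul_zero]; exact Submodule.zero_mem _
    | tmul b m =>
      refine ⟨(⟨a * b, ?_⟩ : 𝒜 (x + y - d)) ⊗ₜ[K] m, rfl⟩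
      rw [add_sub_assoc]
      exact SetLike.mul_mem_graded ha b.2
    | add b c hb hc => rw [map_add, smul_add]; exact Submodule.add_mem _ hb hc

theorem isHomogeneous_span_balancing [FiniteDimensional K V] (d : X) :
    (inducedMod (𝒜 := 𝒜) V d).IsHomogeneous (Submodule.span A (𝒯.balancing V)) := by
  have hmem : ∀ (x : X) (b : A), b ∈ 𝒜 x → ∀ m : V,
      (b ⊗ₜ[K] m : A ⊗[K] V) ∈ (inducedMod (𝒜 := 𝒜) V d).comp (x + d) := by
    intro x b hb m
    exact ⟨(⟨b, by rwa [add_sub_cancel_right]⟩ : 𝒜 (x + d - d)) ⊗ₜ[K] m, rfl⟩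
  have hhom : ∀ z ∈ 𝒯.balancing V, ∃ x, z ∈ (inducedMod (𝒜 := 𝒜) V d).comp x := by
    rintro z (⟨t, m, rfl⟩ | ⟨x, -, b, -, hb, m, rfl⟩)
    · exact ⟨0 + d, Submodule.sub_mem _ (hmem 0 _ (𝒯.T_degree_zero _ t.2) m)
        (hmem 0 _ SetLike.GradedOne.one_mem _)⟩
    · exact ⟨x + d, hmem x b hb m⟩
  intro z hz
  induction hz using Submodule.span_induction with
  | mem z hz =>
    obtain ⟨x, hx⟩ := hhom z hz
    intro y
    by_cases h : x = y
    · subst h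
      rw [GrMod.proj_of_mem _ hx]
      exact Submodule.subset_span hz
    · rw [GrMod.proj_of_mem_ne _ h hx]
      exact Submodule.zero_mem _
  | zero => intro y; rw [map_zero]; exact Submodule.zero_mem _
  | add a b _ _ ha hb => intro y; rw [map_add]; exact Submodule.add_mem _ (ha y) (hb y)
  | smul a z _ hz =>
    intro y
    refine grading_induction (DirectSum.Decomposition.isInternal 𝒜)
      (p := fun a => (inducedMod (𝒜 := 𝒜) V d).proj y (a • z) ∈ _) ?_ ?_ ?_ a
    · rw [zero_smul, map_zero]; exact Submodule.zero_mem _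
    · intro a b ha hb
      rw [add_smul, map_add]
      exact Submodule.add_mem _ ha hb
    · intro x a ha
      rw [GrMod.proj_smul _ ha]
      exact Submodule.smul_mem _ _ (hz _)

/-- The proper standard module `A ⊗_{B⁺} V`, where `V` is a finite-dimensional `T`-module placed
in degree `d`. -/
noncomputable def properStandard [FiniteDimensional K V] (d : X) : GrMod 𝒜 :=
  (inducedMod (𝒜 := 𝒜) V d).quot (Submodule.span A (𝒯.balancing V))
    (𝒯.isHomogeneous_span_balancing V d)

end properStandard

theorem finite_simple [FiniteDimensional K A] (S : SimpleMod K 𝒯.T) :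
    FiniteDimensional K S.carrier :=
  Module.Finite.trans (R := K) 𝒯.T S.carrier

/-- The set `Irr T × X` of labels of simple graded modules. -/
@[ext]
structure Label where
  type : Irr K 𝒯.T
  weight : X

variable {𝒯} in
/-- The weight of a label as an element of the poset of weights. -/
def Label.degree (l : 𝒯.Label) : Weight I := l.weight

/-- `(μ, v) ≺ (λ, w)` if and only if `w - v ∈ ℕ I` and `v ≠ w`. -/
instance : PartialOrder 𝒯.Label where
  le l l' := l = l' ∨ l.degree < l'.degree
  lt l l' := l.degree < l'.degree
  lt_iff_le_not_ge a b := by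
    constructor
    · intro h
      refine ⟨Or.inr h, ?_⟩
      rintro (rfl | h')
      exacts [lt_irrefl _ h, lt_irrefl _ (h.trans h')]
    · rintro ⟨rfl | h, h'⟩
      exacts [absurd (Or.inl rfl) h', h]
  le_refl l := Or.inl rfl
  le_trans a b c := by
    rintro (rfl | h) (rfl | h')
    exacts [Or.inl rfl, Or.inr h', Or.inr h, Or.inr (h.trans h')]
  le_antisymm a b := by
    rintro (rfl | h) (h' | h')
    exacts [rfl, rfl, h'.symm, absurd (h.trans h') (lt_irrefl _)]

/-- The graded `A`-module `L(λ, w)`: the head of the proper standard module `Δ̄(λ[w])`. -/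
noncomputable def simple [FiniteDimensional K A] (l : 𝒯.Label) : GrMod 𝒜 :=
  have := 𝒯.finite_simple l.type.rep
  (𝒯.properStandard l.type.rep.carrier l.weight).head

end TriangularDecomposition

/-! ### Serre subcategories and layers -/

section stratification

universe v₁ u₁

variable {C : Type u₁} [Category.{v₁} C] [Abelian C]

/-- The Serre subcategory spanned by a class of objects. -/
def serreSpan (Q : ObjectProperty C) : ObjectProperty C :=
  fun M => ∀ P : ObjectProperty C, P.IsSerreClass → Q ≤ P → P M

instance (Q : ObjectProperty C) : (serreSpan Q).IsSerreClass where
  exists_zero := by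
    obtain ⟨Z, hZ⟩ := HasZeroObject.zero (C := C)
    exact ⟨Z, hZ, fun P _ _ => P.prop_of_isZero hZ⟩
  prop_of_mono f _ h := fun P hP hQ => P.prop_of_mono f (h P hP hQ)
  prop_of_epi f _ h := fun P hP hQ => P.prop_of_epi f (h P hP hQ)
  prop_X₂_of_shortExact hS h₁ h₃ := fun P hP hQ =>
    P.prop_X₂_of_shortExact hS (h₁ P hP hQ) (h₃ P hP hQ)

instance (P : ObjectProperty C) [P.IsSerreClass] : P.IsClosedUnderBinaryProducts where
  limitsOfShape_le := by
    rintro X ⟨p⟩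
    have : HasBinaryBiproducts C := Abelian.hasBinaryBiproducts
    refine P.prop_of_iso ?_ (P.prop_biprod
      (p.prop_diag_obj (.mk .left)) (p.prop_diag_obj (.mk .right)))
    exact (biprod.isoProd _ _).trans (IsLimit.conePointUniqueUpToIso (prodIsProd _ _)
      ((IsLimit.postcomposeHomEquiv (diagramIsoPair p.diag) _).2 p.isLimit))

instance (P : ObjectProperty C) [P.IsSerreClass] : P.IsClosedUnderFiniteProducts := .mk'

instance (P : ObjectProperty C) [P.IsSerreClass] : PreservesFiniteLimits P.ι := by
  rw [((Functor.preservesFiniteLimits_tfae P.ι).out 3 2 :)]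
  intro _ _ f
  exact P.preservesKernels_ι f

instance (P : ObjectProperty C) [P.IsSerreClass] : PreservesFiniteColimits P.ι := by
  rw [((Functor.preservesFiniteColimits_tfae P.ι).out 3 2 :)]
  intro _ _ f
  exact P.preservesCokernels_ι f

variable {Λ Ξ : Type*} [PartialOrder Λ] [PartialOrder Ξ] (L : Λ → C) (d : Λ → Ξ)

/-- The Serre subcategory `C_{≤ ξ}` spanned by the `L λ` with `d λ ≤ ξ`. -/
def serreLE (ξ : Ξ) : ObjectProperty C :=
  serreSpan (fun M => ∃ l, d l ≤ ξ ∧ M = L l)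

/-- The Serre subcategory `C_{< ξ}` spanned by the `L λ` with `d λ < ξ`. -/
def serreLT (ξ : Ξ) : ObjectProperty C :=
  serreSpan (fun M => ∃ l, d l < ξ ∧ M = L l)

instance (ξ : Ξ) : (serreLE L d ξ).IsSerreClass := by unfold serreLE; infer_instance

instance (ξ : Ξ) : (serreLT L d ξ).IsSerreClass := by unfold serreLT; infer_instance

/-- The full subcategory `C_{≤ ξ}`. -/
abbrev SubcategoryLE (ξ : Ξ) := (serreLE L d ξ).FullSubcategory

/-- The subcategory `C_{< ξ}`, as a Serre subcategory of `C_{≤ ξ}`. -/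
abbrev serreLTInLE (ξ : Ξ) : ObjectProperty (SubcategoryLE L d ξ) :=
  (serreLT L d ξ).inverseImage (serreLE L d ξ).ι

/-- The layer `C_ξ`: the Serre quotient of `C_{≤ ξ}` by `C_{< ξ}`. -/
abbrev Layer (ξ : Ξ) := (serreLTInLE L d ξ).isoModSerre.Localization

/-- The quotient functor `C_{≤ ξ} ⥤ C_ξ`. -/
abbrev layerQ (ξ : Ξ) : SubcategoryLE L d ξ ⥤ Layer L d ξ :=
  (serreLTInLE L d ξ).isoModSerre.Q

/-- `L λ` as an object of `C_{≤ d λ}`. -/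
def simpleLE (l : Λ) : SubcategoryLE L d (d l) :=
  ⟨L l, fun _ _ hQ => hQ _ ⟨l, le_rfl, rfl⟩⟩

/-- The object `L_ξ(λ)` of the layer `C_ξ`, where `ξ = d λ`. -/
def layerSimple (l : Λ) : Layer L d (d l) := (layerQ L d (d l)).obj (simpleLE L d l)

/-- `p : P ⟶ M` is a projective cover: an essential epimorphism from a projective object. -/
structure IsProjectiveCover {D : Type*} [Category* D] {P M : D} (p : P ⟶ M) : Prop where
  projective : Projective P
  epi : Epi p
  essential : ∀ {N : D} (f : N ⟶ P), Epi (f ≫ p) → Epi f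

/-- `IsFilteredBy Q M`: the object `M` has a finite filtration with subquotients satisfying `Q`. -/
inductive IsFilteredBy (Q : ObjectProperty C) : C → Prop
  | zero {M : C} (h : IsZero M) : IsFilteredBy Q M
  | step {S : ShortComplex C} (hS : S.ShortExact) (h₁ : IsFilteredBy Q S.X₁) (h₃ : Q S.X₃) :
      IsFilteredBy Q S.X₂

variable (K : Type*) [Field K] [Linear K C]

/-- The structure of a standardly stratified category on the `K`-linear abelian category `C`, with
simple objects `L λ` labelled by the poset `Λ`, with respect to the map `d : Λ → Ξ`. -/
structure StandardStratification where
  finite_length : ∀ M : C, IsNoetherianObject M ∧ IsArtinianObject M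
  enoughProjectives : EnoughProjectives C
  simple : ∀ l, Simple (L l)
  simple_injective : ∀ l l', Nonempty (L l ≅ L l') → l = l'
  simple_surjective : ∀ M : C, Simple M → ∃ l, Nonempty (M ≅ L l)
  /-- Simple objects are absolutely simple: their endomorphism ring is `K`. -/
  end_simple : ∀ M : C, Simple M → Function.Bijective (algebraMap K (End M))
  interval_finite : ∀ a b : Ξ, (Set.Icc a b).Finite
  finite_fibers : ∀ ξ : Ξ, (d ⁻¹' {ξ}).Finite
  lt_iff : ∀ l l' : Λ, l < l' ↔ d l < d l'
  /-- The standardization functor `C_ξ ⥤ C_{≤ ξ}`. -/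
  standardization (ξ : Ξ) : Layer L d ξ ⥤ SubcategoryLE L d ξ
  adj (ξ : Ξ) : standardization ξ ⊣ layerQ L d ξ
  standardization_left_exact : ∀ ξ, PreservesFiniteLimits (standardization ξ)
  standardization_right_exact : ∀ ξ, PreservesFiniteColimits (standardization ξ)
  /-- The projective cover `P_ξ(λ)` of `L_ξ(λ)` in the layer `C_ξ`, where `ξ = d λ`. -/
  layerProj (l : Λ) : Layer L d (d l)
  layerCover (l : Λ) : layerProj l ⟶ layerSimple L d l
  isProjectiveCover_layerCover : ∀ l, IsProjectiveCover (layerCover l)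
  /-- The projective cover `P(λ)` of `L(λ)` in `C`. -/
  proj (l : Λ) : C
  cover (l : Λ) : proj l ⟶ L l
  isProjectiveCover_cover : ∀ l, IsProjectiveCover (cover l)
  /-- There is an epimorphism from `P(λ)` onto the standard object `Δ(λ) = Δ_ξ(P_ξ(λ))`, whose
  kernel is filtered by standard objects `Δ(μ)` with `μ > λ`. -/
  exists_filtration : ∀ l : Λ,
    ∃ p : proj l ⟶ ((standardization (d l)).obj (layerProj l)).obj, Epi p ∧
      IsFilteredBy (fun M => ∃ m : Λ, l < m ∧
        Nonempty (M ≅ ((standardization (d m)).obj (layerProj m)).obj)) (kernel p)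

namespace StandardStratification

variable {L d K} (S : StandardStratification L d K)

/-- The standard object `Δ(λ)`. -/
def standard (l : Λ) : C := ((S.standardization (d l)).obj (S.layerProj l)).obj

/-- The proper standard object `Δ̄(λ)`. -/
def properStandard (l : Λ) : C := ((S.standardization (d l)).obj (layerSimple L d l)).obj

/-- The canonical morphism `Δ(λ) ⟶ Δ̄(λ)`. -/
def standardToProper (l : Λ) : S.standard l ⟶ S.properStandard l :=
  ((S.standardization (d l)).map (S.layerCover l)).hom

end StandardStratification

/-- The `K`-linear abelian category `C`, with simple objects `L λ` labelled by the poset `Λ`, is a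
highest weight category with standard objects `Δ λ`. -/
structure IsHighestWeight (Δ : Λ → C) : Prop where
  finite_length : ∀ M : C, IsNoetherianObject M ∧ IsArtinianObject M
  enoughProjectives : EnoughProjectives C
  interval_finite : ∀ l l' : Λ, (Set.Icc l l').Finite
  simple : ∀ l, Simple (L l)
  simple_injective : ∀ l l', Nonempty (L l ≅ L l') → l = l'
  simple_surjective : ∀ M : C, Simple M → ∃ l, Nonempty (M ≅ L l)
  finite_hom : ∀ l l', Module.Finite K (Δ l ⟶ Δ l')
  /-- `Δ(λ)` has a quotient `L(λ)`, and the kernel has composition factors `L(μ)` with `μ < λ`. -/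
  standard_top : ∀ l, ∃ q : Δ l ⟶ L l, Epi q ∧
    serreSpan (fun M => ∃ m, m < l ∧ M = L m) (kernel q)
  /-- The projective cover of `L(λ)` has a quotient `Δ(λ)`, and the kernel is filtered by the
  `Δ(μ)` with `μ > λ`. -/
  standard_filtration : ∀ l, ∃ (P : C) (c : P ⟶ L l), IsProjectiveCover c ∧
    ∃ p : P ⟶ Δ l, Epi p ∧
      IsFilteredBy (fun M => ∃ m, l < m ∧ Nonempty (M ≅ Δ m)) (kernel p)

end stratification

/-! ### Algebra of triangular decompositions -/

/-! Everything rests on the vector space isomorphism `A ⊗_{B⁺} V ≅ A⁻ ⊗_K V`, obtained from `n b ⊗ v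
↦ n ⊗ b₀ v`, where `b₀ ∈ T` is the degree-zero part of `b ∈ B⁺` (`properStandardEquiv`). Write
`Δ(V)` for this module, with `V` in degree `d`. All its degrees are `≤ d`, its component of degree
`d` is `V`, and it depends exactly on `V` because `A⁻` is flat over the field `K`.

Highest weight theory classifies the simple objects. If `V` is simple, a proper homogeneous
submodule of `Δ(V)` vanishes in degree `d`, so there is a largest one (`rad_properStandard`).
Conversely, a simple submodule of the component of a simple graded module at a maximal degree is
killed by the positive part, which gives a surjection from some `Δ(V)`. An endomorphism is
determined on the top component, so splitness of `T` makes it a scalar.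

For the strata, `C_{≤ ξ}` consists of the modules with all degrees `≤ ξ`. There `M ↦ M_ξ` is exact
with kernel `C_{< ξ}`, and `Δ` is a left adjoint with invertible unit. Hence this functor is a
localization (`weightLE_isLocalization`), the layer is the category of finitely generated
`T`-modules, and standardization is `Δ`.

The filtration of `P(λ, w)` comes from counting dimensions. Nakayama's lemma for `A⁻` gives `dim M ≤
dim A⁻ · dim (M / A⁻_{<0} M)` for every `M`. Consider the modules for which equality holds and `M /
A⁻_{<0} M` is projective over `T` (`IsNegProjective`). The modules `A ⊗_K V` are of this kind, and
so are their direct summands, such as `P(λ, w)`. If `ξ` is a maximal degree of such an `M`, the same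
count shows that `M_ξ` is projective over `T`, that it generates a copy of `Δ(M_ξ)`, and that the
quotient is again of this kind (`IsNegProjective.quot_topMap`). Peeling off such pieces filters the
submodule generated by all degrees not `≤ w` (`isFilteredBy_upper`); the degrees used are `> w`
because `P(λ, w)` is generated over `A⁻` in degrees `≥ w`. That submodule is the kernel of `P(λ, w)
⟶ Δ(λ, w)`, since `Δ(λ, w)` is projective in `C_{≤ w}` (`ker_eq_upper`).

If `T` is semisimple, projective covers of `T`-modules are isomorphisms, so standard and proper
standard objects agree, and `Δ(λ, w) ⟶ L(λ, w)` is injective in degree `w`. -/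

theorem natCone_neg_eq_zero {X : Type w} [AddCommGroup X] {ι : Type*} (I : Module.Basis ι ℤ X)
    {x : X} (h1 : x ∈ natCone I) (h2 : -x ∈ natCone I) : x = 0 := by
  apply I.repr.injective
  ext i
  have h3 := natCone_repr_nonneg I h1 i
  have h4 := natCone_repr_nonneg I h2 i
  rw [map_neg, Finsupp.neg_apply] at h4
  rw [map_zero, Finsupp.zero_apply]
  linarith

namespace TriangularDecomposition

variable {K : Type u} [Field K] {A : Type v} [Ring A] [Algebra K A]
  {X : Type w} [AddCommGroup X] [DecidableEq X] {ι : Type*} {I : Module.Basis ι ℤ X}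
  {𝒜 : X → Submodule K A} [GradedAlgebra 𝒜] (𝒯 : TriangularDecomposition I 𝒜)

theorem mul_mem_posBorel {p t : A} (hp : p ∈ 𝒯.pos) (ht : t ∈ 𝒯.T) : p * t ∈ 𝒯.posBorel :=
  Submodule.mul_mem_mul hp ht

theorem posBorel_eq : 𝒯.posBorel = Subalgebra.toSubmodule 𝒯.T * Subalgebra.toSubmodule 𝒯.pos :=
  𝒯.pos_mul_T

theorem T_mul_pos_mem_posBorel {t p : A} (ht : t ∈ 𝒯.T) (hp : p ∈ 𝒯.pos) :
    t * p ∈ 𝒯.posBorel := by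
  rw [posBorel_eq]
  exact Submodule.mul_mem_mul ht hp

theorem pos_le_posBorel {p : A} (hp : p ∈ 𝒯.pos) : p ∈ 𝒯.posBorel := by
  simpa using 𝒯.mul_mem_posBorel hp 𝒯.T.one_mem

theorem T_le_posBorel {t : A} (ht : t ∈ 𝒯.T) : t ∈ 𝒯.posBorel := by
  simpa using 𝒯.mul_mem_posBorel 𝒯.pos.one_mem ht

/-- Induction on `B⁺ = T A⁺`. -/
theorem posBorel_induction {p : A → Prop} (hmul : ∀ t ∈ 𝒯.T, ∀ q ∈ 𝒯.pos, p (t * q))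
    (hadd : ∀ a b, p a → p b → p (a + b)) {b : A} (hb : b ∈ 𝒯.posBorel) : p b := by
  rw [posBorel_eq] at hb
  exact Submodule.mul_induction_on hb hmul hadd

/-- The exchange relation makes `B⁺` closed under products: `A⁺T · TA⁺ = A⁺TA⁺ = A⁺A⁺T = A⁺T`. -/
theorem posBorel_mul_mem {b c : A} (hb : b ∈ 𝒯.posBorel) (hc : c ∈ 𝒯.posBorel) :
    b * c ∈ 𝒯.posBorel := by
  have h : 𝒯.posBorel * 𝒯.posBorel ≤ 𝒯.posBorel := by
    have h1 : Subalgebra.toSubmodule 𝒯.pos * Subalgebra.toSubmodule 𝒯.pos =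
        Subalgebra.toSubmodule 𝒯.pos := Subalgebra.isIdempotentElem_toSubmodule _
    have h2 : Subalgebra.toSubmodule 𝒯.T * Subalgebra.toSubmodule 𝒯.T =
        Subalgebra.toSubmodule 𝒯.T := Subalgebra.isIdempotentElem_toSubmodule _
    nth_rewrite 2 [posBorel_eq]
    unfold posBorel
    rw [mul_assoc, ← mul_assoc (Subalgebra.toSubmodule 𝒯.T), h2, ← 𝒯.pos_mul_T, ← mul_assoc, h1]
  exact h (Submodule.mul_mem_mul hb hc)

theorem decompose_T_mul {t a : A} (ht : t ∈ 𝒯.T) (x : X) :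
    (DirectSum.decompose 𝒜 (t * a) x : A) = t * DirectSum.decompose 𝒜 a x :=
  DirectSum.coe_decompose_mul_of_left_mem_zero 𝒜 (𝒯.T_degree_zero t ht)

theorem posBorel_graded {b : A} (hb : b ∈ 𝒯.posBorel) (x : X) :
    (DirectSum.decompose 𝒜 b x : A) ∈ 𝒯.posBorel := by
  refine 𝒯.posBorel_induction (p := fun b => (DirectSum.decompose 𝒜 b x : A) ∈ 𝒯.posBorel)
    (fun t ht q hq => ?_) (fun a b ha hb => ?_) hb
  · rw [𝒯.decompose_T_mul ht]
    exact 𝒯.T_mul_pos_mem_posBorel ht (𝒯.pos_graded q hq x)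
  · rw [DirectSum.decompose_add, DirectSum.add_apply, Submodule.coe_add]
    exact Submodule.add_mem _ ha hb

theorem decompose_posBorel_eq_zero {b : A} (hb : b ∈ 𝒯.posBorel) {x : X} (hx : x ∉ natCone I) :
    (DirectSum.decompose 𝒜 b x : A) = 0 := by
  refine 𝒯.posBorel_induction (p := fun b => (DirectSum.decompose 𝒜 b x : A) = 0)
    (fun t ht q hq => ?_) (fun a b ha hb => ?_) hb
  · rw [𝒯.decompose_T_mul ht]
    by_contra h
    exact hx (𝒯.pos_supp x _ (𝒯.pos_graded q hq x) (SetLike.coe_mem _)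
      (fun h' => h (by rw [h', mul_zero])))
  · rw [DirectSum.decompose_add, DirectSum.add_apply, Submodule.coe_add, ha, hb, add_zero]

theorem posBorel_supp {b : A} (hb : b ∈ 𝒯.posBorel) {x : X} (hbx : b ∈ 𝒜 x) (hb0 : b ≠ 0) :
    x ∈ natCone I := by
  by_contra h
  exact hb0 (by rw [← DirectSum.decompose_of_mem_same 𝒜 hbx, 𝒯.decompose_posBorel_eq_zero hb h])

theorem decompose_pos_zero_mem {p : A} (hp : p ∈ 𝒯.pos) :
    (DirectSum.decompose 𝒜 p 0 : A) ∈ 𝒯.T := by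
  have h : (DirectSum.decompose 𝒜 p 0 : A) ∈ (1 : Submodule K A) := by
    rw [← 𝒯.pos_zero]
    exact ⟨𝒯.pos_graded p hp 0, SetLike.coe_mem _⟩
  obtain ⟨k, hk⟩ := Submodule.mem_one.1 h
  rw [← hk]
  exact 𝒯.T.algebraMap_mem k

theorem decompose_posBorel_zero_mem {b : A} (hb : b ∈ 𝒯.posBorel) :
    (DirectSum.decompose 𝒜 b 0 : A) ∈ 𝒯.T := by
  refine 𝒯.posBorel_induction (p := fun b => (DirectSum.decompose 𝒜 b 0 : A) ∈ 𝒯.T)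
    (fun t ht q hq => ?_) (fun a b ha hb => ?_) hb
  · rw [𝒯.decompose_T_mul ht]
    exact 𝒯.T.mul_mem ht (𝒯.decompose_pos_zero_mem hq)
  · rw [DirectSum.decompose_add, DirectSum.add_apply, Submodule.coe_add]
    exact 𝒯.T.add_mem ha hb

/-- The projection `B⁺ → B⁺₀ = T`. -/
noncomputable def posBorelToT : 𝒯.posBorel →ₗ[K] 𝒯.T :=
  ((GradedAlgebra.proj 𝒜 0).domRestrict 𝒯.posBorel).codRestrict (Subalgebra.toSubmodule 𝒯.T)
    (fun b => 𝒯.decompose_posBorel_zero_mem b.2)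

@[simp] theorem coe_posBorelToT (b : 𝒯.posBorel) :
    (𝒯.posBorelToT b : A) = DirectSum.decompose 𝒜 (b : A) 0 := rfl

/-- The degree-zero part of `b c` is `b_{-x} c`. If it were nonzero, both `x` and `-x` would lie in
the cone, which is pointed. So the projection `B⁺ → T` kills such products, as needed for the second
kind of balancing relations. -/
theorem decompose_eq_zero_of_mul_ne_zero {b c : A} (hb : b ∈ 𝒯.posBorel) (hc : c ∈ 𝒯.posBorel)
    {x : X} (hx : x ≠ 0) (hcx : c ∈ 𝒜 x) :
    (DirectSum.decompose 𝒜 (b * c) 0 : A) = 0 := by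
  classical
  by_cases hc0 : c = 0
  · simp [hc0]
  have h : (0 : X) = -x + x := by simp
  rw [h, DirectSum.coe_decompose_mul_add_of_right_mem 𝒜 hcx,
    𝒯.decompose_posBorel_eq_zero hb, zero_mul]
  exact fun h' => hx (natCone_neg_eq_zero I (𝒯.posBorel_supp hc hcx hc0) h')

/-- Induction on `A = A⁻ B⁺`. -/
theorem mul_induction {p : A → Prop} (hmul : ∀ n ∈ 𝒯.neg, ∀ b ∈ 𝒯.posBorel, p (n * b))
    (hadd : ∀ a b, p a → p b → p (a + b)) (a : A) : p a := by
  obtain ⟨z, rfl⟩ := 𝒯.mul_bijective.2 a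
  induction z with
  | zero => simpa using hmul 0 𝒯.neg.zero_mem 0 (Submodule.zero_mem _)
  | add x y hx hy => rw [map_add]; exact hadd _ _ hx hy
  | tmul y q =>
    induction y with
    | zero => simpa using hmul 0 𝒯.neg.zero_mem 0 (Submodule.zero_mem _)
    | add x y hx hy => rw [TensorProduct.add_tmul, map_add]; exact hadd _ _ hx hy
    | tmul n t =>
      simpa [mul_assoc] using
        hmul n n.2 (t * q) (𝒯.T_mul_pos_mem_posBorel t.2 q.2)

/-- The projection `A ≅ A⁻ ⊗ T ⊗ A⁺ → A⁻ ⊗ T` that is induced by `A⁺ → A⁺₀ = K`. -/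
noncomputable def toNegT : A →ₗ[K] 𝒯.neg ⊗[K] 𝒯.T :=
  LinearMap.lTensor 𝒯.neg (LinearMap.mul' K 𝒯.T ∘ₗ LinearMap.lTensor 𝒯.T
    (𝒯.posBorelToT ∘ₗ (Subalgebra.toSubmodule 𝒯.pos).inclusion
      (fun _ hp => 𝒯.pos_le_posBorel hp))) ∘ₗ
    (TensorProduct.assoc K 𝒯.neg 𝒯.T 𝒯.pos).toLinearMap ∘ₗ
    (LinearEquiv.ofBijective _ 𝒯.mul_bijective).symm.toLinearMap

/-- On `T A⁺` the degree-zero part of `t q` is `t q₀`, which is what the map reads off from `n ⊗ t ⊗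
q`. -/
theorem toNegT_mul (n : 𝒯.neg) (b : 𝒯.posBorel) :
    𝒯.toNegT (n * b) = n ⊗ₜ 𝒯.posBorelToT b := by
  obtain ⟨b, hb⟩ := b
  -- The membership proof is packed into the predicate, so that induction over `B⁺` applies to a
  -- statement about the subtype.
  suffices h : ∃ hb, 𝒯.toNegT (n * b) = n ⊗ₜ 𝒯.posBorelToT ⟨b, hb⟩ by exact h.2
  refine 𝒯.posBorel_induction (p := fun b => ∃ hb, 𝒯.toNegT (n * b) = n ⊗ₜ 𝒯.posBorelToT ⟨b, hb⟩)
    (fun t ht q hq => ?_) ?_ hb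
  · refine ⟨𝒯.T_mul_pos_mem_posBorel ht hq, ?_⟩
    have h : (LinearEquiv.ofBijective _ 𝒯.mul_bijective).symm (n * (t * q)) =
        (n ⊗ₜ ⟨t, ht⟩) ⊗ₜ ⟨q, hq⟩ := by
      rw [LinearEquiv.symm_apply_eq]
      simp [mul_assoc]
    simp only [toNegT, LinearMap.comp_apply, LinearEquiv.coe_coe, h, TensorProduct.assoc_tmul,
      LinearMap.lTensor_tmul, LinearMap.mul'_apply]
    congr 1
    apply Subtype.ext
    simp [-DirectSum.decompose_mul, 𝒯.decompose_T_mul ht]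
  · rintro a b ⟨ha, ha'⟩ ⟨hb, hb'⟩
    refine ⟨Submodule.add_mem _ ha hb, ?_⟩
    rw [mul_add, map_add, ha', hb', ← TensorProduct.tmul_add, ← map_add]
    rfl

section module

variable (V : Type v) [AddCommGroup V] [Module K V] [Module 𝒯.T V] [IsScalarTower K 𝒯.T V]

/-- The map `A ⊗ V → A⁻ ⊗ V`, `n b ⊗ v ↦ n ⊗ b₀ v`. -/
noncomputable def toNegTensor : A ⊗[K] V →ₗ[K] 𝒯.neg ⊗[K] V :=
  LinearMap.lTensor 𝒯.neg (TensorProduct.lift (Algebra.lsmul K K V (A := 𝒯.T)).toLinearMap) ∘ₗ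
    (TensorProduct.assoc K 𝒯.neg 𝒯.T V).toLinearMap ∘ₗ LinearMap.rTensor V 𝒯.toNegT

theorem toNegTensor_tmul {n b : A} (hn : n ∈ 𝒯.neg) (hb : b ∈ 𝒯.posBorel) (v : V) :
    𝒯.toNegTensor V ((n * b) ⊗ₜ v) = ⟨n, hn⟩ ⊗ₜ (𝒯.posBorelToT ⟨b, hb⟩ • v) := by
  have := 𝒯.toNegT_mul ⟨n, hn⟩ ⟨b, hb⟩
  simp only at this
  simp [toNegTensor, this]

/-- With `a = n b`, the relation for `t ∈ T` dies because `(b t)₀ = b₀ t`, and the relation for `c ∈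
B⁺` of nonzero degree dies because `(b c)₀ = 0`. -/
theorem toNegTensor_smul_balancing (a : A) {z : A ⊗[K] V} (hz : z ∈ 𝒯.balancing V) :
    𝒯.toNegTensor V (a • z) = 0 := by
  refine 𝒯.mul_induction (p := fun a => 𝒯.toNegTensor V (a • z) = 0) (fun n hn b hb => ?_)
    (fun a b ha hb => by rw [add_smul, map_add, ha, hb, add_zero]) a
  rcases hz with ⟨t, m, rfl⟩ | ⟨x, hx, c, hc, hcx, m, rfl⟩
  · rw [smul_sub, TensorProduct.smul_tmul', TensorProduct.smul_tmul', smul_eq_mul, smul_eq_mul,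
      mul_one, mul_assoc, map_sub, 𝒯.toNegTensor_tmul V hn hb,
      𝒯.toNegTensor_tmul V hn (𝒯.posBorel_mul_mem hb (𝒯.T_le_posBorel t.2)), sub_eq_zero, smul_smul]
    congr 2
    apply Subtype.ext
    simp [-DirectSum.decompose_mul, DirectSum.coe_decompose_mul_of_right_mem_zero 𝒜 (𝒯.T_degree_zero t t.2)]
  · rw [TensorProduct.smul_tmul', smul_eq_mul, mul_assoc,
      𝒯.toNegTensor_tmul V hn (𝒯.posBorel_mul_mem hb hc)]
    have : 𝒯.posBorelToT ⟨b * c, 𝒯.posBorel_mul_mem hb hc⟩ = 0 :=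
      Subtype.ext (𝒯.decompose_eq_zero_of_mul_ne_zero hb hc hx hcx)
    rw [this, zero_smul, TensorProduct.tmul_zero]

theorem toNegTensor_eq_zero {z : A ⊗[K] V} (hz : z ∈ Submodule.span A (𝒯.balancing V)) :
    𝒯.toNegTensor V z = 0 := by
  -- The map is only `K`-linear, so induction over an `A`-span needs the claim for all multiples at
  -- once.
  suffices h : ∀ a : A, 𝒯.toNegTensor V (a • z) = 0 by simpa using h 1
  induction hz using Submodule.span_induction with
  | mem z hz => exact fun a => 𝒯.toNegTensor_smul_balancing V a hz
  | zero => simp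
  | add x y _ _ hx hy => intro a; rw [smul_add, map_add, hx, hy, add_zero]
  | smul c x _ hx => intro a; rw [smul_smul]; exact hx _

end module

end TriangularDecomposition

/-! ### Graded modules -/

namespace GrMod

variable {K : Type u} [Field K] {A : Type v} [Ring A] [Algebra K A] {X : Type w}
  [AddCommGroup X] [DecidableEq X] {𝒜 : X → Submodule K A}

theorem congr_toLin {M N : GrMod 𝒜} {f g : M ⟶ N} (h : f = g) (m : M.carrier) :
    f.toLin m = g.toLin m := by rw [h]

/-- The underlying `K`-linear map of a morphism of graded modules. -/
def Hom.toLinK {M N : GrMod 𝒜} (f : M ⟶ N) : M.carrier →ₗ[K] N.carrier :=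
  f.toLin.restrictScalars K

theorem epi_of_surjective {M N : GrMod 𝒜} (f : M ⟶ N) (hf : Function.Surjective f.toLin) :
    Epi f where
  left_cancellation g h e := by
    ext n
    obtain ⟨m, rfl⟩ := hf n
    exact congr_toLin e m

theorem mono_of_injective {M N : GrMod 𝒜} (f : M ⟶ N) (hf : Function.Injective f.toLin) :
    Mono f where
  right_cancellation g h e := by
    ext m
    exact hf (congr_toLin e m)

theorem exists_preimage_mem {M N : GrMod 𝒜} (f : M ⟶ N) (hf : Function.Surjective f.toLin)
    {x : X} {n : N.carrier} (hn : n ∈ N.comp x) : ∃ m ∈ M.comp x, f.toLin m = n := by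
  obtain ⟨m, rfl⟩ := hf n
  exact ⟨M.proj x m, M.proj_mem x m, by rw [hom_proj, N.proj_of_mem hn]⟩

theorem mem_of_injective {M N : GrMod 𝒜} (f : M ⟶ N) (hf : Function.Injective f.toLin)
    {x : X} {m : M.carrier} (hm : f.toLin m ∈ N.comp x) : m ∈ M.comp x := by
  have : M.proj x m = m := hf (by rw [hom_proj, N.proj_of_mem hm])
  rw [← this]
  exact M.proj_mem x m

/-- A bijective morphism of graded modules is an isomorphism. -/
noncomputable def isoOfBijective {M N : GrMod 𝒜} (f : M ⟶ N) (hf : Function.Bijective f.toLin) :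
    M ≅ N where
  hom := f
  inv := ⟨(LinearEquiv.ofBijective f.toLin hf).symm.toLinearMap, fun x n hn => by
    obtain ⟨m, hm, rfl⟩ := exists_preimage_mem f hf.2 hn
    convert hm
    exact (LinearEquiv.ofBijective f.toLin hf).symm_apply_apply m⟩
  hom_inv_id := by
    ext m
    exact (LinearEquiv.ofBijective f.toLin hf).symm_apply_apply m
  inv_hom_id := by
    ext m
    exact (LinearEquiv.ofBijective f.toLin hf).apply_symm_apply m

theorem bijective_of_isIso {M N : GrMod 𝒜} (f : M ⟶ N) [IsIso f] :
    Function.Bijective f.toLin :=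
  Function.bijective_iff_has_inverse.2 ⟨(inv f).toLin,
    fun m => congr_toLin (IsIso.hom_inv_id f) m, fun m => congr_toLin (IsIso.inv_hom_id f) m⟩

theorem isIso_of_bijective {M N : GrMod 𝒜} (f : M ⟶ N) (hf : Function.Bijective f.toLin) :
    IsIso f := (isoOfBijective f hf).isIso_hom

theorem isZero_iff {M : GrMod 𝒜} : IsZero M ↔ ∀ m : M.carrier, m = 0 := by
  rw [IsZero.iff_id_eq_zero]
  exact ⟨fun h m => congr_toLin h m, fun h => by ext m; exact h m⟩

theorem exists_comp_ne_bot {M : GrMod 𝒜} {m : M.carrier} (hm : m ≠ 0) :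
    ∃ x, M.comp x ≠ ⊥ := by
  by_contra! h
  refine hm (grading_induction M.isInternal (p := fun m => m = 0) rfl ?_ ?_ m)
  · rintro x y rfl rfl; simp
  · intro x m hm
    rwa [h x, Submodule.mem_bot] at hm

section span

variable [GradedAlgebra 𝒜]

theorem proj_smul_mem {M : GrMod 𝒜} {N : Submodule A M.carrier} {m : M.carrier}
    (h : ∀ x, M.proj x m ∈ N) (a : A) (x : X) : M.proj x (a • m) ∈ N := by
  refine grading_induction (DirectSum.Decomposition.isInternal 𝒜)
    (p := fun a => M.proj x (a • m) ∈ N) ?_ ?_ ?_ a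
  · rw [zero_smul, map_zero]; exact Submodule.zero_mem _
  · intro a b ha hb
    rw [add_smul, map_add]
    exact Submodule.add_mem _ ha hb
  · intro y a ha
    rw [GrMod.proj_smul _ ha]
    exact Submodule.smul_mem _ _ (h _)

/-- A submodule generated by homogeneous elements is homogeneous. -/
theorem isHomogeneous_span (M : GrMod 𝒜) {S : Set M.carrier} (hS : ∀ m ∈ S, ∃ x, m ∈ M.comp x) :
    M.IsHomogeneous (Submodule.span A S) := by
  intro m hm
  induction hm using Submodule.span_induction with
  | mem m hm =>
    obtain ⟨y, hy⟩ := hS m hm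
    intro x
    by_cases h : y = x
    · subst h
      rw [M.proj_of_mem hy]
      exact Submodule.subset_span hm
    · rw [M.proj_of_mem_ne h hy]
      exact Submodule.zero_mem _
  | zero => intro x; rw [map_zero]; exact Submodule.zero_mem _
  | add a b _ _ ha hb => intro x; rw [map_add]; exact Submodule.add_mem _ (ha x) (hb x)
  | smul a m _ hm => exact proj_smul_mem hm a

end span

theorem IsHomogeneous.comap {M N : GrMod 𝒜} (f : M ⟶ N) {P : Submodule A N.carrier}
    (hP : N.IsHomogeneous P) : M.IsHomogeneous (P.comap f.toLin) := by
  intro m hm x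
  rw [Submodule.mem_comap, hom_proj]
  exact hP _ hm x

theorem IsHomogeneous.map {M N : GrMod 𝒜} (f : M ⟶ N) {P : Submodule A M.carrier}
    (hP : M.IsHomogeneous P) : N.IsHomogeneous (P.map f.toLin) := by
  rintro _ ⟨m, hm, rfl⟩ x
  exact ⟨M.proj x m, hP _ hm x, hom_proj f x m⟩

theorem quotπ_surjective (M : GrMod 𝒜) (N : Submodule A M.carrier) (hN : M.IsHomogeneous N) :
    Function.Surjective (M.quotπ N hN).toLin := N.mkQ_surjective

/-- A morphism that kills a homogeneous submodule descends to the quotient. -/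
noncomputable def quotDesc {M P : GrMod 𝒜} (N : Submodule A M.carrier) (hN : M.IsHomogeneous N)
    (f : M ⟶ P) (h : N ≤ LinearMap.ker f.toLin) : M.quot N hN ⟶ P :=
  ⟨N.liftQ f.toLin h, by
    rintro x _ ⟨m, hm, rfl⟩
    exact f.map_mem x m hm⟩

section finite

variable [FiniteDimensional K A]

instance finiteDimensional (M : GrMod 𝒜) : FiniteDimensional K M.carrier :=
  Module.Finite.trans (R := K) A M.carrier

theorem finite_support (M : GrMod 𝒜) : {x | M.comp x ≠ ⊥}.Finite :=
  WellFoundedGT.finite_ne_bot_of_iSupIndep M.isInternal.submodule_iSupIndep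

instance (M : GrMod 𝒜) (N : Submodule A M.carrier) (hN : M.IsHomogeneous N) :
    Mono (M.subι N hN) := mono_of_injective _ N.subtype_injective

theorem finrank_le_of_mono {M N : GrMod 𝒜} (f : M ⟶ N) [Mono f] :
    Module.finrank K M.carrier ≤ Module.finrank K N.carrier :=
  LinearMap.finrank_le_finrank_of_injective (f := Hom.toLinK f) (injective_of_mono f)

theorem isIso_of_mono_of_finrank {M N : GrMod 𝒜} (f : M ⟶ N) [Mono f]
    (h : Module.finrank K M.carrier = Module.finrank K N.carrier) : IsIso f :=
  isIso_of_bijective f ⟨injective_of_mono f,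
    (LinearMap.injective_iff_surjective_of_finrank_eq_finrank (f := Hom.toLinK f) h).1
      (injective_of_mono f)⟩

theorem finrank_eq_zero_iff {M : GrMod 𝒜} : Module.finrank K M.carrier = 0 ↔ IsZero M := by
  rw [isZero_iff, Module.finrank_zero_iff, subsingleton_iff_forall_eq 0]

/-- Short exact sequences of graded modules. -/
theorem shortExact_of {S : ShortComplex (GrMod 𝒜)} (hf : Function.Injective S.f.toLin)
    (hg : Function.Surjective S.g.toLin)
    (h : ∀ m, S.g.toLin m = 0 → ∃ l, S.f.toLin l = m) : S.ShortExact := by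
  have := mono_of_injective _ hf
  have := epi_of_surjective _ hg
  have key {P : GrMod 𝒜} (k : P ⟶ S.X₂) (hk : k ≫ S.g = 0) : ∃ l : P ⟶ S.X₁, l ≫ S.f = k :=
    exists_lift S.f k fun m => h _ (congr_toLin hk m)
  exact { exact := ShortComplex.exact_of_f_is_kernel _ (KernelFork.IsLimit.ofι _ _
      (fun g hg => (key g hg).choose) (fun g hg => (key g hg).choose_spec)
      (fun g hg b hb => by rw [← cancel_mono S.f, hb, (key g hg).choose_spec])) }

theorem exists_of_shortExact {S : ShortComplex (GrMod 𝒜)} (hS : S.ShortExact) {m : S.X₂.carrier}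
    (hm : S.g.toLin m = 0) : ∃ l, S.f.toLin l = m := by
  have := hS.mono_f
  have h : S.X₂.subι _ (isHomogeneous_ker S.g) ≫ S.g = 0 := by ext m; exact m.2
  exact ⟨(hS.exact.lift _ h).toLin ⟨m, hm⟩, congr_toLin (hS.exact.lift_f _ h) ⟨m, hm⟩⟩

theorem finrank_of_shortExact {S : ShortComplex (GrMod 𝒜)} (hS : S.ShortExact) :
    Module.finrank K S.X₂.carrier =
      Module.finrank K S.X₁.carrier + Module.finrank K S.X₃.carrier := by
  have := hS.mono_f
  have := hS.epi_g
  have h1 := LinearMap.finrank_range_add_finrank_ker (Hom.toLinK S.g)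
  have h2 : LinearMap.ker (Hom.toLinK S.g) = LinearMap.range (Hom.toLinK S.f) := by
    ext m
    refine ⟨fun hm => exists_of_shortExact hS hm, ?_⟩
    rintro ⟨l, rfl⟩
    exact congr_toLin S.zero l
  have h3 : LinearMap.range (Hom.toLinK S.g) = ⊤ := LinearMap.range_eq_top.2 (surjective_of_epi S.g)
  rw [h2, LinearMap.finrank_range_of_inj (f := Hom.toLinK S.f) (injective_of_mono S.f),
    h3, finrank_top] at h1
  omega

/-- The kernel of a morphism of graded modules. -/
noncomputable def kernelIso {M N : GrMod 𝒜} (f : M ⟶ N) :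
    kernel f ≅ M.sub _ (isHomogeneous_ker f) :=
  IsLimit.conePointUniqueUpToIso (kernelIsKernel f)
    (KernelFork.IsLimit.ofι (f := f) (M.subι _ (isHomogeneous_ker f)) (by ext m; exact m.2)
      (fun {P} g hg => (⟨g.toLin.codRestrict _ (fun m =>
          LinearMap.congr_fun (congrArg Hom.toLin hg) m), fun x m hm => g.map_mem x m hm⟩ :
          P ⟶ M.sub _ (isHomogeneous_ker f)))
      (fun g hg => by ext m; rfl)
      (fun g hg b hb => by
        ext m
        exact Subtype.ext (LinearMap.congr_fun (congrArg Hom.toLin hb) m)))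

/-- The dimension over `K` is strictly increasing on subobjects and bounded by that of `M`, which
stops ascending and descending chains. -/
theorem finite_length (M : GrMod 𝒜) : IsNoetherianObject M ∧ IsArtinianObject M := by
  have h : StrictMono (fun S : Subobject M => Module.finrank K (S : GrMod 𝒜).carrier) := by
    intro S S' hS
    refine lt_of_le_of_ne (finrank_le_of_mono (Subobject.ofLE _ _ hS.le)) fun e => ?_
    have := isIso_of_mono_of_finrank (Subobject.ofLE _ _ hS.le) e
    exact hS.not_ge (Subobject.le_of_comm (inv (Subobject.ofLE _ _ hS.le)) (by simp))
  have hle : ∀ S : Subobject M, Module.finrank K (S : GrMod 𝒜).carrier ≤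
      Module.finrank K M.carrier := fun S => finrank_le_of_mono S.arrow
  constructor
  · have h' : StrictAnti (fun S : Subobject M =>
        Module.finrank K M.carrier - Module.finrank K (S : GrMod 𝒜).carrier) := by
      intro S S' hS
      have h1 : Module.finrank K (S : GrMod 𝒜).carrier <
        Module.finrank K (S' : GrMod 𝒜).carrier := h hS
      have h2 := hle S'
      change Module.finrank K M.carrier - Module.finrank K (S' : GrMod 𝒜).carrier <
        Module.finrank K M.carrier - Module.finrank K (S : GrMod 𝒜).carrier
      omega
    exact ⟨h'.wellFoundedGT⟩
  · exact ⟨h.wellFoundedLT⟩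

instance finite_hom (M N : GrMod 𝒜) : Module.Finite K (M ⟶ N) :=
  let φ : (M ⟶ N) →ₗ[K] M.carrier →ₗ[K] N.carrier :=
    { toFun := fun f => Hom.toLinK f, map_add' := fun _ _ => rfl, map_smul' := fun _ _ => rfl }
  Module.Finite.of_injective φ (fun f g h => by ext m; exact LinearMap.congr_fun h m)

theorem simple_iff {M : GrMod 𝒜} : Simple M ↔
    (∃ m : M.carrier, m ≠ 0) ∧ ∀ N, M.IsHomogeneous N → N ≠ ⊥ → N = ⊤ := by
  constructor
  · intro h
    constructor
    · by_contra! h'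
      exact Simple.not_isZero M (isZero_iff.2 h')
    · intro N hN hN0
      have : IsIso (M.subι N hN) := by
        refine isIso_of_mono_of_nonzero fun e => hN0 ?_
        rw [eq_bot_iff]
        intro n hn
        exact congr_toLin e ⟨n, hn⟩
      rw [eq_top_iff]
      rintro m -
      obtain ⟨n, rfl⟩ := (bijective_of_isIso (M.subι N hN)).2 m
      exact n.2
  · rintro ⟨⟨m, hm⟩, h⟩
    refine ⟨fun {Y} f hf => ⟨?_, ?_⟩⟩
    · rintro hf' rfl
      obtain ⟨y, rfl⟩ := (bijective_of_isIso (0 : Y ⟶ M)).2 m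
      exact hm rfl
    · intro hf0
      refine isIso_of_bijective f ⟨injective_of_mono f, ?_⟩
      rw [← LinearMap.range_eq_top]
      refine h _ (isHomogeneous_range f) fun e => hf0 ?_
      ext y
      rw [LinearMap.range_eq_bot] at e
      rw [e]; rfl

end finite

end GrMod

namespace TriangularDecomposition

variable {K : Type u} [Field K] {A : Type v} [Ring A] [Algebra K A]
  {X : Type w} [AddCommGroup X] [DecidableEq X] {ι : Type*} {I : Module.Basis ι ℤ X}
  {𝒜 : X → Submodule K A} [GradedAlgebra 𝒜] (𝒯 : TriangularDecomposition I 𝒜)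

/-! ### Weight spaces -/

/-- The homogeneous component of degree `ξ` as a `T`-module. -/
def weightSpace (M : GrMod 𝒜) (ξ : X) : Submodule 𝒯.T M.carrier where
  carrier := M.comp ξ
  add_mem' := (M.comp ξ).add_mem
  zero_mem' := (M.comp ξ).zero_mem
  smul_mem' t m hm := by
    have := M.smul_mem 0 ξ t (𝒯.T_degree_zero t t.2) m hm
    rwa [zero_add] at this

/-- The restriction of a morphism to weight spaces. -/
def weightMap {M N : GrMod 𝒜} (f : M ⟶ N) (ξ : X) :
    𝒯.weightSpace M ξ →ₗ[𝒯.T] 𝒯.weightSpace N ξ where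
  toFun m := ⟨f.toLin m, f.map_mem ξ _ m.2⟩
  map_add' _ _ := Subtype.ext (map_add _ _ _)
  map_smul' t m := Subtype.ext (map_smul f.toLin (t : A) (m : M.carrier))

theorem weightMap_injective {M N : GrMod 𝒜} {f : M ⟶ N} (hf : Function.Injective f.toLin) (ξ : X) :
    Function.Injective (𝒯.weightMap f ξ) :=
  fun _ _ h => Subtype.ext (hf (congrArg Subtype.val h))

theorem weightMap_surjective {M N : GrMod 𝒜} {f : M ⟶ N} (hf : Function.Surjective f.toLin)
    (ξ : X) : Function.Surjective (𝒯.weightMap f ξ) := by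
  rintro ⟨n, hn⟩
  obtain ⟨m, hm, rfl⟩ := GrMod.exists_preimage_mem f hf hn
  exact ⟨⟨m, hm⟩, rfl⟩

/-- The element `m` is annihilated by the homogeneous elements of `B⁺` of nonzero degree. -/
def IsSingular {M : GrMod 𝒜} (m : M.carrier) : Prop :=
  ∀ x : X, x ≠ 0 → ∀ b ∈ 𝒯.posBorel, b ∈ 𝒜 x → b • m = 0

/-- A nonzero homogeneous element of `B⁺` has degree in the cone, so in nonzero degree it moves `ξ`
to a larger degree, where `M` vanishes. -/
theorem isSingular_of_maximal {M : GrMod 𝒜} {ξ : X}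
    (h : ∀ x ∈ natCone I, x ≠ 0 → M.comp (x + ξ) = ⊥) {m : M.carrier} (hm : m ∈ M.comp ξ) :
    𝒯.IsSingular m := by
  intro x hx b hb hbx
  by_cases hb0 : b = 0
  · rw [hb0, zero_smul]
  have h1 := M.smul_mem x ξ b hbx m hm
  rwa [h x (𝒯.posBorel_supp hb hbx hb0) hx, Submodule.mem_bot] at h1

/-! ### Induced modules -/

section induced

variable (V : Type v) [AddCommGroup V] [Module K V] [FiniteDimensional K V] (d : X)

/-- The canonical map `V → A ⊗ V`. -/
noncomputable def indMk : V →ₗ[K] (inducedMod (𝒜 := 𝒜) V d).carrier :=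
  TensorProduct.mk K A V 1

theorem smul_indMk (a : A) (v : V) : a • indMk (𝒜 := 𝒜) V d v = (a ⊗ₜ[K] v : A ⊗[K] V) := by
  have : a • ((1 : A) ⊗ₜ[K] v) = a ⊗ₜ[K] v := by
    rw [TensorProduct.smul_tmul', smul_eq_mul, mul_one]
  exact this

theorem indMk_mem (v : V) : indMk (𝒜 := 𝒜) V d v ∈ (inducedMod (𝒜 := 𝒜) V d).comp d := by
  refine ⟨(⟨1, ?_⟩ : 𝒜 (d - d)) ⊗ₜ[K] v, rfl⟩
  rw [sub_self]
  exact SetLike.GradedOne.one_mem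

variable {V d} in
theorem inducedMod_induction {p : (inducedMod (𝒜 := 𝒜) V d).carrier → Prop}
    (hmul : ∀ (a : A) v, p (a • indMk V d v)) (hadd : ∀ x y, p x → p y → p (x + y))
    (z : (inducedMod (𝒜 := 𝒜) V d).carrier) : p z := by
  suffices h : ∀ z : A ⊗[K] V, p z from h z
  intro z
  induction z with
  | zero =>
    have := hmul 0 0
    rwa [zero_smul] at this
  | add x y hx hy => exact hadd _ _ hx hy
  | tmul a v =>
    have := hmul a v
    rwa [smul_indMk] at this

variable {V d} in
theorem inducedMod_hom_ext {M : GrMod 𝒜} {f g : inducedMod (𝒜 := 𝒜) V d ⟶ M}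
    (h : ∀ v, f.toLin (indMk V d v) = g.toLin (indMk V d v)) : f = g := by
  ext z
  exact inducedMod_induction (p := fun z => f.toLin z = g.toLin z)
    (fun a v => by rw [map_smul, map_smul, h]) (fun x y hx hy => by rw [map_add, map_add, hx, hy]) z

variable {V} in
/-- The linear map of the universal property of the induced module. -/
noncomputable def indLift {M : GrMod 𝒜} (f : V →ₗ[K] M.carrier) : A ⊗[K] V →ₗ[A] M.carrier :=
  TensorProduct.AlgebraTensorModule.lift (LinearMap.toSpanSingleton A (V →ₗ[K] M.carrier) f)

variable {V} in
omit [GradedAlgebra 𝒜] [FiniteDimensional K V] in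
@[simp] theorem indLift_tmul {M : GrMod 𝒜} (f : V →ₗ[K] M.carrier) (a : A) (v : V) :
    indLift f (a ⊗ₜ v) = a • f v := by simp [indLift]

variable {V d} in
/-- The universal property of the induced module. -/
noncomputable def indDesc {M : GrMod 𝒜} (f : V →ₗ[K] M.carrier) (hf : ∀ v, f v ∈ M.comp d) :
    inducedMod (𝒜 := 𝒜) V d ⟶ M :=
  ⟨indLift f, by
    have h : ∀ x, ∀ z : 𝒜 (x - d) ⊗[K] V,
        indLift f (LinearMap.rTensor V (𝒜 (x - d)).subtype z) ∈ M.comp x := by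
      intro x z
      induction z with
      | zero => simp
      | tmul a v =>
        have := M.smul_mem _ _ a a.2 _ (hf v)
        rw [sub_add_cancel] at this
        simpa using this
      | add a b ha hb => rw [map_add, map_add]; exact Submodule.add_mem _ ha hb
    rintro x _ ⟨z, rfl⟩
    exact h x z⟩

variable {V d} in
@[simp] theorem indDesc_indMk {M : GrMod 𝒜} (f : V →ₗ[K] M.carrier) (hf : ∀ v, f v ∈ M.comp d)
    (v : V) : (indDesc f hf).toLin (indMk V d v) = f v :=
  (indLift_tmul f 1 v).trans (one_smul _ _)

end induced

/-! ### Standard modules -/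

section standard

variable (V : Type v) [AddCommGroup V] [Module K V] [Module 𝒯.T V]
  [FiniteDimensional K V] (d : X)

/-- The projection from the induced module to the standard module. -/
noncomputable def indToStd : inducedMod (𝒜 := 𝒜) V d ⟶ 𝒯.properStandard V d :=
  GrMod.quotπ _ _ (𝒯.isHomogeneous_span_balancing V d)

theorem indToStd_surjective : Function.Surjective (𝒯.indToStd V d).toLin :=
  GrMod.quotπ_surjective _ _ _

theorem indToStd_eq_zero {z : A ⊗[K] V} (hz : z ∈ 𝒯.balancing V) :
    (𝒯.indToStd V d).toLin z = 0 :=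
  (Submodule.Quotient.mk_eq_zero _).2 (Submodule.subset_span hz)

/-- The canonical map `V → A ⊗_{B⁺} V`. -/
noncomputable def stdMk : V →ₗ[𝒯.T] (𝒯.properStandard V d).carrier where
  toFun v := (𝒯.indToStd V d).toLin (indMk V d v)
  map_add' v v' := by rw [map_add, map_add]
  map_smul' t v := by
    have h := 𝒯.indToStd_eq_zero V d (Or.inl ⟨t, v, rfl⟩)
    replace h : (𝒯.indToStd V d).toLin ((t : A) • indMk V d v - (1 : A) • indMk V d (t • v)) = 0 := by
      rw [smul_indMk, smul_indMk]
      exact h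
    rw [map_sub, sub_eq_zero, one_smul, map_smul] at h
    exact h.symm

theorem indToStd_indMk (v : V) :
    (𝒯.indToStd V d).toLin (indMk V d v) = 𝒯.stdMk V d v := rfl

theorem stdMk_mem (v : V) : 𝒯.stdMk V d v ∈ (𝒯.properStandard V d).comp d :=
  (𝒯.indToStd V d).map_mem _ _ (indMk_mem V d v)

theorem isSingular_stdMk (v : V) : 𝒯.IsSingular (𝒯.stdMk V d v) := by
  intro x hx b hb hbx
  have h := 𝒯.indToStd_eq_zero V d (Or.inr ⟨x, hx, b, hb, hbx, v, rfl⟩)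
  rwa [← smul_indMk (𝒜 := 𝒜) V d, map_smul] at h

variable {V d} in
-- All components of `b` of nonzero degree kill `m`, so `B⁺` acts on singular elements through `B⁺ →
-- T`.
theorem IsSingular.smul_eq {M : GrMod 𝒜} {m : M.carrier} (hm : 𝒯.IsSingular m) {b : A}
    (hb : b ∈ 𝒯.posBorel) : b • m = 𝒯.posBorelToT ⟨b, hb⟩ • m := by
  classical
  change b • m = (DirectSum.decompose 𝒜 b 0 : A) • m
  conv_lhs => rw [← DirectSum.sum_support_decompose 𝒜 b, Finset.sum_smul]
  refine Finset.sum_eq_single 0 (fun x _ hx => ?_) (fun h0 => ?_)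
  · exact hm x hx _ (𝒯.posBorel_graded hb x) (SetLike.coe_mem _)
  · rw [DFinsupp.notMem_support_iff.1 h0]; simp

/-- A standard module is generated by `V`. -/
theorem properStandard_induction {p : (𝒯.properStandard V d).carrier → Prop}
    (hmul : ∀ n ∈ 𝒯.neg, ∀ v, p (n • 𝒯.stdMk V d v))
    (hadd : ∀ x y, p x → p y → p (x + y)) (z : (𝒯.properStandard V d).carrier) : p z := by
  obtain ⟨z, rfl⟩ := 𝒯.indToStd_surjective V d z
  refine inducedMod_induction (p := fun z => p ((𝒯.indToStd V d).toLin z)) (fun a v => ?_)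
    (fun x y hx hy => by rw [map_add]; exact hadd _ _ hx hy) z
  rw [map_smul, indToStd_indMk]
  refine 𝒯.mul_induction (p := fun a => p (a • 𝒯.stdMk V d v)) (fun n hn b hb => ?_)
    (fun a b ha hb => by rw [add_smul]; exact hadd _ _ ha hb) a
  rw [mul_smul, IsSingular.smul_eq _ (𝒯.isSingular_stdMk V d v) hb, ← map_smul]
  exact hmul n hn _

variable {V d} in
theorem properStandard_hom_ext {M : GrMod 𝒜} {f g : 𝒯.properStandard V d ⟶ M}
    (h : ∀ v, f.toLin (𝒯.stdMk V d v) = g.toLin (𝒯.stdMk V d v)) : f = g := by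
  ext z
  refine 𝒯.properStandard_induction V d (p := fun z => f.toLin z = g.toLin z)
    (fun n _ v => by rw [map_smul, map_smul, h]) (fun x y hx hy => by rw [map_add, map_add, hx, hy])
    z

section tower

variable [IsScalarTower K 𝒯.T V]

variable {V d} in
/-- The universal property of the standard module. -/
noncomputable def stdDesc {M : GrMod 𝒜} (f : V →ₗ[𝒯.T] M.carrier) (hf : ∀ v, f v ∈ M.comp d)
    (hs : ∀ v, 𝒯.IsSingular (f v)) : 𝒯.properStandard V d ⟶ M :=
  GrMod.quotDesc _ (𝒯.isHomogeneous_span_balancing V d) (indDesc (f.restrictScalars K) hf) (by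
    have h : Submodule.span A (𝒯.balancing V) ≤ LinearMap.ker (indLift (f.restrictScalars K)) := by
      rw [Submodule.span_le]
      rintro _ (⟨t, m, rfl⟩ | ⟨x, hx, b, hb, hbx, m, rfl⟩)
      · have : (t : A) • f m - (1 : A) • f (t • m) = 0 := by
          rw [map_smul, one_smul, sub_eq_zero]; rfl
        simpa using this
      · have : b • f m = 0 := hs m x hx b hb hbx
        simpa using this
    exact h)

variable {V d} in
@[simp] theorem stdDesc_stdMk {M : GrMod 𝒜} (f : V →ₗ[𝒯.T] M.carrier)
    (hf : ∀ v, f v ∈ M.comp d) (hs : ∀ v, 𝒯.IsSingular (f v)) (v : V) :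
    (𝒯.stdDesc f hf hs).toLin (𝒯.stdMk V d v) = f v :=
  indDesc_indMk (f.restrictScalars K) hf v

/-- The vector space `A⁻ ⊗ V` underlying the standard module. -/
noncomputable def properStandardToTensor : (𝒯.properStandard V d).carrier →ₗ[K] 𝒯.neg ⊗[K] V :=
  ((Submodule.span A (𝒯.balancing V)).restrictScalars K).liftQ (𝒯.toNegTensor V)
    (fun _ hz => 𝒯.toNegTensor_eq_zero V hz)

theorem properStandardToTensor_smul {n : A} (hn : n ∈ 𝒯.neg) (v : V) :
    𝒯.properStandardToTensor V d (n • 𝒯.stdMk V d v) = ⟨n, hn⟩ ⊗ₜ v := by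
  have h := 𝒯.toNegTensor_tmul V hn (𝒯.T_le_posBorel 𝒯.T.one_mem) v
  rw [mul_one] at h
  have h' : n • 𝒯.stdMk V d v = (𝒯.indToStd V d).toLin (n ⊗ₜ[K] v : A ⊗[K] V) := by
    rw [← smul_indMk (𝒜 := 𝒜) V d, map_smul]
    rfl
  rw [h']
  refine h.trans ?_
  have : 𝒯.posBorelToT ⟨1, 𝒯.T_le_posBorel 𝒯.T.one_mem⟩ = 1 :=
    Subtype.ext (DirectSum.decompose_of_mem_same 𝒜 SetLike.GradedOne.one_mem)
  rw [this, one_smul]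

/-- The map `A⁻ ⊗ V → A ⊗_{B⁺} V`. -/
noncomputable def tensorToProperStandard : 𝒯.neg ⊗[K] V →ₗ[K] (𝒯.properStandard V d).carrier :=
  TensorProduct.lift (LinearMap.mk₂ K
    (fun (n : 𝒯.neg) v => (n : A) • 𝒯.stdMk V d v)
    (fun _ _ _ => add_smul _ _ _) (fun k n v => smul_assoc k (n : A) _)
    (fun n v v' => by rw [map_add, smul_add])
    (fun k n v => by
      rw [LinearMap.map_smul_of_tower, smul_comm]))

/-- The isomorphism `A⁻ ⊗ V ≅ A ⊗_{B⁺} V` of vector spaces. -/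
noncomputable def properStandardEquiv : 𝒯.neg ⊗[K] V ≃ₗ[K] (𝒯.properStandard V d).carrier :=
  LinearEquiv.ofLinearMap (𝒯.tensorToProperStandard V d) (𝒯.properStandardToTensor V d)
    (by
      ext z
      refine 𝒯.properStandard_induction V d (p := fun z => 𝒯.tensorToProperStandard V d
        (𝒯.properStandardToTensor V d z) = z) (fun n hn v => ?_) (fun x y hx hy => ?_) z
      · rw [properStandardToTensor_smul _ _ _ hn]; rfl
      · rw [map_add, map_add, hx, hy])
    (by
      ext n v
      exact 𝒯.properStandardToTensor_smul V d n.2 v)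

@[simp] theorem properStandardEquiv_tmul (n : 𝒯.neg) (v : V) :
    𝒯.properStandardEquiv V d (n ⊗ₜ v) = (n : A) • 𝒯.stdMk V d v := rfl

end tower

end standard

end TriangularDecomposition

/-! ### Supports, and the largest homogeneous submodule avoiding a degree -/

namespace GrMod

variable {K : Type u} [Field K] {A : Type v} [Ring A] [Algebra K A] {X : Type w}
  [AddCommGroup X] [DecidableEq X] {𝒜 : X → Submodule K A}

theorem comp_eq_bot_iff {M : GrMod 𝒜} {x : X} : M.comp x = ⊥ ↔ ∀ m, M.proj x m = 0 := by
  rw [Submodule.eq_bot_iff]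
  exact ⟨fun h m => h _ (M.proj_mem x m), fun h m hm => by rw [← M.proj_of_mem hm, h]⟩

theorem comp_ne_bot_of_mem {M : GrMod 𝒜} {x : X} {m : M.carrier} (hm : m ∈ M.comp x)
    (h : m ≠ 0) : M.comp x ≠ ⊥ := fun e => h (by rwa [e, Submodule.mem_bot] at hm)

theorem comp_ne_bot_of_injective {M N : GrMod 𝒜} {f : M ⟶ N} (hf : Function.Injective f.toLin)
    {x : X} (h : M.comp x ≠ ⊥) : N.comp x ≠ ⊥ := by
  obtain ⟨m, hm, hm0⟩ := Submodule.exists_mem_ne_zero_of_ne_bot h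
  exact comp_ne_bot_of_mem (f.map_mem x m hm) fun e => hm0 (hf (by rw [e, map_zero]))

theorem comp_ne_bot_of_surjective {M N : GrMod 𝒜} {f : M ⟶ N} (hf : Function.Surjective f.toLin)
    {x : X} (h : N.comp x ≠ ⊥) : M.comp x ≠ ⊥ := by
  obtain ⟨n, hn, hn0⟩ := Submodule.exists_mem_ne_zero_of_ne_bot h
  obtain ⟨m, hm, rfl⟩ := exists_preimage_mem f hf hn
  exact comp_ne_bot_of_mem hm fun e => hn0 (by rw [e, map_zero])

theorem comp_ne_bot_of_shortExact [FiniteDimensional K A] {S : ShortComplex (GrMod 𝒜)}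
    (hS : S.ShortExact) {x : X} (h : S.X₂.comp x ≠ ⊥) :
    S.X₁.comp x ≠ ⊥ ∨ S.X₃.comp x ≠ ⊥ := by
  have := hS.mono_f
  obtain ⟨m, hm, hm0⟩ := Submodule.exists_mem_ne_zero_of_ne_bot h
  by_cases hg : S.g.toLin m = 0
  · obtain ⟨l, rfl⟩ := exists_of_shortExact hS hg
    refine Or.inl (comp_ne_bot_of_mem (mem_of_injective S.f (injective_of_mono _) hm) fun e => ?_)
    exact hm0 (by rw [e, map_zero])
  · exact Or.inr (comp_ne_bot_of_mem (S.g.map_mem x m hm) hg)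

theorem proj_smul_of_mem [GradedAlgebra 𝒜] (M : GrMod 𝒜) {y : X} {m : M.carrier}
    (hm : m ∈ M.comp y) (a : A) (x : X) :
    M.proj x (a • m) = (DirectSum.decompose 𝒜 a (x - y) : A) • m := by
  refine grading_induction (DirectSum.Decomposition.isInternal 𝒜)
    (p := fun a => M.proj x (a • m) = (DirectSum.decompose 𝒜 a (x - y) : A) • m) ?_ ?_ ?_ a
  · simp
  · intro a b ha hb
    rw [add_smul, map_add, ha, hb, DirectSum.decompose_add, DirectSum.add_apply,
      Submodule.coe_add, add_smul]
  · intro z a ha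
    rw [M.proj_smul ha]
    by_cases h : z = x - y
    · rw [h, sub_sub_cancel, M.proj_of_mem hm, DirectSum.decompose_of_mem_same 𝒜 (h ▸ ha)]
    · rw [M.proj_of_mem_ne (x := y) (fun e => h (by rw [e]; abel)) hm,
        DirectSum.decompose_of_mem_ne 𝒜 ha h, smul_zero, zero_smul]

/-- The largest homogeneous submodule whose component of degree `d` vanishes. -/
def avoiding (M : GrMod 𝒜) (d : X) : Submodule A M.carrier where
  carrier := {m | ∀ a : A, M.proj d (a • m) = 0}
  add_mem' hm hm' a := by rw [smul_add, map_add, hm, hm', add_zero]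
  zero_mem' a := by rw [smul_zero, map_zero]
  smul_mem' b m hm a := by rw [smul_smul]; exact hm _

/-- The degree-`d` part of `a m_x` involves only the component `a_{d-x}` of `a`, and equals the
degree-`d` part of `a_{d-x} m`, which vanishes by assumption. -/
theorem isHomogeneous_avoiding [GradedAlgebra 𝒜] (M : GrMod 𝒜) (d : X) :
    M.IsHomogeneous (M.avoiding d) := by
  intro m hm x a
  rw [M.proj_smul_of_mem (M.proj_mem x m)]
  have h1 : (DirectSum.decompose 𝒜 a (d - x) : A) • M.proj x m =
      M.proj d ((DirectSum.decompose 𝒜 a (d - x) : A) • m) := by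
    rw [M.proj_smul (SetLike.coe_mem _), sub_sub_cancel]
  rw [h1]
  exact hm _

theorem eq_zero_of_mem_avoiding {M : GrMod 𝒜} {d : X} {m : M.carrier} (hm : m ∈ M.avoiding d)
    (hd : m ∈ M.comp d) : m = 0 := by
  have := hm 1
  rwa [one_smul, M.proj_of_mem hd] at this

theorem le_avoiding {M : GrMod 𝒜} {d : X} {N : Submodule A M.carrier} (hN : M.IsHomogeneous N)
    (h : ∀ m ∈ N, m ∈ M.comp d → m = 0) : N ≤ M.avoiding d :=
  fun _ hm a => h _ (hN _ (N.smul_mem a hm) d) (M.proj_mem d _)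

end GrMod

/-! ### Degrees and simple heads of standard modules -/

namespace TriangularDecomposition

variable {K : Type u} [Field K] {A : Type v} [Ring A] [Algebra K A]
  {X : Type w} [AddCommGroup X] [DecidableEq X] {ι : Type*} {I : Module.Basis ι ℤ X}
  {𝒜 : X → Submodule K A} [GradedAlgebra 𝒜] (𝒯 : TriangularDecomposition I 𝒜)

section standard

variable (V : Type v) [AddCommGroup V] [Module K V] [Module 𝒯.T V]
  [FiniteDimensional K V] (d : X)

theorem decompose_neg_eq_zero {n : A} (hn : n ∈ 𝒯.neg) {x : X} (hx : -x ∉ natCone I) :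
    (DirectSum.decompose 𝒜 n x : A) = 0 := by
  by_contra h
  exact hx (𝒯.neg_supp x _ (𝒯.neg_graded n hn x) (SetLike.coe_mem _) h)

theorem exists_decompose_neg_zero {n : A} (hn : n ∈ 𝒯.neg) :
    ∃ k : K, algebraMap K A k = DirectSum.decompose 𝒜 n 0 := by
  have h : (DirectSum.decompose 𝒜 n 0 : A) ∈ (1 : Submodule K A) := by
    rw [← 𝒯.neg_zero]
    exact ⟨𝒯.neg_graded n hn 0, SetLike.coe_mem _⟩
  exact Submodule.mem_one.1 h

theorem properStandard_support {x : X} (h : (𝒯.properStandard V d).comp x ≠ ⊥) :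
    d - x ∈ natCone I := by
  contrapose! h
  rw [GrMod.comp_eq_bot_iff]
  refine 𝒯.properStandard_induction V d (fun n hn v => ?_)
    (fun y z hy hz => by rw [map_add, hy, hz, add_zero])
  rw [GrMod.proj_smul_of_mem _ (𝒯.stdMk_mem V d v), 𝒯.decompose_neg_eq_zero hn, zero_smul]
  rwa [neg_sub]

section tower

variable [IsScalarTower K 𝒯.T V]

/-- The degree-`d` part of `n v` is `n₀ v`, and `n₀` is a scalar because `A⁻₀ = K`. -/
theorem exists_stdMk_eq {m : (𝒯.properStandard V d).carrier}
    (hm : m ∈ (𝒯.properStandard V d).comp d) : ∃ v, 𝒯.stdMk V d v = m := by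
  rw [← GrMod.proj_of_mem _ hm]
  refine 𝒯.properStandard_induction V d
    (p := fun m => ∃ v, 𝒯.stdMk V d v = (𝒯.properStandard V d).proj d m) (fun n hn v => ?_) ?_ m
  · obtain ⟨k, hk⟩ := 𝒯.exists_decompose_neg_zero hn
    rw [GrMod.proj_smul_of_mem _ (𝒯.stdMk_mem V d v), sub_self, ← hk, algebraMap_smul]
    exact ⟨k • v, LinearMap.map_smul_of_tower _ _ _⟩
  · rintro y z ⟨v, hv⟩ ⟨v', hv'⟩
    exact ⟨v + v', by rw [map_add, map_add, hv, hv']⟩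

/-- Under `A⁻ ⊗ V ≅ A ⊗_{B⁺} V` the map becomes `v ↦ 1 ⊗ v`, injective over a field as soon as `1 ≠
0` in `A⁻`. -/
theorem stdMk_injective : Function.Injective (𝒯.stdMk V d) := by
  rw [injective_iff_map_eq_zero]
  intro v hv
  by_contra hv0
  have h : 𝒯.properStandardEquiv V d (1 ⊗ₜ v) = 0 := by
    rw [properStandardEquiv_tmul, hv, smul_zero]
  rw [LinearEquiv.map_eq_zero_iff] at h
  -- `A⁻` and `T` share the unit of `A`; if it vanished, `V` would be zero.
  have h1 : (1 : 𝒯.neg) ≠ 0 := by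
    intro h1
    have h2 : (1 : 𝒯.T) = 0 := Subtype.ext (congrArg (Subtype.val : 𝒯.neg → A) h1)
    exact hv0 (by rw [← one_smul 𝒯.T v, h2, zero_smul])
  have : Nontrivial 𝒯.neg := ⟨1, 0, h1⟩
  exact hv0 ((Module.FaithfullyFlat.one_tmul_eq_zero_iff K V v).1 h)

end tower

end standard

section head

variable (V : Type v) [AddCommGroup V] [Module K V] [Module 𝒯.T V] [IsScalarTower K 𝒯.T V]
  [FiniteDimensional K V] [IsSimpleModule 𝒯.T V] (d : X)

/-- A nonzero vector of degree `d` lies in `V`, generates `V` over `T` by simplicity, and hence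
generates the whole module. So a proper homogeneous submodule has no component in degree `d`. -/
theorem le_avoiding_properStandard {N : Submodule A (𝒯.properStandard V d).carrier}
    (hN : (𝒯.properStandard V d).IsHomogeneous N) (hN' : N ≠ ⊤) :
    N ≤ (𝒯.properStandard V d).avoiding d := by
  refine GrMod.le_avoiding hN fun m hm hmd => ?_
  by_contra hm0
  obtain ⟨v, rfl⟩ := 𝒯.exists_stdMk_eq V d hmd
  have hv : v ≠ 0 := fun h => hm0 (by rw [h, map_zero])
  refine hN' (eq_top_iff.2 fun z _ => ?_)
  refine 𝒯.properStandard_induction V d (p := fun z => z ∈ N) (fun n _ v' => ?_)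
    (fun _ _ => N.add_mem) z
  obtain ⟨t, rfl⟩ := IsSimpleModule.toSpanSingleton_surjective 𝒯.T hv v'
  rw [LinearMap.toSpanSingleton_apply, map_smul]
  exact N.smul_mem _ (N.smul_mem (t : A) hm)

theorem avoiding_properStandard_ne_top : (𝒯.properStandard V d).avoiding d ≠ ⊤ := by
  have : Nontrivial V := IsSimpleModule.nontrivial 𝒯.T V
  obtain ⟨v, hv⟩ := exists_ne (0 : V)
  intro h
  refine hv (𝒯.stdMk_injective V d ?_)
  rw [map_zero]
  exact GrMod.eq_zero_of_mem_avoiding (h ▸ Submodule.mem_top) (𝒯.stdMk_mem V d v)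

/-- The submodule avoiding degree `d` is proper and contains every proper homogeneous submodule, so
it is the only maximal one. -/
theorem rad_properStandard :
    (𝒯.properStandard V d).rad = (𝒯.properStandard V d).avoiding d := by
  have h : {N | Maximal (fun N' => (𝒯.properStandard V d).IsHomogeneous N' ∧ N' ≠ ⊤) N} =
      {(𝒯.properStandard V d).avoiding d} := by
    ext N
    rw [Set.mem_singleton_iff, Set.mem_ofPred_eq]
    constructor
    · intro hN
      exact le_antisymm (𝒯.le_avoiding_properStandard V d hN.1.1 hN.1.2)
        (hN.2 ⟨GrMod.isHomogeneous_avoiding _ d, 𝒯.avoiding_properStandard_ne_top V d⟩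
          (𝒯.le_avoiding_properStandard V d hN.1.1 hN.1.2))
    · rintro rfl
      exact ⟨⟨GrMod.isHomogeneous_avoiding _ d, 𝒯.avoiding_properStandard_ne_top V d⟩,
        fun N hN _ => 𝒯.le_avoiding_properStandard V d hN.1 hN.2⟩
  rw [GrMod.rad, h, sInf_singleton]

/-- The projection of the standard module onto its head. -/
noncomputable def headπ : 𝒯.properStandard V d ⟶ (𝒯.properStandard V d).head :=
  GrMod.quotπ _ _ (GrMod.isHomogeneous_rad _)

omit [IsScalarTower K 𝒯.T V] [IsSimpleModule 𝒯.T V] in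
theorem headπ_surjective : Function.Surjective (𝒯.headπ V d).toLin := GrMod.quotπ_surjective _ _ _

theorem headπ_eq_zero_iff {m : (𝒯.properStandard V d).carrier} :
    (𝒯.headπ V d).toLin m = 0 ↔ m ∈ (𝒯.properStandard V d).avoiding d := by
  rw [← rad_properStandard]
  exact Submodule.Quotient.mk_eq_zero _

omit [IsScalarTower K 𝒯.T V] [IsSimpleModule 𝒯.T V] in
theorem head_support {x : X} (h : (𝒯.properStandard V d).head.comp x ≠ ⊥) :
    d - x ∈ natCone I :=
  𝒯.properStandard_support V d (GrMod.comp_ne_bot_of_surjective (𝒯.headπ_surjective V d) h)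

/-- The component of degree `d` of the head of the standard module of `V`. -/
noncomputable def headWeight : V ≃ₗ[𝒯.T] 𝒯.weightSpace (𝒯.properStandard V d).head d :=
  LinearEquiv.ofBijective
    (𝒯.weightMap (𝒯.headπ V d) d ∘ₗ (𝒯.stdMk V d).codRestrict _ (𝒯.stdMk_mem V d))
    ⟨by
      rw [injective_iff_map_eq_zero]
      intro v hv
      refine 𝒯.stdMk_injective V d ?_
      rw [map_zero]
      exact GrMod.eq_zero_of_mem_avoiding
        ((𝒯.headπ_eq_zero_iff V d).1 (congrArg Subtype.val hv)) (𝒯.stdMk_mem V d v), by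
      rintro ⟨m, hm⟩
      obtain ⟨m, hm', rfl⟩ := GrMod.exists_preimage_mem _ (𝒯.headπ_surjective V d) hm
      obtain ⟨v, rfl⟩ := 𝒯.exists_stdMk_eq V d hm'
      exact ⟨v, rfl⟩⟩

variable {V d} in
theorem head_hom_ext {M : GrMod 𝒜} {f g : (𝒯.properStandard V d).head ⟶ M}
    (h : ∀ v, f.toLin (𝒯.headWeight V d v) = g.toLin (𝒯.headWeight V d v)) : f = g := by
  have : 𝒯.headπ V d ≫ f = 𝒯.headπ V d ≫ g := 𝒯.properStandard_hom_ext h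
  ext m
  obtain ⟨m, rfl⟩ := 𝒯.headπ_surjective V d m
  exact GrMod.congr_toLin this m

variable [FiniteDimensional K A]

/-- The preimage of a proper homogeneous submodule of the head is proper, hence contained in the
radical. -/
theorem simple_head : Simple (𝒯.properStandard V d).head := by
  rw [GrMod.simple_iff]
  constructor
  · have : Nontrivial V := IsSimpleModule.nontrivial 𝒯.T V
    obtain ⟨v, hv⟩ := exists_ne (0 : V)
    exact ⟨𝒯.headWeight V d v, fun h => hv ((𝒯.headWeight V d).injective
      (Subtype.ext (by rw [h, map_zero]; rfl)))⟩
  · intro N hN hN0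
    by_contra hN1
    refine hN0 (eq_bot_iff.2 fun m hm => ?_)
    obtain ⟨m, rfl⟩ := 𝒯.headπ_surjective V d m
    rw [Submodule.mem_bot, headπ_eq_zero_iff]
    refine 𝒯.le_avoiding_properStandard V d (hN.comap (𝒯.headπ V d)) (fun h => hN1 ?_) hm
    refine eq_top_iff.2 fun z _ => ?_
    obtain ⟨z, rfl⟩ := 𝒯.headπ_surjective V d z
    exact h.ge (Submodule.mem_top (x := z))

variable {V d} in
-- The map `f` extends to a morphism from the standard module, surjective because `M` is simple. Its
-- kernel is proper, hence inside the radical; conversely the image of the radical has no component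
-- of degree `d`, so it is not all of `M` and must vanish.
theorem nonempty_iso_head {M : GrMod 𝒜} [Simple M] (f : V →ₗ[𝒯.T] M.carrier) (hf0 : f ≠ 0)
    (hf : ∀ v, f v ∈ M.comp d) (hs : ∀ v, 𝒯.IsSingular (f v)) :
    Nonempty (M ≅ (𝒯.properStandard V d).head) := by
  obtain ⟨v, hv⟩ : ∃ v, f v ≠ 0 := by
    by_contra! h
    exact hf0 (LinearMap.ext h)
  have hM := (GrMod.simple_iff.1 ((inferInstance : Simple M))).2
  let g := 𝒯.stdDesc f hf hs
  have hg : g.toLin (𝒯.stdMk V d v) = f v := 𝒯.stdDesc_stdMk f hf hs v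
  have hsurj : Function.Surjective g.toLin := by
    rw [← LinearMap.range_eq_top]
    refine hM _ (GrMod.isHomogeneous_range g) fun h => hv ?_
    rw [← hg, ← Submodule.mem_bot (R := A), ← h]
    exact ⟨_, rfl⟩
  have hker : LinearMap.ker g.toLin = (𝒯.properStandard V d).avoiding d := by
    refine le_antisymm (𝒯.le_avoiding_properStandard V d (GrMod.isHomogeneous_ker g) ?_) ?_
    · intro h
      have : 𝒯.stdMk V d v ∈ LinearMap.ker g.toLin := h ▸ Submodule.mem_top
      exact hv (by rw [← hg]; exact this)
    · rw [LinearMap.le_ker_iff_map]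
      by_contra h
      have h1 := hM _ ((GrMod.isHomogeneous_avoiding _ d).map g) h
      have h2 : f v ∈ Submodule.map g.toLin ((𝒯.properStandard V d).avoiding d) :=
        h1 ▸ Submodule.mem_top
      obtain ⟨z, hz, hzv⟩ := h2
      have h3 := GrMod.eq_zero_of_mem_avoiding (GrMod.isHomogeneous_avoiding _ d z hz d)
        (GrMod.proj_mem _ d z)
      rw [← M.proj_of_mem (hf v), ← hzv, ← GrMod.hom_proj, h3, map_zero] at hv
      exact hv rfl
  have e : (𝒯.properStandard V d).head ≅ M :=
    GrMod.isoOfBijective (GrMod.quotDesc _ (GrMod.isHomogeneous_rad _) g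
      (by rw [hker, rad_properStandard])) ⟨by
        rw [injective_iff_map_eq_zero]
        intro z hz
        obtain ⟨z, rfl⟩ := 𝒯.headπ_surjective V d z
        rw [headπ_eq_zero_iff, ← hker]
        exact hz, fun m => by
        obtain ⟨z, rfl⟩ := hsurj m
        exact ⟨(𝒯.headπ V d).toLin z, rfl⟩⟩
  exact ⟨e.symm⟩

end head

end TriangularDecomposition

/-! ### Finite intervals of weights and finiteness of the set of simple modules -/

section

variable {X : Type w} [AddCommGroup X] {ι : Type*} (I : Module.Basis ι ℤ X)

/-- Coordinates in `I` embed the weights monotonically into `ι → ℤ`, where intervals are finite for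
finite `ι`. -/
theorem Weight.finite_Icc [Finite ι] (a b : Weight I) : (Set.Icc a b).Finite := by
  classical
  have := Fintype.ofFinite ι
  let f : Weight I → ι → ℤ := fun x i => I.repr (show X from x) i
  have hf : Function.Injective f := fun x y h => I.repr.injective (Finsupp.ext (congrFun h))
  have hmono : ∀ x y : Weight I, x ≤ y → f x ≤ f y := by
    intro x y h i
    have h1 := natCone_repr_nonneg I h i
    rw [map_sub, Finsupp.sub_apply] at h1
    exact sub_nonneg.1 h1
  refine Set.Finite.of_finite_image ((Set.finite_Icc (f a) (f b)).subset ?_) hf.injOn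
  rintro _ ⟨x, hx, rfl⟩
  exact ⟨hmono _ _ hx.1, hmono _ _ hx.2⟩

end

theorem exists_simple_submodule_of_isArtinian (R M : Type*) [Ring R] [AddCommGroup M] [Module R M]
    [IsArtinian R M] [Nontrivial M] : ∃ N : Submodule R M, IsSimpleModule R N := by
  obtain ⟨N, hN⟩ := IsAtomic.exists_atom (Submodule R M)
  exact ⟨N, isSimpleModule_iff_isAtom.2 hN⟩

theorem finrank_quotient_lt_of_nontrivial {K R M : Type*} [Field K] [Ring R] [Algebra K R]
    [AddCommGroup M] [Module R M] [Module K M] [IsScalarTower K R M] [FiniteDimensional K M]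
    (N : Submodule R M) [Nontrivial N] : Module.finrank K (M ⧸ N) < Module.finrank K M := by
  have h1 := Submodule.finrank_quotient_add_finrank (N.restrictScalars K)
  have h2 : 0 < Module.finrank K (N.restrictScalars K) :=
    have : Nontrivial (N.restrictScalars K) := (inferInstance : Nontrivial N)
    Module.finrank_pos
  have h3 := (Submodule.Quotient.restrictScalarsEquiv K N).finrank_eq
  omega

/-- A finite-dimensional algebra has finitely many simple modules which are quotients of a given
finite-dimensional module. -/
theorem finite_simple_quotients {K : Type u} [Field K] {R : Type v} [Ring R] [Algebra K R] (n : ℕ) :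
    ∀ (M : Type v) [AddCommGroup M] [Module R M] [Module K M] [IsScalarTower K R M]
      [FiniteDimensional K M], Module.finrank K M = n →
      {S : Irr K R | ∃ f : M →ₗ[R] S.rep.carrier, f ≠ 0}.Finite := by
  induction n using Nat.strong_induction_on with
  | _ n ih =>
    intro M _ _ _ _ _ hn
    rcases subsingleton_or_nontrivial M with h | h
    · convert Set.finite_empty
      rw [Set.eq_empty_iff_forall_notMem]
      rintro S ⟨f, hf⟩
      exact hf (LinearMap.ext fun m => by rw [Subsingleton.elim m 0, map_zero, map_zero])
    · have : IsArtinian R M := isArtinian_of_tower K inferInstance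
      obtain ⟨N, hN⟩ := exists_simple_submodule_of_isArtinian R M
      have : Nontrivial N := IsSimpleModule.nontrivial R N
      have hfin : Module.finrank K (M ⧸ N) < n := hn ▸ finrank_quotient_lt_of_nontrivial N
      let S₀ : SimpleMod K R := ⟨N⟩
      refine ((ih _ hfin (M ⧸ N) rfl).insert (Quotient.mk _ S₀)).subset ?_
      rintro S ⟨f, hf⟩
      -- Either `f` kills the simple submodule `N` and factors through the smaller module `M ⧸ N`,
      -- or by Schur's lemma it identifies `N` with the target.
      by_cases h0 : f ∘ₗ N.subtype = 0
      · have hle : N ≤ LinearMap.ker f := fun n hn => LinearMap.congr_fun h0 ⟨n, hn⟩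
        refine Or.inr ⟨N.liftQ f hle, fun h => hf ?_⟩
        rw [← N.liftQ_mkQ f hle, h, LinearMap.zero_comp]
      · left
        have e := LinearEquiv.ofBijective _ (LinearMap.bijective_of_ne_zero h0)
        rw [← Quotient.out_eq S]
        exact Quotient.sound ⟨e.symm⟩

theorem finite_irr {K : Type u} [Field K] {R : Type v} [Ring R] [Algebra K R]
    [FiniteDimensional K R] : Finite (Irr K R) := by
  rw [← Set.finite_univ_iff]
  refine (finite_simple_quotients (K := K) _ R rfl).subset fun S _ => ?_
  have : Nontrivial S.rep.carrier := IsSimpleModule.nontrivial R _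
  obtain ⟨v, hv⟩ := exists_ne (0 : S.rep.carrier)
  refine ⟨LinearMap.toSpanSingleton R _ v, fun h => hv ?_⟩
  simpa using LinearMap.congr_fun h 1

/-! ### Maximal weights and Serre classes defined by supports -/

namespace GrMod

variable {K : Type u} [Field K] {A : Type v} [Ring A] [Algebra K A] {X : Type w}
  [AddCommGroup X] [DecidableEq X] {𝒜 : X → Submodule K A} [FiniteDimensional K A]

theorem exists_maximal_weight {ι : Type*} (I : Module.Basis ι ℤ X) (M : GrMod 𝒜) {x : X}
    (hx : M.comp x ≠ ⊥) : ∃ ξ, M.comp ξ ≠ ⊥ ∧ ξ - x ∈ natCone I ∧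
      ∀ y ∈ natCone I, y ≠ 0 → M.comp (y + ξ) = ⊥ := by
  obtain ⟨ξ, hξ, hmax⟩ := Set.Finite.exists_le_maximal (α := Weight I) M.finite_support hx
  refine ⟨(show X from ξ), hmax.1, hξ, fun y hy hy0 => ?_⟩
  by_contra h
  let ξ' : X := ξ
  have h1 : ξ ≤ (show Weight I from y + ξ') := by
    change y + ξ' - ξ' ∈ natCone I
    rwa [add_sub_cancel_right]
  have h2 : y + ξ' = ξ' := le_antisymm (α := Weight I) (hmax.2 h h1) h1
  exact hy0 (by simpa using h2)

/-- The graded modules whose degrees lie in `W`. -/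
def supportedIn (W : Set X) : ObjectProperty (GrMod 𝒜) := fun M => ∀ x, M.comp x ≠ ⊥ → x ∈ W

instance (W : Set X) : (supportedIn (𝒜 := 𝒜) W).IsSerreClass where
  exists_zero := ⟨zeroObj, (IsZero.iff_id_eq_zero _).2 (by ext m; rfl),
    fun x hx => absurd (Submodule.eq_bot_iff _ |>.2 fun _ _ => rfl) hx⟩
  prop_of_mono f _ h := fun x hx => h x (comp_ne_bot_of_injective (injective_of_mono f) hx)
  prop_of_epi f _ h := fun x hx => h x (comp_ne_bot_of_surjective (surjective_of_epi f) hx)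
  prop_X₂_of_shortExact hS h₁ h₃ := fun x hx =>
    (comp_ne_bot_of_shortExact hS hx).elim (h₁ x) (h₃ x)

/-- Dévissage: a simple subobject is split off, and both it and the quotient keep their degrees in
`W`, so induction on the dimension applies. -/
theorem prop_of_supportedIn (P : ObjectProperty (GrMod 𝒜)) [P.IsSerreClass] {W : Set X}
    (h : ∀ S, Simple S → supportedIn W S → P S) (M : GrMod 𝒜) (hM : supportedIn W M) : P M := by
  induction hn : Module.finrank K M.carrier using Nat.strong_induction_on generalizing M with
  | _ n ih =>
    by_cases h0 : IsZero M
    · exact P.prop_of_isZero h0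
    have := (finite_length M).2
    obtain ⟨Y, hY⟩ := exists_simple_subobject h0
    have hS : (ShortComplex.mk Y.arrow (cokernel.π Y.arrow) (by simp)).ShortExact :=
      { exact := ShortComplex.exact_cokernel _ }
    have hfin : Module.finrank K M.carrier = Module.finrank K (Y : GrMod 𝒜).carrier +
        Module.finrank K (cokernel Y.arrow).carrier := finrank_of_shortExact hS
    have h1 : Module.finrank K (Y : GrMod 𝒜).carrier ≠ 0 := fun e =>
      Simple.not_isZero (Y : GrMod 𝒜) (finrank_eq_zero_iff.1 e)
    exact P.prop_X₂_of_shortExact hS (h _ hY ((supportedIn W).prop_of_mono Y.arrow hM))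
      (ih (Module.finrank K (cokernel Y.arrow).carrier) (by omega) _
        ((supportedIn W).prop_of_epi (cokernel.π Y.arrow) hM) rfl)

end GrMod

/-! ### Classification of the simple graded modules -/

namespace TriangularDecomposition

variable {K : Type u} [Field K] {A : Type v} [Ring A] [Algebra K A]
  {X : Type w} [AddCommGroup X] [DecidableEq X] {ι : Type*} {I : Module.Basis ι ℤ X}
  {𝒜 : X → Submodule K A} [GradedAlgebra 𝒜] (𝒯 : TriangularDecomposition I 𝒜)
  [FiniteDimensional K A]

/-- The component of degree `w` of the simple module `L(λ, w)` is `λ`. -/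
noncomputable def simpleWeight (l : 𝒯.Label) :
    l.type.rep.carrier ≃ₗ[𝒯.T] 𝒯.weightSpace (𝒯.simple l) l.weight :=
  have := 𝒯.finite_simple l.type.rep
  𝒯.headWeight l.type.rep.carrier l.weight

theorem simple_simple (l : 𝒯.Label) : Simple (𝒯.simple l) :=
  have := 𝒯.finite_simple l.type.rep
  𝒯.simple_head l.type.rep.carrier l.weight

theorem simple_support (l : 𝒯.Label) {x : X} (h : (𝒯.simple l).comp x ≠ ⊥) :
    l.weight - x ∈ natCone I :=
  have := 𝒯.finite_simple l.type.rep
  𝒯.head_support l.type.rep.carrier l.weight h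

theorem simple_comp_weight_ne_bot (l : 𝒯.Label) : (𝒯.simple l).comp l.weight ≠ ⊥ := by
  have : Nontrivial l.type.rep.carrier := IsSimpleModule.nontrivial 𝒯.T _
  obtain ⟨v, hv⟩ := exists_ne (0 : l.type.rep.carrier)
  exact GrMod.comp_ne_bot_of_mem (𝒯.simpleWeight l v).2 fun h =>
    hv ((𝒯.simpleWeight l).injective (Subtype.ext (by rw [h, map_zero]; rfl)))

theorem simple_hom_ext {l : 𝒯.Label} {M : GrMod 𝒜} {f g : 𝒯.simple l ⟶ M}
    (h : ∀ v, f.toLin (𝒯.simpleWeight l v) = g.toLin (𝒯.simpleWeight l v)) : f = g :=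
  have := 𝒯.finite_simple l.type.rep
  𝒯.head_hom_ext h

/-- Isomorphic graded modules have isomorphic weight spaces. -/
def weightEquiv {M N : GrMod 𝒜} (e : M ≅ N) (ξ : X) :
    𝒯.weightSpace M ξ ≃ₗ[𝒯.T] 𝒯.weightSpace N ξ :=
  LinearEquiv.ofLinearMap (𝒯.weightMap e.hom ξ) (𝒯.weightMap e.inv ξ)
    (by ext m; exact GrMod.congr_toLin e.inv_hom_id m.1)
    (by ext m; exact GrMod.congr_toLin e.hom_inv_id m.1)

/-- The label can be read off: `w` is the largest degree of `L(λ, w)`, and `λ` is the component in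
that degree. -/
theorem simple_injective (l l' : 𝒯.Label) (h : Nonempty (𝒯.simple l ≅ 𝒯.simple l')) : l = l' := by
  obtain ⟨e⟩ := h
  have h1 : l.weight = l'.weight := by
    refine le_antisymm (α := Weight I) ?_ ?_
    · exact 𝒯.simple_support l' (GrMod.comp_ne_bot_of_injective (f := e.hom)
        (GrMod.bijective_of_isIso e.hom).1 (𝒯.simple_comp_weight_ne_bot l))
    · exact 𝒯.simple_support l (GrMod.comp_ne_bot_of_injective (f := e.inv)
        (GrMod.bijective_of_isIso e.inv).1 (𝒯.simple_comp_weight_ne_bot l'))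
  refine Label.ext ?_ h1
  have φ := (𝒯.simpleWeight l).trans (𝒯.weightEquiv e l.weight)
  rw [h1] at φ
  rw [← Quotient.out_eq l.type, ← Quotient.out_eq l'.type]
  exact Quotient.sound ⟨φ.trans (𝒯.simpleWeight l').symm⟩

/-- The component at a maximal degree `ξ` is a nonzero finite-dimensional `T`-module consisting of
singular elements. Any simple `T`-submodule of it gives a label. -/
theorem simple_surjective (M : GrMod 𝒜) (hM : Simple M) :
    ∃ l, Nonempty (M ≅ 𝒯.simple l) := by
  obtain ⟨m, hm⟩ := (GrMod.simple_iff.1 hM).1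
  obtain ⟨x, hx⟩ := GrMod.exists_comp_ne_bot hm
  obtain ⟨ξ, hξ, -, hmax⟩ := GrMod.exists_maximal_weight I M hx
  have : Nontrivial (𝒯.weightSpace M ξ) := Submodule.nontrivial_iff_ne_bot.2 fun h => hξ
    ((Submodule.eq_bot_iff _).2 fun m hm => (Submodule.eq_bot_iff _).1 h m hm)
  have : FiniteDimensional K (𝒯.weightSpace M ξ) :=
    FiniteDimensional.finiteDimensional_submodule (M.comp ξ)
  have : IsArtinian 𝒯.T (𝒯.weightSpace M ξ) := isArtinian_of_tower K inferInstance
  obtain ⟨N, hN⟩ := exists_simple_submodule_of_isArtinian 𝒯.T (𝒯.weightSpace M ξ)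
  let S : SimpleMod K 𝒯.T := ⟨N⟩
  let l : 𝒯.Label := ⟨Quotient.mk _ S, ξ⟩
  obtain ⟨e⟩ : Nonempty (l.type.rep.carrier ≃ₗ[𝒯.T] N) :=
    Quotient.exact (Quotient.out_eq l.type)
  have := 𝒯.finite_simple l.type.rep
  have hmem : ∀ v, (e v : M.carrier) ∈ M.comp ξ := fun v => (e v).1.2
  refine ⟨l, 𝒯.nonempty_iso_head (V := l.type.rep.carrier) (d := ξ)
    ((𝒯.weightSpace M ξ).subtype ∘ₗ N.subtype ∘ₗ e.toLinearMap) ?_ hmem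
    (fun v => 𝒯.isSingular_of_maximal hmax (hmem v))⟩
  intro h
  have : Nontrivial l.type.rep.carrier := IsSimpleModule.nontrivial 𝒯.T _
  obtain ⟨v, hv⟩ := exists_ne (0 : l.type.rep.carrier)
  exact hv (e.injective (Subtype.ext (Subtype.ext (by
    rw [map_zero]; exact LinearMap.congr_fun h v))))

/-- After transport to some `L(λ, w)`, an endomorphism acts on the component `λ` by a scalar since
`T` is split, and a morphism out of `L(λ, w)` is determined there. -/
theorem end_simple (𝒯 : TriangularDecomposition I 𝒜) (M : GrMod 𝒜) (hM : Simple M) :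
    Function.Bijective (algebraMap K (End M)) := by
  constructor
  · have : Nontrivial (End M) := ⟨𝟙 M, 0, id_nonzero M⟩
    exact FaithfulSMul.algebraMap_injective K (End M)
  · intro g
    obtain ⟨l, ⟨e⟩⟩ := 𝒯.simple_surjective M hM
    let f : 𝒯.simple l ⟶ 𝒯.simple l := e.inv ≫ g ≫ e.hom
    obtain ⟨k, hk⟩ := (𝒯.T_split l.type.rep).2
      ((𝒯.simpleWeight l).symm.toLinearMap ∘ₗ 𝒯.weightMap f l.weight ∘ₗ
        (𝒯.simpleWeight l).toLinearMap)
    have hf : f = k • 𝟙 _ := by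
      refine 𝒯.simple_hom_ext fun v => ?_
      have h1 := LinearMap.congr_fun hk v
      rw [LinearMap.comp_apply, LinearMap.comp_apply, LinearEquiv.coe_coe, LinearEquiv.coe_coe,
        LinearEquiv.eq_symm_apply, Module.algebraMap_end_apply] at h1
      have h2 := LinearMap.map_smul_of_tower (𝒯.simpleWeight l).toLinearMap k v
      exact (congrArg Subtype.val (h2.symm.trans h1)).symm
    refine ⟨k, ?_⟩
    have hg : g = e.hom ≫ f ≫ e.inv := by simp [f]
    rw [hg, hf, Algebra.algebraMap_eq_smul_one]
    simp [End.one_def]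

end TriangularDecomposition

/-! ### Functoriality of standard modules and the weight functors -/

namespace TriangularDecomposition

variable {K : Type u} [Field K] {A : Type v} [Ring A] [Algebra K A]
  {X : Type w} [AddCommGroup X] [DecidableEq X] {ι : Type*} {I : Module.Basis ι ℤ X}
  {𝒜 : X → Submodule K A} [GradedAlgebra 𝒜] (𝒯 : TriangularDecomposition I 𝒜)

section

variable {V W : Type v} [AddCommGroup V] [Module K V] [Module 𝒯.T V] [IsScalarTower K 𝒯.T V]
  [FiniteDimensional K V] [AddCommGroup W] [Module K W] [Module 𝒯.T W] [IsScalarTower K 𝒯.T W]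
  [FiniteDimensional K W] (d : X)

/-- Functoriality of standard modules. -/
noncomputable def stdMap (f : V →ₗ[𝒯.T] W) : 𝒯.properStandard V d ⟶ 𝒯.properStandard W d :=
  𝒯.stdDesc (𝒯.stdMk W d ∘ₗ f) (fun v => 𝒯.stdMk_mem W d (f v))
    (fun v => 𝒯.isSingular_stdMk W d (f v))

omit [IsScalarTower K 𝒯.T W] in
@[simp] theorem stdMap_stdMk (f : V →ₗ[𝒯.T] W) (v : V) :
    (𝒯.stdMap d f).toLin (𝒯.stdMk V d v) = 𝒯.stdMk W d (f v) := 𝒯.stdDesc_stdMk _ _ _ v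

/-- In terms of `A⁻ ⊗ V` the map is `id ⊗ f`, injective because `A⁻` is flat over `K`. This yields
left exactness of standardization. -/
theorem stdMap_injective {f : V →ₗ[𝒯.T] W} (hf : Function.Injective f) :
    Function.Injective (𝒯.stdMap d f).toLin := by
  have h : ∀ z, (𝒯.stdMap d f).toLin (𝒯.properStandardEquiv V d z) =
      𝒯.properStandardEquiv W d (LinearMap.lTensor 𝒯.neg (f.restrictScalars K) z) := by
    intro z
    induction z with
    | zero => simp only [map_zero]
    | add x y hx hy => simp only [map_add, hx, hy]
    | tmul n v =>
      rw [properStandardEquiv_tmul, map_smul, stdMap_stdMk]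
      rfl
  have h2 : Function.Injective (LinearMap.lTensor 𝒯.neg (f.restrictScalars K)) :=
    Module.Flat.lTensor_preserves_injective_linearMap _ hf
  intro z z' hz
  obtain ⟨z, rfl⟩ := (𝒯.properStandardEquiv V d).surjective z
  obtain ⟨z', rfl⟩ := (𝒯.properStandardEquiv V d).surjective z'
  rw [h, h] at hz
  rw [h2 ((𝒯.properStandardEquiv W d).injective hz)]

variable (V) in
theorem finrank_properStandard [FiniteDimensional K A] :
    Module.finrank K (𝒯.properStandard V d).carrier =
      Module.finrank K 𝒯.neg * Module.finrank K V := by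
  rw [← (𝒯.properStandardEquiv V d).finrank_eq, Module.finrank_tensorProduct]

end

variable [FiniteDimensional K A]

instance (M : GrMod 𝒜) (ξ : X) : Module.Finite 𝒯.T (𝒯.weightSpace M ξ) :=
  have : FiniteDimensional K (𝒯.weightSpace M ξ) :=
    FiniteDimensional.finiteDimensional_submodule (M.comp ξ)
  Module.Finite.of_restrictScalars_finite K 𝒯.T _

/-- The functor that maps a graded module to its component of degree `ξ`. -/
def weightFunctor (ξ : X) : GrMod 𝒜 ⥤ FGModuleCat.{v} 𝒯.T where
  obj M := FGModuleCat.of 𝒯.T (𝒯.weightSpace M ξ)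
  map f := FGModuleCat.ofHom (𝒯.weightMap f ξ)

instance isNoetherianRing_T : IsNoetherianRing 𝒯.T := isNoetherian_of_tower K inferInstance

end TriangularDecomposition

/-! ### Exactness and isomorphisms for finitely generated modules -/

namespace FGModuleCat

variable {R : Type v} [Ring R] [IsNoetherianRing R]

theorem mono_iff {M N : FGModuleCat.{v} R} (f : M ⟶ N) :
    Mono f ↔ Function.Injective f.hom.hom := by
  rw [← (forget₂ (FGModuleCat.{v} R) (ModuleCat.{v} R)).mono_map_iff_mono,
    ModuleCat.mono_iff_injective]
  rfl

theorem epi_iff {M N : FGModuleCat.{v} R} (f : M ⟶ N) :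
    Epi f ↔ Function.Surjective f.hom.hom := by
  rw [← (forget₂ (FGModuleCat.{v} R) (ModuleCat.{v} R)).epi_map_iff_epi,
    ModuleCat.epi_iff_surjective]
  rfl

theorem shortExact_of {S : ShortComplex (FGModuleCat.{v} R)}
    (hf : Function.Injective S.f.hom.hom) (hg : Function.Surjective S.g.hom.hom)
    (h : ∀ m, S.g.hom.hom m = 0 → ∃ l, S.f.hom.hom l = m) : S.ShortExact := by
  have := (mono_iff S.f).2 hf
  have := (epi_iff S.g).2 hg
  have key : (S.map (forget₂ (FGModuleCat.{v} R) (ModuleCat.{v} R))).Exact := by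
    rw [ShortComplex.moduleCat_exact_iff]
    exact h
  exact { exact := (S.exact_map_iff_of_faithful _).1 key }

/-- Finitely generated modules are isomorphic if they are linearly equivalent. -/
def isoOfEquiv {V W : Type v} [AddCommGroup V] [Module R V] [Module.Finite R V]
    [AddCommGroup W] [Module R W] [Module.Finite R W] (e : V ≃ₗ[R] W) : of R V ≅ of R W where
  hom := ofHom e.toLinearMap
  inv := ofHom e.symm.toLinearMap
  hom_inv_id := by ext v; exact e.symm_apply_apply v
  inv_hom_id := by ext v; exact e.apply_symm_apply v

theorem isIso_of_bijective {M N : FGModuleCat.{v} R} (f : M ⟶ N)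
    (hf : Function.Bijective f.hom.hom) : IsIso f :=
  have := (mono_iff f).2 hf.1
  have := (epi_iff f).2 hf.2
  isIso_of_mono_of_epi f

end FGModuleCat

namespace TriangularDecomposition

variable {K : Type u} [Field K] {A : Type v} [Ring A] [Algebra K A]
  {X : Type w} [AddCommGroup X] [DecidableEq X] {ι : Type*} {I : Module.Basis ι ℤ X}
  {𝒜 : X → Submodule K A} [GradedAlgebra 𝒜] (𝒯 : TriangularDecomposition I 𝒜)
  [FiniteDimensional K A]

/-- A weight as an element of the group of degrees. -/
abbrev _root_.Weight.val (ξ : Weight I) : X := ξ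

/-- The degrees `≤ ξ`. -/
def weightsLE (ξ : Weight I) : Set X := {x : X | ξ.val - x ∈ natCone I}

/-- The degrees `< ξ`. -/
def weightsLT (ξ : Weight I) : Set X := {x : X | ξ.val - x ∈ natCone I ∧ x ≠ ξ.val}

/-! ### Weights and the Serre subcategories -/

instance (ξ : X) : (𝒯.weightFunctor ξ).Additive where

theorem weightFunctor_exact (ξ : X) : PreservesFiniteLimits (𝒯.weightFunctor ξ) ∧
    PreservesFiniteColimits (𝒯.weightFunctor ξ) := by
  refine ((Functor.exact_tfae (𝒯.weightFunctor ξ)).out 0 3).1 fun S hS => ?_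
  have := hS.mono_f
  have := hS.epi_g
  refine FGModuleCat.shortExact_of (𝒯.weightMap_injective (GrMod.injective_of_mono S.f) ξ)
    (𝒯.weightMap_surjective (GrMod.surjective_of_epi S.g) ξ) ?_
  rintro ⟨m, hm⟩ h
  obtain ⟨l, rfl⟩ := GrMod.exists_of_shortExact hS (congrArg Subtype.val h)
  exact ⟨⟨l, GrMod.mem_of_injective S.f (GrMod.injective_of_mono S.f) hm⟩, rfl⟩

instance (ξ : X) : PreservesFiniteLimits (𝒯.weightFunctor ξ) := (𝒯.weightFunctor_exact ξ).1

instance (ξ : X) : PreservesFiniteColimits (𝒯.weightFunctor ξ) := (𝒯.weightFunctor_exact ξ).2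

/-- `C_{≤ ξ}` consists of the modules with weights `≤ ξ`. -/
theorem serreSpan_simple_eq (W : Set X) (hW : ∀ y ∈ W, ∀ x, y - x ∈ natCone I → x ∈ W) :
    serreSpan (fun M => ∃ l : 𝒯.Label, l.weight ∈ W ∧ M = 𝒯.simple l) =
      GrMod.supportedIn W := by
  apply le_antisymm
  · intro M hM
    refine hM _ inferInstance ?_
    rintro _ ⟨l, hl, rfl⟩ x hx
    exact hW _ hl _ (𝒯.simple_support l hx)
  -- By dévissage only simple modules matter, and a simple module with degrees in `W` has in
  -- particular its label's weight in `W`.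
  · refine GrMod.prop_of_supportedIn _ fun S hS hSW => ?_
    obtain ⟨l, ⟨e⟩⟩ := 𝒯.simple_surjective S hS
    have h1 : l.weight ∈ W := hSW _ (GrMod.comp_ne_bot_of_injective (f := e.inv)
      (GrMod.bijective_of_isIso e.inv).1 (𝒯.simple_comp_weight_ne_bot l))
    intro P _ hP
    exact P.prop_of_iso e.symm (hP _ ⟨l, h1, rfl⟩)

/-- The map from labels to weights. -/
abbrev deg : 𝒯.Label → Weight I := Label.degree

theorem serreLE_eq (ξ : Weight I) :
    serreLE 𝒯.simple 𝒯.deg ξ = GrMod.supportedIn (weightsLE ξ) :=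
  𝒯.serreSpan_simple_eq (weightsLE ξ) fun _ hy _ hx => le_trans (α := Weight I) hx hy

theorem serreLT_eq (ξ : Weight I) :
    serreLT 𝒯.simple 𝒯.deg ξ = GrMod.supportedIn (weightsLT ξ) := by
  rw [← 𝒯.serreSpan_simple_eq (weightsLT ξ) fun y hy x hx =>
    lt_iff_le_and_ne.1 (lt_of_le_of_lt (α := Weight I) hx (lt_iff_le_and_ne.2 hy))]
  unfold serreLT
  congr 1
  ext M
  refine exists_congr fun l => and_congr_left fun _ => ?_
  exact lt_iff_le_and_ne

/-- The subcategory `C_{≤ ξ}` of graded modules. -/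
abbrev CatLE (ξ : Weight I) := SubcategoryLE 𝒯.simple 𝒯.deg ξ

/-- The functor from `C_{≤ ξ}` to `T`-modules. -/
def weightLE (ξ : Weight I) : 𝒯.CatLE ξ ⥤ FGModuleCat.{v} 𝒯.T :=
  (serreLE 𝒯.simple 𝒯.deg ξ).ι ⋙ 𝒯.weightFunctor ξ.val

instance (ξ : Weight I) : PreservesFiniteLimits (𝒯.weightLE ξ) :=
  comp_preservesFiniteLimits _ _

instance (ξ : Weight I) : PreservesFiniteColimits (𝒯.weightLE ξ) :=
  comp_preservesFiniteColimits _ _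

theorem isZero_weightFunctor_iff {M : GrMod 𝒜} {ξ : X} :
    IsZero ((𝒯.weightFunctor ξ).obj M) ↔ M.comp ξ = ⊥ := by
  rw [IsZero.iff_id_eq_zero, Submodule.eq_bot_iff]
  constructor
  · intro h m hm
    have := LinearMap.congr_fun (congrArg (fun f => f.hom.hom) h) ⟨m, hm⟩
    exact congrArg Subtype.val this
  · intro h
    ext m
    exact Subtype.ext (h _ m.2)

/-- For a module with all degrees `≤ ξ`, having all degrees `< ξ` just means that the component of
degree `ξ` vanishes. -/
theorem kernel_weightLE (ξ : Weight I) :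
    serreLTInLE 𝒯.simple 𝒯.deg ξ = (𝒯.weightLE ξ).kernel := by
  ext M
  have h1 : serreLTInLE 𝒯.simple 𝒯.deg ξ M ↔
      GrMod.supportedIn (weightsLT ξ) M.obj := by
    rw [← serreLT_eq]; rfl
  have h2 : GrMod.supportedIn (weightsLE ξ) M.obj := by
    rw [← serreLE_eq]; exact M.property
  have h3 : (𝒯.weightLE ξ).kernel M ↔ M.obj.comp ξ.val = ⊥ :=
    𝒯.isZero_weightFunctor_iff
  rw [h1, h3]
  constructor
  · intro h
    by_contra h'
    exact (h _ h').2 rfl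
  · intro h x hx
    exact ⟨h2 x hx, fun e => hx (e ▸ h)⟩

end TriangularDecomposition

namespace TriangularDecomposition

variable {K : Type u} [Field K] {A : Type v} [Ring A] [Algebra K A]
  {X : Type w} [AddCommGroup X] [DecidableEq X] {ι : Type*} {I : Module.Basis ι ℤ X}
  {𝒜 : X → Submodule K A} [GradedAlgebra 𝒜] (𝒯 : TriangularDecomposition I 𝒜)
  [FiniteDimensional K A]

/-! ### The standardization functors -/

/-- The `K`-vector space underlying a `T`-module. -/
abbrev restrictModule (V : Type v) [AddCommGroup V] [Module 𝒯.T V] : Module K V :=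
  Module.compHom V (algebraMap K 𝒯.T)

omit [FiniteDimensional K A] in
theorem restrictModule_tower (V : Type v) [AddCommGroup V] [Module 𝒯.T V] :
    letI := 𝒯.restrictModule V
    IsScalarTower K 𝒯.T V :=
  letI := 𝒯.restrictModule V
  ⟨fun k t v => by
    change (k • t) • v = algebraMap K 𝒯.T k • t • v
    rw [Algebra.smul_def, mul_smul]⟩

theorem restrictModule_finite (V : Type v) [AddCommGroup V] [Module 𝒯.T V] [Module.Finite 𝒯.T V] :
    letI := 𝒯.restrictModule V
    FiniteDimensional K V :=
  letI := 𝒯.restrictModule V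
  have := 𝒯.restrictModule_tower V
  Module.Finite.trans (R := K) 𝒯.T V

/-- The standard module of a finitely generated `T`-module. -/
noncomputable def stdObj (V : FGModuleCat.{v} 𝒯.T) (d : X) : GrMod 𝒜 :=
  letI := 𝒯.restrictModule V.obj
  have := 𝒯.restrictModule_finite V.obj
  𝒯.properStandard V.obj d

/-- The canonical map from a `T`-module to the weight space of its standard module. -/
noncomputable def stdUnit (V : FGModuleCat.{v} 𝒯.T) (d : X) :
    V.obj →ₗ[𝒯.T] 𝒯.weightSpace (𝒯.stdObj V d) d :=
  letI := 𝒯.restrictModule V.obj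
  have := 𝒯.restrictModule_finite V.obj
  (𝒯.stdMk V.obj d).codRestrict _ (𝒯.stdMk_mem V.obj d)

theorem stdUnit_bijective (V : FGModuleCat.{v} 𝒯.T) (d : X) :
    Function.Bijective (𝒯.stdUnit V d) := by
  let := 𝒯.restrictModule V.obj
  have := 𝒯.restrictModule_finite V.obj
  have := 𝒯.restrictModule_tower V.obj
  refine ⟨fun v v' h => 𝒯.stdMk_injective V.obj d (congrArg Subtype.val h), ?_⟩
  rintro ⟨m, hm⟩
  obtain ⟨v, rfl⟩ := 𝒯.exists_stdMk_eq V.obj d hm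
  exact ⟨v, rfl⟩

theorem stdObj_support (V : FGModuleCat.{v} 𝒯.T) (d : X) {x : X}
    (h : (𝒯.stdObj V d).comp x ≠ ⊥) : d - x ∈ natCone I :=
  letI := 𝒯.restrictModule V.obj
  have := 𝒯.restrictModule_finite V.obj
  𝒯.properStandard_support V.obj d h

variable {𝒯} in
theorem stdObj_induction {V : FGModuleCat.{v} 𝒯.T} {d : X} {p : (𝒯.stdObj V d).carrier → Prop}
    (hmul : ∀ n ∈ 𝒯.neg, ∀ v, p (n • (𝒯.stdUnit V d v : (𝒯.stdObj V d).carrier)))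
    (hadd : ∀ x y, p x → p y → p (x + y)) (z : (𝒯.stdObj V d).carrier) : p z :=
  letI := 𝒯.restrictModule V.obj
  have := 𝒯.restrictModule_finite V.obj
  𝒯.properStandard_induction V.obj d hmul hadd z

variable {𝒯} in
theorem stdObj_hom_ext {V : FGModuleCat.{v} 𝒯.T} {d : X} {M : GrMod 𝒜} {f g : 𝒯.stdObj V d ⟶ M}
    (h : ∀ v, f.toLin (𝒯.stdUnit V d v) = g.toLin (𝒯.stdUnit V d v)) : f = g :=
  letI := 𝒯.restrictModule V.obj
  have := 𝒯.restrictModule_finite V.obj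
  𝒯.properStandard_hom_ext h

variable {𝒯} in
/-- The universal property of the standard module. -/
noncomputable def stdObjDesc {V : FGModuleCat.{v} 𝒯.T} {d : X} {M : GrMod 𝒜}
    (f : V.obj →ₗ[𝒯.T] 𝒯.weightSpace M d)
    (hM : ∀ x ∈ natCone I, x ≠ 0 → M.comp (x + d) = ⊥) : 𝒯.stdObj V d ⟶ M :=
  letI := 𝒯.restrictModule V.obj
  have := 𝒯.restrictModule_finite V.obj
  have := 𝒯.restrictModule_tower V.obj
  𝒯.stdDesc ((𝒯.weightSpace M d).subtype ∘ₗ f) (fun v => (f v).2)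
    (fun v => 𝒯.isSingular_of_maximal hM (f v).2)

variable {𝒯} in
@[simp] theorem stdObjDesc_stdUnit {V : FGModuleCat.{v} 𝒯.T} {d : X} {M : GrMod 𝒜}
    (f : V.obj →ₗ[𝒯.T] 𝒯.weightSpace M d)
    (hM : ∀ x ∈ natCone I, x ≠ 0 → M.comp (x + d) = ⊥) (v : V.obj) :
    (stdObjDesc f hM).toLin (𝒯.stdUnit V d v) = f v :=
  letI := 𝒯.restrictModule V.obj
  have := 𝒯.restrictModule_finite V.obj
  have := 𝒯.restrictModule_tower V.obj
  𝒯.stdDesc_stdMk ((𝒯.weightSpace M d).subtype ∘ₗ f) (fun v => (f v).2)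
    (fun v => 𝒯.isSingular_of_maximal hM (f v).2) v

variable {𝒯} in
-- A morphism out of a standard module is determined by its values on `V`, so `f` must be `stdMap`
-- of `φ`. An arbitrary `f` is allowed because the standardization functor gets its action on
-- morphisms from the adjunction.
theorem injective_of_stdUnit {V W : FGModuleCat.{v} 𝒯.T} {d : X} (φ : V.obj →ₗ[𝒯.T] W.obj)
    (hφ : Function.Injective φ) (f : 𝒯.stdObj V d ⟶ 𝒯.stdObj W d)
    (hf : ∀ v, f.toLin (𝒯.stdUnit V d v) = 𝒯.stdUnit W d (φ v)) :
    Function.Injective f.toLin := by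
  let := 𝒯.restrictModule V.obj
  have := 𝒯.restrictModule_finite V.obj
  have := 𝒯.restrictModule_tower V.obj
  let := 𝒯.restrictModule W.obj
  have := 𝒯.restrictModule_finite W.obj
  have := 𝒯.restrictModule_tower W.obj
  have h : f = 𝒯.stdMap d φ := 𝒯.properStandard_hom_ext fun v =>
    (hf v).trans (𝒯.stdMap_stdMk d φ v).symm
  rw [h]
  exact 𝒯.stdMap_injective d hφ

theorem stdObj_mem_supportedIn (V : FGModuleCat.{v} 𝒯.T) (ξ : Weight I) :
    GrMod.supportedIn (weightsLE ξ) (𝒯.stdObj V ξ.val) :=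
  fun _ hx => 𝒯.stdObj_support V ξ.val hx

/-- The standard module as an object of `C_{≤ ξ}`. -/
noncomputable def stdLE (ξ : Weight I) (V : FGModuleCat.{v} 𝒯.T) : 𝒯.CatLE ξ :=
  ⟨𝒯.stdObj V ξ.val, by rw [serreLE_eq]; exact 𝒯.stdObj_mem_supportedIn V ξ⟩

omit [GradedAlgebra 𝒜] [FiniteDimensional K A] in
theorem comp_eq_bot_of_supportedIn {ξ : Weight I} {M : GrMod 𝒜}
    (hM : GrMod.supportedIn (weightsLE ξ) M) (x : X) (hx : x ∈ natCone I) (hx0 : x ≠ 0) :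
    M.comp (x + ξ.val) = ⊥ := by
  by_contra h
  have h1 : ξ.val - (x + ξ.val) ∈ natCone I := hM _ h
  rw [sub_add_cancel_right] at h1
  exact hx0 (natCone_neg_eq_zero I hx h1)

theorem catLE_supportedIn {ξ : Weight I} (M : 𝒯.CatLE ξ) :
    GrMod.supportedIn (weightsLE ξ) M.obj := by
  rw [← serreLE_eq]; exact M.property

/-- The adjunction between standardization and weight spaces on morphisms. -/
noncomputable def stdHomEquiv (ξ : Weight I) (V : FGModuleCat.{v} 𝒯.T) (M : 𝒯.CatLE ξ) :
    (𝒯.stdLE ξ V ⟶ M) ≃ (V ⟶ (𝒯.weightLE ξ).obj M) where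
  toFun g := FGModuleCat.ofHom (𝒯.weightMap g.hom ξ.val ∘ₗ 𝒯.stdUnit V ξ.val)
  invFun φ := ObjectProperty.homMk
    (stdObjDesc φ.hom.hom (comp_eq_bot_of_supportedIn (𝒯.catLE_supportedIn M)))
  left_inv g := by
    apply ObjectProperty.hom_ext
    refine stdObj_hom_ext fun v => ?_
    exact stdObjDesc_stdUnit (𝒯.weightMap g.hom ξ.val ∘ₗ 𝒯.stdUnit V ξ.val)
      (comp_eq_bot_of_supportedIn (𝒯.catLE_supportedIn M)) v
  right_inv φ := FGModuleCat.hom_ext (LinearMap.ext fun v => Subtype.ext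
    (stdObjDesc_stdUnit φ.hom.hom (comp_eq_bot_of_supportedIn (𝒯.catLE_supportedIn M)) v))

/-- The standardization functor from `T`-modules to `C_{≤ ξ}`. -/
noncomputable def stdFunctor (ξ : Weight I) : FGModuleCat.{v} 𝒯.T ⥤ 𝒯.CatLE ξ :=
  Adjunction.leftAdjointOfEquiv (G := 𝒯.weightLE ξ) (𝒯.stdHomEquiv ξ) (fun _ _ _ _ _ => rfl)

/-- Standardization is left adjoint to taking weight spaces. -/
noncomputable def stdAdj (ξ : Weight I) : 𝒯.stdFunctor ξ ⊣ 𝒯.weightLE ξ :=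
  Adjunction.adjunctionOfEquivLeft (G := 𝒯.weightLE ξ) (𝒯.stdHomEquiv ξ) (fun _ _ _ _ _ => rfl)

theorem stdFunctor_map_stdUnit (ξ : Weight I) {V W : FGModuleCat.{v} 𝒯.T} (f : V ⟶ W) (v : V.obj) :
    Subtype.val (p := (· ∈ 𝒯.weightSpace (𝒯.stdObj W ξ.val) ξ.val))
      (𝒯.stdUnit W ξ.val (f.hom.hom v)) =
      ((𝒯.stdFunctor ξ).map f).hom.toLin (𝒯.stdUnit V ξ.val v).1 :=
  (stdObjDesc_stdUnit (𝒯.stdUnit W ξ.val ∘ₗ f.hom.hom)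
    (comp_eq_bot_of_supportedIn (𝒯.stdObj_mem_supportedIn W ξ)) v).symm

/-- The unit is the identification of `V` with the top component of its standard module. Its
invertibility makes the left adjoint fully faithful. -/
instance isIso_stdAdj_unit_app (ξ : Weight I) (V : FGModuleCat.{v} 𝒯.T) :
    IsIso ((𝒯.stdAdj ξ).unit.app V) :=
  FGModuleCat.isIso_of_bijective _ (𝒯.stdUnit_bijective V ξ.val)

instance (ξ : Weight I) : (𝒯.stdFunctor ξ).Full := (𝒯.stdAdj ξ).full_L_of_isSplitEpi_unit_app

instance (ξ : Weight I) : (𝒯.stdFunctor ξ).Faithful := (𝒯.stdAdj ξ).faithful_L_of_mono_unit_app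

instance (ξ : Weight I) : PreservesFiniteColimits (𝒯.stdFunctor ξ) :=
  have := (𝒯.stdAdj ξ).leftAdjoint_preservesColimits
  PreservesColimits.preservesFiniteColimits _

instance (ξ : Weight I) : (𝒯.weightLE ξ).Additive :=
  inferInstanceAs ((serreLE 𝒯.simple 𝒯.deg ξ).ι ⋙ 𝒯.weightFunctor ξ.val).Additive

instance (ξ : Weight I) : (𝒯.stdFunctor ξ).Additive := (𝒯.stdAdj ξ).left_adjoint_additive

/-- Right exactness is automatic for a left adjoint, so it remains to preserve monomorphisms. -/
instance (ξ : Weight I) : PreservesFiniteLimits (𝒯.stdFunctor ξ) := by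
  rw [Functor.preservesFiniteLimits_iff_forall_exact_map_and_mono]
  intro S hS
  refine ⟨((Functor.preservesFiniteColimits_iff_forall_exact_map_and_epi _).1 inferInstance S hS).1,
    ?_⟩
  have := hS.mono_f
  apply (serreLE 𝒯.simple 𝒯.deg ξ).ι.mono_of_mono_map
  apply GrMod.mono_of_injective
  exact injective_of_stdUnit S.f.hom.hom ((FGModuleCat.mono_iff _).1 inferInstance) _
    (fun v => (𝒯.stdFunctor_map_stdUnit ξ S.f v).symm)

/-! ### The layers -/

theorem isoModSerre_congr {C : Type*} [Category* C] [Abelian C] {P Q : ObjectProperty C}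
    [P.IsSerreClass] [Q.IsSerreClass] (h : P = Q) : P.isoModSerre = Q.isoModSerre := by
  subst h; rfl

/-- The kernel of this exact functor is `C_{< ξ}`, so the isomorphisms modulo `C_{< ξ}` are exactly
the morphisms it inverts. A functor with a fully faithful left adjoint is a localization at the
morphisms it inverts. -/
instance weightLE_isLocalization (ξ : Weight I) :
    (𝒯.weightLE ξ).IsLocalization (serreLTInLE 𝒯.simple 𝒯.deg ξ).isoModSerre := by
  rw [isoModSerre_congr (𝒯.kernel_weightLE ξ),
    Abelian.isoModSerre_kernel_eq_inverseImage_isomorphisms]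
  exact (𝒯.stdAdj ξ).isLocalization'

/-- The layer `C_ξ` is equivalent to the category of finitely generated `T`-modules. -/
noncomputable def layerEquiv (ξ : Weight I) : Layer 𝒯.simple 𝒯.deg ξ ≌ FGModuleCat.{v} 𝒯.T :=
  Localization.uniq (layerQ 𝒯.simple 𝒯.deg ξ) (𝒯.weightLE ξ)
    (serreLTInLE 𝒯.simple 𝒯.deg ξ).isoModSerre

/-- The quotient functor onto the layer is given by the weight space. -/
noncomputable def layerIso (ξ : Weight I) :
    𝒯.weightLE ξ ⋙ (𝒯.layerEquiv ξ).inverse ≅ layerQ 𝒯.simple 𝒯.deg ξ :=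
  Localization.compUniqInverse (layerQ 𝒯.simple 𝒯.deg ξ) (𝒯.weightLE ξ)
    (serreLTInLE 𝒯.simple 𝒯.deg ξ).isoModSerre

/-- The standardization functor on the layer. -/
noncomputable def layerStd (ξ : Weight I) : Layer 𝒯.simple 𝒯.deg ξ ⥤ 𝒯.CatLE ξ :=
  (𝒯.layerEquiv ξ).functor ⋙ 𝒯.stdFunctor ξ

/-- Standardization on the layer is left adjoint to the quotient functor. -/
noncomputable def layerAdj (ξ : Weight I) : 𝒯.layerStd ξ ⊣ layerQ 𝒯.simple 𝒯.deg ξ :=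
  ((𝒯.layerEquiv ξ).toAdjunction.comp (𝒯.stdAdj ξ)).ofNatIsoRight (𝒯.layerIso ξ)

instance (ξ : Weight I) : PreservesFiniteLimits (𝒯.layerStd ξ) := comp_preservesFiniteLimits _ _

instance (ξ : Weight I) : PreservesFiniteColimits (𝒯.layerStd ξ) :=
  comp_preservesFiniteColimits _ _

end TriangularDecomposition

/-! ### Projective covers -/

section cover

variable {C : Type*} [Category* C]

theorem IsProjectiveCover.comp_iso {P M N : C} {p : P ⟶ M} (hp : IsProjectiveCover p) (e : M ≅ N) :
    IsProjectiveCover (p ≫ e.hom) where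
  projective := hp.projective
  epi := have := hp.epi; inferInstance
  essential f h := hp.essential f <| by
    rw [← Category.assoc] at h
    have h2 : f ≫ p = ((f ≫ p) ≫ e.hom) ≫ e.inv := by simp
    rw [h2]
    infer_instance

theorem IsProjectiveCover.map_equivalence {D : Type*} [Category* D] (F : C ≌ D) {P M : C}
    {p : P ⟶ M} (hp : IsProjectiveCover p) : IsProjectiveCover (F.functor.map p) where
  projective := (F.map_projective_iff P).2 hp.projective
  epi := have := hp.epi; inferInstance
  essential {N} f h := by
    let g : F.inverse.obj N ⟶ P := F.inverse.map f ≫ (F.unitIso.app P).inv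
    have hg : F.functor.map g = (F.counitIso.app N).hom ≫ f := by simp [g]
    have h1 : Epi (g ≫ p) := by
      apply F.functor.epi_of_epi_map
      rw [F.functor.map_comp, hg, Category.assoc]
      infer_instance
    have h2 := hp.essential g h1
    have h3 : f = (F.counitIso.app N).inv ≫ F.functor.map g := by rw [hg]; simp
    rw [h3]
    infer_instance

/-- A projective cover of a projective object is an isomorphism. -/
theorem IsProjectiveCover.isIso_of_projective [Balanced C] {P M : C} {p : P ⟶ M}
    (hp : IsProjectiveCover p) [Projective M] : IsIso p := by
  have := hp.epi
  let s := Projective.factorThru (𝟙 M) p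
  have hs : s ≫ p = 𝟙 M := Projective.factorThru_comp _ _
  have h1 : Epi s := hp.essential s (by rw [hs]; infer_instance)
  have h2 : IsSplitMono s := ⟨⟨p, hs⟩⟩
  have h3 : IsIso s := isIso_of_epi_of_isSplitMono s
  have h4 : p = inv s := by rw [← cancel_epi s, hs, IsIso.hom_inv_id]
  rw [h4]
  infer_instance

theorem exists_epi_mono_factorization [Abelian C] {M N : C} (f : M ⟶ N) :
    ∃ (J : C) (e : M ⟶ J) (i : J ⟶ N), Epi e ∧ Mono i ∧ e ≫ i = f :=
  ⟨_, _, image.ι f, inferInstance, inferInstance, image.fac f⟩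

/-- Fitting's lemma in an abelian category with a notion of dimension. -/
theorem exists_factorization_pow [Abelian C] (dim : C → ℕ)
    (hmono : ∀ {M N : C} (f : M ⟶ N) [Mono f], dim M ≤ dim N)
    (hmonoIso : ∀ {M N : C} (f : M ⟶ N) [Mono f], dim M = dim N → IsIso f)
    (hepiIso : ∀ {M N : C} (f : M ⟶ N) [Epi f], dim M = dim N → IsIso f)
    {P : C} (h : End P) :
    ∃ (n : ℕ) (J : C) (e : P ⟶ J) (i : J ⟶ P), e ≫ i = (h ^ (n + 1) : End P) ∧ Mono i ∧ Epi e ∧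
      IsIso (i ≫ e) := by
  -- Among the images of all positive powers of `h`, one of least dimension is chosen.
  have hex : ∃ d n, ∃ (J : C) (e : P ⟶ J) (i : J ⟶ P), e ≫ i = (h ^ (n + 1) : End P) ∧ Mono i ∧
      Epi e ∧ dim J = d :=
    ⟨_, 0, _, _, image.ι (h ^ (0 + 1) : End P), image.fac _, inferInstance, inferInstance, rfl⟩
  classical
  obtain ⟨n, J, e, i, hei, hi, he, hJ⟩ := Nat.find_spec hex
  refine ⟨n, J, e, i, hei, hi, he, ?_⟩
  obtain ⟨J', e', i', he', hi', hf⟩ := exists_epi_mono_factorization (i ≫ e)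
  -- The image `J'` of `i ≫ e` is also the image of `(h ^ (n + 1)) ^ 2`, so minimality prevents its
  -- dimension from dropping below that of `J`.
  have h1 : (e ≫ e') ≫ i' ≫ i = (h ^ (n + 1 + n + 1) : End P) := by
    rw [add_assoc (n + 1), pow_add, End.mul_def, ← hei, Category.assoc, reassoc_of% hf,
      Category.assoc]
  have h2 : dim J ≤ dim J' := by
    rw [hJ]
    exact Nat.find_min' hex ⟨_, J', _, _, h1, mono_comp _ _, epi_comp _ _, rfl⟩
  have h3 : IsIso i' := hmonoIso i' (le_antisymm (hmono i') h2)
  have h4 : Epi (i ≫ e) := by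
    rw [← hf]
    exact epi_comp _ _
  exact hepiIso _ rfl

/-- In an abelian category with a notion of dimension, quotients of projective objects have
projective covers. -/
theorem exists_isProjectiveCover [Abelian C] (dim : C → ℕ)
    (hmono : ∀ {M N : C} (f : M ⟶ N) [Mono f], dim M ≤ dim N)
    (hmonoIso : ∀ {M N : C} (f : M ⟶ N) [Mono f], dim M = dim N → IsIso f)
    (hepiIso : ∀ {M N : C} (f : M ⟶ N) [Epi f], dim M = dim N → IsIso f)
    {P₀ L : C} [Projective P₀] (p₀ : P₀ ⟶ L) [Epi p₀] :
    ∃ (P : C) (p : P ⟶ L), IsProjectiveCover p := by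
  classical
  -- The cover is a projective object of least dimension mapping onto `L`; essentiality will follow
  -- from minimality.
  have hex : ∃ n, ∃ (P : C) (p : P ⟶ L), Projective P ∧ Epi p ∧ dim P = n :=
    ⟨_, P₀, p₀, inferInstance, inferInstance, rfl⟩
  obtain ⟨P, p, hP, hp, hdim⟩ := Nat.find_spec hex
  have hmin : ∀ (Q : C) (q : Q ⟶ L), Projective Q → Epi q → dim P ≤ dim Q := by
    intro Q q hQ hq
    rw [hdim]
    exact Nat.find_min' hex ⟨Q, q, hQ, hq, rfl⟩
  refine ⟨P, p, hP, hp, fun {N} f hf => ?_⟩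
  obtain ⟨g, hg⟩ : ∃ g : P ⟶ N, g ≫ f ≫ p = p := ⟨_, Projective.factorThru_comp p (f ≫ p)⟩
  -- The endomorphism `h` lies over `L` and factors through `f`, so it suffices that some positive
  -- power of it is an epimorphism.
  obtain ⟨h, hh⟩ : ∃ h : End P, h = g ≫ f := ⟨_, rfl⟩
  have hp' : ∀ n : ℕ, (h ^ n : End P) ≫ p = p := by
    intro n
    induction n with
    | zero => rw [pow_zero, End.one_def, Category.id_comp]
    | succ n ih => rw [pow_succ, End.mul_def, Category.assoc, ih, hh, Category.assoc, hg]
  obtain ⟨n, J, e, i, hei, hi, he, hie⟩ := exists_factorization_pow dim hmono hmonoIso hepiIso h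
  -- Since `i ≫ e` is invertible, `J` is a retract of `P`; it still maps onto `L`, and minimality
  -- then forces `i` to be an isomorphism.
  have hproj : Projective J := by
    have hr : i ≫ e ≫ inv (i ≫ e) = 𝟙 J := by
      rw [← Category.assoc]
      exact IsIso.hom_inv_id (i ≫ e)
    exact (Retract.mk i (e ≫ inv (i ≫ e)) hr).projective
  have hepi : Epi (i ≫ p) := by
    have : e ≫ i ≫ p = p := by rw [← Category.assoc, hei, hp']
    have : Epi (e ≫ i ≫ p) := by rwa [this]
    exact epi_of_epi e _
  have : IsIso i := hmonoIso i (le_antisymm (hmono i) (hmin _ _ hproj hepi))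
  have hk : Epi (e ≫ i) := epi_comp _ _
  have hkf : e ≫ i = ((h ^ n : End P) ≫ g) ≫ f := by
    rw [hei, pow_succ', End.mul_def, Category.assoc, ← hh]
  rw [hkf] at hk
  exact epi_of_epi ((h ^ n : End P) ≫ g) f

end cover

/-! ### Filtrations -/

section filtration

variable {C : Type*} [Category* C] [Abelian C]

theorem IsFilteredBy.of_iso {Q : ObjectProperty C} {M N : C} (h : IsFilteredBy Q M) (e : M ≅ N) :
    IsFilteredBy Q N := by
  cases h with
  | zero h => exact .zero (h.of_iso e.symm)
  | @step S hS h₁ h₃ =>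
    let S' : ShortComplex C := ShortComplex.mk (S.f ≫ e.hom) (e.inv ≫ S.g) (by simp)
    have : S ≅ S' := ShortComplex.isoMk (Iso.refl _) e (Iso.refl _) (by simp [S']) (by simp [S'])
    exact IsFilteredBy.step (S := S') (ShortComplex.shortExact_of_iso this hS) h₁ h₃

theorem IsFilteredBy.of_prop {Q : ObjectProperty C} {M : C} (h : Q M) : IsFilteredBy Q M := by
  obtain ⟨Z, hZ⟩ := HasZeroObject.zero (C := C)
  let S : ShortComplex C := ShortComplex.mk (0 : Z ⟶ M) (𝟙 M) (by simp)
  have hS : S.ShortExact :=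
    { exact := (S.exact_iff_mono rfl).2 (inferInstanceAs (Mono (𝟙 M)))
      mono_f := ⟨fun _ _ _ => hZ.eq_of_tgt _ _⟩
      epi_g := inferInstanceAs (Epi (𝟙 M)) }
  exact IsFilteredBy.step (S := S) hS (.zero hZ) h

theorem IsFilteredBy.mono {Q Q' : ObjectProperty C} {M : C} (h : IsFilteredBy Q M) (hQ : Q ≤ Q') :
    IsFilteredBy Q' M := by
  induction h with
  | zero h => exact .zero h
  | step hS _ h₃ ih => exact .step hS ih (hQ _ h₃)

end filtration

namespace GrMod

variable {K : Type u} [Field K] {A : Type v} [Ring A] [Algebra K A] {X : Type w}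
  [AddCommGroup X] [DecidableEq X] {𝒜 : X → Submodule K A} [FiniteDimensional K A]

/-- Filtrations of the target and of the kernel are spliced by induction on the former: the preimage
of the first term `S.X₁` surjects onto it with the same kernel as `p`, and the remaining quotient is
`S.X₃`. -/
theorem isFilteredBy_of_surjective {Q : ObjectProperty (GrMod 𝒜)} {N : GrMod 𝒜}
    (hN : IsFilteredBy Q N) : ∀ {M : GrMod 𝒜} (p : M ⟶ N), Function.Surjective p.toLin →
      IsFilteredBy Q (M.sub _ (isHomogeneous_ker p)) → IsFilteredBy Q M := by
  induction hN with
  | @zero N h =>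
    intro M p hp hk
    refine hk.of_iso (isoOfBijective (M.subι _ _) ⟨Submodule.subtype_injective _, fun m => ?_⟩)
    exact ⟨⟨m, isZero_iff.1 h _⟩, rfl⟩
  | @step S hS h₁ h₃ ih =>
    intro M p hp hk
    have := hS.mono_f
    have := hS.epi_g
    let q : M ⟶ S.X₃ := p ≫ S.g
    let H := M.sub _ (isHomogeneous_ker q)
    obtain ⟨r, hr⟩ : ∃ r : H ⟶ S.X₁, r ≫ S.f = M.subι _ (isHomogeneous_ker q) ≫ p :=
      exists_lift S.f _ fun m => exists_of_shortExact hS m.2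
    have hr' : ∀ m : H.carrier, S.f.toLin (r.toLin m) = p.toLin (Subtype.val m) := congr_toLin hr
    have hrsurj : Function.Surjective r.toLin := by
      intro x
      obtain ⟨m, hm⟩ := hp (S.f.toLin x)
      have hmH : q.toLin m = 0 := by
        change S.g.toLin (p.toLin m) = 0
        rw [hm]
        exact congr_toLin S.zero x
      exact ⟨⟨m, hmH⟩, injective_of_mono S.f ((hr' _).trans hm)⟩
    have hH : IsFilteredBy Q H := by
      refine ih r hrsurj (hk.of_iso ?_)
      refine isoOfBijective (M := M.sub _ (isHomogeneous_ker p))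
        ⟨((Submodule.inclusion (p := LinearMap.ker p.toLin) (p' := LinearMap.ker q.toLin)
          fun m hm => ?_).codRestrict _ fun m => ?_), fun x m hm => hm⟩ ⟨?_, ?_⟩
      · change S.g.toLin (p.toLin m) = 0
        rw [LinearMap.mem_ker.1 hm, map_zero]
      · exact injective_of_mono S.f ((hr' _).trans (m.2.trans (map_zero _).symm))
      · intro m m' h
        exact Subtype.ext (congrArg (fun z => Subtype.val (Subtype.val z)) h)
      · rintro ⟨⟨m, hm⟩, hm'⟩
        refine ⟨⟨m, ?_⟩, rfl⟩
        have h0 : r.toLin ⟨m, hm⟩ = 0 := hm'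
        exact (hr' ⟨m, hm⟩).symm.trans (by rw [h0, map_zero])
    refine IsFilteredBy.step (S := ShortComplex.mk (M.subι _ (isHomogeneous_ker q)) q
      (by ext m; exact m.2)) ?_ hH h₃
    exact shortExact_of (Submodule.subtype_injective _)
      ((surjective_of_epi S.g).comp hp) (fun m hm => ⟨⟨m, hm⟩, rfl⟩)

end GrMod

/-! ### Projective finitely generated modules -/

namespace FGModuleCat

variable {R : Type v} [Ring R] [IsNoetherianRing R]

theorem projective_of_module_projective (V : FGModuleCat.{v} R) [Module.Projective R V.obj] :
    Projective V where
  factors {E X} f e he := by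
    obtain ⟨h, hh⟩ := Module.projective_lifting_property e.hom.hom f.hom.hom ((epi_iff e).1 he)
    exact ⟨ofHom (W := E.obj) h, FGModuleCat.hom_ext hh⟩

theorem exists_epi_of_projective (V : FGModuleCat.{v} R) :
    ∃ (P : FGModuleCat.{v} R) (p : P ⟶ V), Projective P ∧ Module.Projective R P.obj ∧ Epi p := by
  obtain ⟨n, f, hf⟩ := Module.Finite.exists_fin' R V.obj
  have : Module.Projective R (of R (Fin n → R)).obj := inferInstanceAs (Module.Projective R (Fin n → R))
  exact ⟨of R (Fin n → R), ofHom (W := V.obj) f, projective_of_module_projective _, this,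
    (epi_iff _).2 hf⟩

theorem module_projective_of_projective (V : FGModuleCat.{v} R) [Projective V] :
    Module.Projective R V.obj := by
  obtain ⟨P, p, _, hP, hp⟩ := exists_epi_of_projective V
  refine Module.Projective.of_split (Projective.factorThru (𝟙 V) p).hom.hom p.hom.hom ?_
  have := congrArg (fun f => f.hom.hom) (Projective.factorThru_comp (𝟙 V) p)
  exact this

end FGModuleCat

namespace GrMod

variable {K : Type u} [Field K] {A : Type v} [Ring A] [Algebra K A] {X : Type w}
  [AddCommGroup X] [DecidableEq X] {𝒜 : X → Submodule K A} [FiniteDimensional K A]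

theorem isIso_of_epi_of_finrank {M N : GrMod 𝒜} (f : M ⟶ N) [Epi f]
    (h : Module.finrank K M.carrier = Module.finrank K N.carrier) : IsIso f :=
  isIso_of_bijective f ⟨(LinearMap.injective_iff_surjective_of_finrank_eq_finrank
    (f := Hom.toLinK f) h).2 (surjective_of_epi f), surjective_of_epi f⟩

end GrMod

namespace TriangularDecomposition

variable {K : Type u} [Field K] {A : Type v} [Ring A] [Algebra K A]
  {X : Type w} [AddCommGroup X] [DecidableEq X] {ι : Type*} {I : Module.Basis ι ℤ X}
  {𝒜 : X → Submodule K A} [GradedAlgebra 𝒜] (𝒯 : TriangularDecomposition I 𝒜)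
  [FiniteDimensional K A]

/-! ### Projective objects -/

/-- Morphisms out of `A ⊗ V` are `K`-linear maps from `V` to the component of degree `d`, and these
lift along surjections. -/
instance projective_inducedMod (V : Type v) [AddCommGroup V] [Module K V] [FiniteDimensional K V]
    (d : X) : Projective (inducedMod (𝒜 := 𝒜) V d) where
  factors {E M} f e he := by
    let r : E.comp d →ₗ[K] M.comp d := e.toLinK.restrict fun m hm => e.map_mem d m hm
    have hr : Function.Surjective r := by
      rintro ⟨m, hm⟩
      obtain ⟨n, hn, h⟩ := GrMod.exists_preimage_mem e (GrMod.surjective_of_epi e) hm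
      exact ⟨⟨n, hn⟩, Subtype.ext h⟩
    let g : V →ₗ[K] M.comp d := LinearMap.codRestrict (M.comp d) (f.toLinK ∘ₗ indMk V d)
      fun v => f.map_mem d _ (indMk_mem V d v)
    obtain ⟨h, hh⟩ := Module.projective_lifting_property r g hr
    refine ⟨indDesc ((E.comp d).subtype ∘ₗ h) fun v => (h v).2, inducedMod_hom_ext fun v => ?_⟩
    exact (congrArg e.toLin (indDesc_indMk _ _ v)).trans
      (congrArg Subtype.val (LinearMap.congr_fun hh v))

/-- The summand `A ⊗ M_x` hits the whole component of degree `x`; one such summand is added for each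
degree in `s`. -/
theorem exists_projective_range (M : GrMod 𝒜) (s : Finset X) :
    ∃ (P : GrMod 𝒜) (p : P ⟶ M), Projective P ∧ ∀ x ∈ s, ∀ m ∈ M.comp x, ∃ z, p.toLin z = m := by
  classical
  induction s using Finset.induction_on with
  | empty => exact ⟨inducedMod PUnit 0, 0, inferInstance, by simp⟩
  | insert x s _ ih =>
    obtain ⟨P, p, hP, h⟩ := ih
    have : FiniteDimensional K (M.comp x) := FiniteDimensional.finiteDimensional_submodule _
    let q : inducedMod (𝒜 := 𝒜) (M.comp x) x ⟶ M := indDesc (M.comp x).subtype fun v => v.2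
    refine ⟨P ⊞ inducedMod (M.comp x) x, biprod.desc p q, inferInstance, fun y hy m hm => ?_⟩
    rcases Finset.mem_insert.1 hy with rfl | hy
    · refine ⟨(biprod.inr : _ ⟶ P ⊞ inducedMod (M.comp y) y).toLin (indMk (M.comp y) y ⟨m, hm⟩), ?_⟩
      refine (GrMod.congr_toLin (biprod.inr_desc p q) _).trans ?_
      exact indDesc_indMk _ _ _
    · obtain ⟨z, hz⟩ := h y hy m hm
      exact ⟨(biprod.inl : _ ⟶ P ⊞ inducedMod (M.comp x) x).toLin z,
        (GrMod.congr_toLin (biprod.inl_desc p q) _).trans hz⟩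

theorem enoughProjectives : EnoughProjectives (GrMod 𝒜) where
  presentation M := by
    obtain ⟨P, p, hP, h⟩ := exists_projective_range M M.finite_support.toFinset
    have hp : Epi p := by
      refine GrMod.epi_of_surjective p fun m => ?_
      refine grading_induction M.isInternal (p := fun m => ∃ z, p.toLin z = m) ⟨0, map_zero _⟩ ?_ ?_ m
      · rintro _ _ ⟨a, rfl⟩ ⟨b, rfl⟩
        exact ⟨a + b, map_add _ _ _⟩
      · intro x m hm
        by_cases h0 : m = 0
        · exact ⟨0, by rw [map_zero, h0]⟩
        · exact h x (M.finite_support.mem_toFinset.2 (GrMod.comp_ne_bot_of_mem hm h0)) m hm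
    exact ⟨⟨P, p⟩⟩

/-! ### Projective covers -/

/-- The dimension of a finitely generated `T`-module. -/
noncomputable def dimT (V : FGModuleCat.{v} 𝒯.T) : ℕ :=
  letI := 𝒯.restrictModule V.obj
  Module.finrank K V.obj

omit [FiniteDimensional K A] in
-- In a scalar tower the action of `K` is forced to be the one through `T`.
theorem dimT_of (V : Type v) [AddCommGroup V] [Module K V] [Module 𝒯.T V] [IsScalarTower K 𝒯.T V]
    [Module.Finite 𝒯.T V] : 𝒯.dimT (FGModuleCat.of 𝒯.T V) = Module.finrank K V := by
  have h : 𝒯.restrictModule V = ‹Module K V› := by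
    apply Module.ext
    funext k v
    exact (algebraMap_smul 𝒯.T k v)
  unfold dimT
  rw [← h]

variable {𝒯} in
/-- A `T`-linear map as a `K`-linear map. -/
def homK {V W : FGModuleCat.{v} 𝒯.T} (f : V ⟶ W) :
    letI := 𝒯.restrictModule V.obj
    letI := 𝒯.restrictModule W.obj
    V.obj →ₗ[K] W.obj :=
  letI := 𝒯.restrictModule V.obj
  letI := 𝒯.restrictModule W.obj
  { toFun := f.hom.hom
    map_add' := map_add _
    map_smul' := fun k v => map_smul f.hom.hom (algebraMap K 𝒯.T k) v }

theorem dimT_le_of_mono {V W : FGModuleCat.{v} 𝒯.T} (f : V ⟶ W) [Mono f] : 𝒯.dimT V ≤ 𝒯.dimT W := by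
  let := 𝒯.restrictModule V.obj
  let := 𝒯.restrictModule W.obj
  have := 𝒯.restrictModule_finite W.obj
  exact LinearMap.finrank_le_finrank_of_injective (f := homK f) ((FGModuleCat.mono_iff f).1 ‹_›)

theorem isIso_of_mono_of_dimT {V W : FGModuleCat.{v} 𝒯.T} (f : V ⟶ W) [Mono f]
    (h : 𝒯.dimT V = 𝒯.dimT W) : IsIso f := by
  let := 𝒯.restrictModule V.obj
  let := 𝒯.restrictModule W.obj
  have := 𝒯.restrictModule_finite W.obj
  have := 𝒯.restrictModule_finite V.obj
  have h1 : Function.Injective (homK f) := (FGModuleCat.mono_iff f).1 ‹_›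
  exact FGModuleCat.isIso_of_bijective f
    ⟨h1, (LinearMap.injective_iff_surjective_of_finrank_eq_finrank h).1 h1⟩

theorem isIso_of_epi_of_dimT {V W : FGModuleCat.{v} 𝒯.T} (f : V ⟶ W) [Epi f]
    (h : 𝒯.dimT V = 𝒯.dimT W) : IsIso f := by
  let := 𝒯.restrictModule V.obj
  let := 𝒯.restrictModule W.obj
  have := 𝒯.restrictModule_finite W.obj
  have := 𝒯.restrictModule_finite V.obj
  have h1 : Function.Surjective (homK f) := (FGModuleCat.epi_iff f).1 ‹_›
  exact FGModuleCat.isIso_of_bijective f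
    ⟨(LinearMap.injective_iff_surjective_of_finrank_eq_finrank h).2 h1, h1⟩

theorem exists_cover_T (V : FGModuleCat.{v} 𝒯.T) :
    ∃ (P : FGModuleCat.{v} 𝒯.T) (p : P ⟶ V), IsProjectiveCover p := by
  obtain ⟨P, p, hP, _, hp⟩ := FGModuleCat.exists_epi_of_projective V
  exact exists_isProjectiveCover 𝒯.dimT (𝒯.dimT_le_of_mono ·) (𝒯.isIso_of_mono_of_dimT ·)
    (𝒯.isIso_of_epi_of_dimT ·) p

/-- The simple `T`-module of a label. -/
noncomputable def simpleT (l : 𝒯.Label) : FGModuleCat.{v} 𝒯.T := FGModuleCat.of 𝒯.T l.type.rep.carrier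

/-- The projective cover of the simple `T`-module of a label. -/
noncomputable def projT (l : 𝒯.Label) : FGModuleCat.{v} 𝒯.T := (𝒯.exists_cover_T (𝒯.simpleT l)).choose

/-- The covering map of the simple `T`-module of a label. -/
noncomputable def coverT (l : 𝒯.Label) : 𝒯.projT l ⟶ 𝒯.simpleT l :=
  (𝒯.exists_cover_T (𝒯.simpleT l)).choose_spec.choose

theorem isProjectiveCover_coverT (l : 𝒯.Label) : IsProjectiveCover (𝒯.coverT l) :=
  (𝒯.exists_cover_T (𝒯.simpleT l)).choose_spec.choose_spec

/-- The simple module `L(λ, w)` has a projective cover. -/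
theorem exists_cover (l : 𝒯.Label) :
    ∃ (P : GrMod 𝒜) (p : P ⟶ 𝒯.simple l), IsProjectiveCover p := by
  have := enoughProjectives (𝒜 := 𝒜)
  exact exists_isProjectiveCover (fun M : GrMod 𝒜 => Module.finrank K M.carrier)
    (GrMod.finrank_le_of_mono ·) (GrMod.isIso_of_mono_of_finrank ·)
    (GrMod.isIso_of_epi_of_finrank ·) (Projective.π (𝒯.simple l))

/-- The indecomposable projective module `P(λ, w)`. -/
noncomputable def proj (l : 𝒯.Label) : GrMod 𝒜 := (𝒯.exists_cover l).choose

/-- The projective cover of `L(λ, w)`. -/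
noncomputable def cover (l : 𝒯.Label) : 𝒯.proj l ⟶ 𝒯.simple l := (𝒯.exists_cover l).choose_spec.choose

theorem isProjectiveCover_cover (l : 𝒯.Label) : IsProjectiveCover (𝒯.cover l) :=
  (𝒯.exists_cover l).choose_spec.choose_spec

/-- The projective module `A ⊗ λ` maps onto `L(λ, w)`. Its lift to the projective cover is an
epimorphism by essentiality, and it splits. Properties of induced modules are thereby passed on to
`P(λ, w)`. -/
theorem proj_retract (l : 𝒯.Label) :
    have := 𝒯.finite_simple l.type.rep
    ∃ (s : 𝒯.proj l ⟶ inducedMod l.type.rep.carrier l.weight)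
      (q : inducedMod l.type.rep.carrier l.weight ⟶ 𝒯.proj l), s ≫ q = 𝟙 _ := by
  have := 𝒯.finite_simple l.type.rep
  have hc := 𝒯.isProjectiveCover_cover l
  have := hc.epi
  have := hc.projective
  let p : inducedMod (𝒜 := 𝒜) l.type.rep.carrier l.weight ⟶ 𝒯.simple l :=
    𝒯.indToStd l.type.rep.carrier l.weight ≫ 𝒯.headπ l.type.rep.carrier l.weight
  have hp : Epi p := GrMod.epi_of_surjective p
    ((𝒯.headπ_surjective _ _).comp (𝒯.indToStd_surjective _ _))
  let q := Projective.factorThru p (𝒯.cover l)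
  have hq : q ≫ 𝒯.cover l = p := Projective.factorThru_comp _ _
  have : Epi q := hc.essential q (by rw [hq]; exact hp)
  exact ⟨Projective.factorThru (𝟙 _) q, q, Projective.factorThru_comp _ _⟩

end TriangularDecomposition

/-! ### Heights -/

/-- The height on the root lattice: the sum of the coordinates. -/
noncomputable def height {X : Type w} [AddCommGroup X] {ι : Type*} (I : Module.Basis ι ℤ X) :
    X →ₗ[ℤ] ℤ :=
  I.constr ℤ fun _ => (1 : ℤ)

theorem height_pos {X : Type w} [AddCommGroup X] {ι : Type*} (I : Module.Basis ι ℤ X) {x : X}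
    (hx : x ∈ natCone I) (hx0 : x ≠ 0) : 1 ≤ height I x := by
  have h : x = 0 ∨ 1 ≤ height I x := by
    clear hx0
    induction hx using AddSubmonoid.closure_induction with
    | mem x hx =>
      obtain ⟨i, rfl⟩ := hx
      right
      rw [height, Module.Basis.constr_basis]
    | zero => exact Or.inl rfl
    | add x y _ _ hx hy =>
      rcases hx with rfl | hx
      · rwa [zero_add]
      · rcases hy with rfl | hy
        · rw [add_zero]
          exact Or.inr hx
        · right
          rw [map_add]
          linarith
  exact h.resolve_left hx0

namespace TriangularDecomposition

variable {K : Type u} [Field K] {A : Type v} [Ring A] [Algebra K A]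
  {X : Type w} [AddCommGroup X] [DecidableEq X] {ι : Type*} {I : Module.Basis ι ℤ X}
  {𝒜 : X → Submodule K A} [GradedAlgebra 𝒜] (𝒯 : TriangularDecomposition I 𝒜)

/-! ### The radical over `A⁻` -/

/-- Induction on `T A⁻_x ⊆ A⁻_x T`. -/
theorem T_mul_neg_induction {p : A → Prop} {x : X}
    (hmul : ∀ n ∈ 𝒯.neg, n ∈ 𝒜 x → ∀ t ∈ 𝒯.T, p (n * t)) (hadd : ∀ a b, p a → p b → p (a + b))
    {t n : A} (ht : t ∈ 𝒯.T) (hn : n ∈ 𝒯.neg) (hnx : n ∈ 𝒜 x) : p (t * n) := by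
  have h1 : t * n ∈ Subalgebra.toSubmodule 𝒯.neg * Subalgebra.toSubmodule 𝒯.T := by
    rw [𝒯.neg_mul_T]
    exact Submodule.mul_mem_mul ht hn
  -- Because `T` sits in degree zero, taking the component of degree `x` of an element of `A⁻ T`
  -- only replaces each left factor by its component of degree `x`.
  have h2 : ∀ b ∈ Subalgebra.toSubmodule 𝒯.neg * Subalgebra.toSubmodule 𝒯.T,
      p (DirectSum.decompose 𝒜 b x) := by
    intro b hb
    refine Submodule.mul_induction_on hb (fun n hn t ht => ?_) fun a b ha hb => ?_
    · rw [DirectSum.coe_decompose_mul_of_right_mem_zero 𝒜 (𝒯.T_degree_zero t ht)]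
      exact hmul _ (𝒯.neg_graded n hn x) (SetLike.coe_mem _) t ht
    · rw [DirectSum.decompose_add, DirectSum.add_apply, Submodule.coe_add]
      exact hadd _ _ ha hb
  have h3 := h2 _ h1
  rwa [𝒯.decompose_T_mul ht, DirectSum.decompose_of_mem_same 𝒜 hnx] at h3

/-- The subspace `A⁻_{<0} M` of a graded module `M`. -/
def negRad (M : GrMod 𝒜) : Submodule 𝒯.T M.carrier where
  __ := AddSubmonoid.closure {m | ∃ x ≠ 0, ∃ b ∈ 𝒯.neg, b ∈ 𝒜 x ∧ ∃ m', m = b • m'}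
  smul_mem' t m hm := by
    change m ∈ AddSubmonoid.closure _ at hm
    change t • m ∈ AddSubmonoid.closure _
    induction hm using AddSubmonoid.closure_induction with
    | mem m hm =>
      obtain ⟨x, hx, b, hb, hbx, m, rfl⟩ := hm
      change (t : A) • b • m ∈ _
      rw [smul_smul]
      refine 𝒯.T_mul_neg_induction (p := fun a => a • m ∈ AddSubmonoid.closure
        {m | ∃ x ≠ 0, ∃ b ∈ 𝒯.neg, b ∈ 𝒜 x ∧ ∃ m', m = b • m'})
        (fun n hn hnx t _ => AddSubmonoid.subset_closure ⟨x, hx, n, hn, hnx, t • m, mul_smul _ _ _⟩)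
        (fun a b ha hb => ?_) t.2 hb hbx
      rw [add_smul]
      exact AddSubmonoid.add_mem _ ha hb
    | zero =>
      rw [smul_zero]
      exact AddSubmonoid.zero_mem _
    | add m m' _ _ h h' =>
      rw [smul_add]
      exact AddSubmonoid.add_mem _ h h'

variable {𝒯} in
theorem smul_mem_negRad {M : GrMod 𝒜} {x : X} (hx : x ≠ 0) {b : A} (hb : b ∈ 𝒯.neg)
    (hbx : b ∈ 𝒜 x) (m : M.carrier) : b • m ∈ 𝒯.negRad M :=
  AddSubmonoid.subset_closure (s := {m | ∃ x ≠ 0, ∃ b ∈ 𝒯.neg, b ∈ 𝒜 x ∧ ∃ m', m = b • m'})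
    ⟨x, hx, b, hb, hbx, m, rfl⟩

variable {𝒯} in
theorem negRad_induction {M : GrMod 𝒜} {p : M.carrier → Prop}
    (hsmul : ∀ x ≠ 0, ∀ b ∈ 𝒯.neg, b ∈ 𝒜 x → ∀ m, p (b • m)) (hzero : p 0)
    (hadd : ∀ m m', p m → p m' → p (m + m')) {m : M.carrier} (hm : m ∈ 𝒯.negRad M) : p m := by
  change m ∈ AddSubmonoid.closure _ at hm
  induction hm using AddSubmonoid.closure_induction with
  | mem m hm =>
    obtain ⟨x, hx, b, hb, hbx, m, rfl⟩ := hm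
    exact hsmul x hx b hb hbx m
  | zero => exact hzero
  | add m m' _ _ h h' => exact hadd m m' h h'

/-- The quotient `M / A⁻_{<0} M`. -/
abbrev negTop (M : GrMod 𝒜) := M.carrier ⧸ 𝒯.negRad M

/-- An `A`-linear map as a `T`-linear map. -/
def homT {M N : GrMod 𝒜} (f : M ⟶ N) : M.carrier →ₗ[𝒯.T] N.carrier where
  toFun := f.toLin
  map_add' := map_add _
  map_smul' t m := map_smul f.toLin (t : A) m

theorem negRad_le_comap {M N : GrMod 𝒜} (f : M ⟶ N) :
    𝒯.negRad M ≤ (𝒯.negRad N).comap (𝒯.homT f) := by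
  intro m hm
  refine negRad_induction (p := fun m => f.toLin m ∈ 𝒯.negRad N) (fun x hx b hb hbx m => ?_) ?_
    (fun m m' h h' => ?_) hm
  · rw [map_smul]
    exact smul_mem_negRad hx hb hbx _
  · rw [map_zero]
    exact Submodule.zero_mem _
  · rw [map_add]
    exact Submodule.add_mem _ h h'

/-- Functoriality of `M / A⁻_{<0} M`. -/
def negTopMap {M N : GrMod 𝒜} (f : M ⟶ N) : 𝒯.negTop M →ₗ[𝒯.T] 𝒯.negTop N :=
  (𝒯.negRad M).mapQ (𝒯.negRad N) (𝒯.homT f) (𝒯.negRad_le_comap f)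

variable [FiniteDimensional K A]

/-- Finite dimensionality leaves only finitely many degrees. The bound makes the induction in
Nakayama's lemma terminate. -/
theorem exists_height_lt (I : Module.Basis ι ℤ X) (𝒜 : X → Submodule K A) [GradedAlgebra 𝒜] :
    ∃ N : ℕ, ∀ x, 𝒜 x ≠ ⊥ → height I (-x) < N := by
  have hfin : {x | 𝒜 x ≠ ⊥}.Finite := WellFoundedGT.finite_ne_bot_of_iSupIndep
    (DirectSum.Decomposition.isInternal 𝒜).submodule_iSupIndep
  obtain ⟨b, hb⟩ := (hfin.image fun x => height I (-x)).bddAbove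
  refine ⟨(b + 1).toNat, fun x hx => ?_⟩
  have h1 := hb ⟨x, hx, rfl⟩
  have h2 := Int.self_le_toNat (b + 1)
  simp only at h1
  omega

variable {𝒯} in
/-- Nakayama's lemma for `A⁻`. -/
theorem eq_top_of_negRad {M : GrMod 𝒜} (Y : Submodule K M.carrier)
    (hY : ∀ a ∈ 𝒯.neg, ∀ y ∈ Y, a • y ∈ Y) (hM : ∀ m, ∃ y ∈ Y, m - y ∈ 𝒯.negRad M) : Y = ⊤ := by
  obtain ⟨N, hN⟩ := exists_height_lt I 𝒜
  -- Descending induction on depth: elements of `A⁻_x` with `height (-x) ≥ N - k` send `M` into `Y`.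
  -- For `k = 0` there are no nonzero ones, and `k = N` covers `a = 1`.
  have key : ∀ (k : ℕ) (x : X), ∀ a ∈ 𝒯.neg, a ∈ 𝒜 x → (N : ℤ) ≤ height I (-x) + k →
      ∀ m : M.carrier, a • m ∈ Y := by
    intro k
    induction k with
    | zero =>
      intro x a _ hax hx m
      have h : 𝒜 x = ⊥ := by
        by_contra h
        have := hN x h
        simp only [Nat.cast_zero] at hx
        omega
      rw [h, Submodule.mem_bot] at hax
      rw [hax, zero_smul]
      exact Y.zero_mem
    | succ k ih =>
      intro x a ha hax hx m
      -- Writing `m = y + r` with `r ∈ A⁻_{<0} M`, the term `a y` stays in `Y`, while `a r` is a sum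
      -- of terms `(a b) m'` with `a b` strictly deeper.
      obtain ⟨y, hy, hr⟩ := hM m
      have h : ∀ r ∈ 𝒯.negRad M, a • r ∈ Y := by
        intro r hr
        refine negRad_induction (p := fun r => a • r ∈ Y) (fun z hz b hb hbz m => ?_) ?_ ?_ hr
        · rw [smul_smul]
          by_cases hb0 : b = 0
          · rw [hb0, mul_zero, zero_smul]
            exact Y.zero_mem
          refine ih (x + z) _ (𝒯.neg.mul_mem ha hb) (SetLike.mul_mem_graded hax hbz) ?_ m
          have := height_pos I (𝒯.neg_supp z b hb hbz hb0) (neg_ne_zero.2 hz)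
          rw [neg_add, map_add]
          push_cast at hx
          linarith
        · rw [smul_zero]
          exact Y.zero_mem
        · intro m m' h h'
          rw [smul_add]
          exact Y.add_mem h h'
      have := Y.add_mem (h _ hr) (hY a ha y hy)
      rwa [← smul_add, sub_add_cancel] at this
  rw [eq_top_iff]
  intro m _
  have := key N 0 1 𝒯.neg.one_mem SetLike.GradedOne.one_mem (by simp) m
  rwa [one_smul] at this

/-- A module is spanned over `A⁻` by representatives of `M / A⁻_{<0} M`. -/
theorem finrank_le_negTop (M : GrMod 𝒜) :
    Module.finrank K M.carrier ≤ Module.finrank K 𝒯.neg * Module.finrank K (𝒯.negTop M) := by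
  -- A `K`-linear section suffices: by Nakayama's lemma its image generates `M` over `A⁻`.
  obtain ⟨σ, hσ⟩ := ((𝒯.negRad M).mkQ.restrictScalars K).exists_rightInverse_of_surjective
    (LinearMap.range_eq_top.2 (𝒯.negRad M).mkQ_surjective)
  let g : 𝒯.neg ⊗[K] 𝒯.negTop M →ₗ[K] M.carrier :=
    TensorProduct.lift (LinearMap.mk₂ K (fun (n : 𝒯.neg) q => (n : A) • σ q)
      (fun _ _ _ => add_smul _ _ _) (fun k n v => smul_assoc k (n : A) _)
      (fun n v v' => by rw [map_add, smul_add]) (fun k n v => by rw [map_smul, smul_comm]))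
  have hg : LinearMap.range g = ⊤ := by
    refine eq_top_of_negRad (𝒯 := 𝒯) _ ?_ fun m => ?_
    · rintro a ha _ ⟨z, rfl⟩
      induction z with
      | zero => rw [map_zero, smul_zero]; exact Submodule.zero_mem _
      | add x y hx hy => rw [map_add, smul_add]; exact Submodule.add_mem _ hx hy
      | tmul n q => exact ⟨(⟨a, ha⟩ * n) ⊗ₜ q, mul_smul a (n : A) (σ q)⟩
    · refine ⟨_, ⟨1 ⊗ₜ Submodule.Quotient.mk m, rfl⟩, ?_⟩
      have h1 : g (1 ⊗ₜ Submodule.Quotient.mk m) = σ (Submodule.Quotient.mk m) := one_smul A _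
      rw [h1]
      exact (Submodule.Quotient.eq _).1 (LinearMap.congr_fun hσ (Submodule.Quotient.mk m)).symm
  rw [← Module.finrank_tensorProduct]
  exact LinearMap.finrank_le_finrank_of_surjective (LinearMap.range_eq_top.1 hg)

end TriangularDecomposition

/-! ### Projectivity over `A⁻ T` through dimension counts -/

namespace TriangularDecomposition

variable {K : Type u} [Field K] {A : Type v} [Ring A] [Algebra K A]
  {X : Type w} [AddCommGroup X] [DecidableEq X] {ι : Type*} {I : Module.Basis ι ℤ X}
  {𝒜 : X → Submodule K A} [GradedAlgebra 𝒜] (𝒯 : TriangularDecomposition I 𝒜)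

variable {𝒯} in
-- The degree-zero part of `n` is a scalar and its other components send `M` into `A⁻_{<0} M`. The
-- scalar is the same for every module.
theorem exists_neg_smul_sub_mem {n : A} (hn : n ∈ 𝒯.neg) :
    ∃ k : K, ∀ {M : GrMod 𝒜} (m : M.carrier), n • m - k • m ∈ 𝒯.negRad M := by
  classical
  obtain ⟨k, hk⟩ := 𝒯.exists_decompose_neg_zero hn
  refine ⟨k, fun {M} m => ?_⟩
  have h : ∀ s : Finset X, ∑ x ∈ s.erase 0, (DirectSum.decompose 𝒜 n x : A) • m ∈ 𝒯.negRad M :=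
    fun s => Submodule.sum_mem _ fun x hx => smul_mem_negRad (Finset.ne_of_mem_erase hx)
      (𝒯.neg_graded n hn x) (SetLike.coe_mem _) m
  have h1 : n • m - k • m =
      ∑ x ∈ ((DirectSum.decompose 𝒜 n).support).erase 0, (DirectSum.decompose 𝒜 n x : A) • m := by
    rw [← algebraMap_smul A k m, hk, sub_eq_iff_eq_add]
    conv_lhs => rw [← DirectSum.sum_support_decompose 𝒜 n, Finset.sum_smul]
    by_cases h0 : (0 : X) ∈ (DirectSum.decompose 𝒜 n).support
    · rw [Finset.sum_erase_add _ _ h0]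
    · have h2 : (DirectSum.decompose 𝒜 n 0 : A) = 0 := by
        rw [DFinsupp.notMem_support_iff.1 h0]; rfl
      rw [Finset.erase_eq_of_notMem h0, h2, zero_smul, add_zero]
  rw [h1]
  exact h _

/-- The projection onto a weight space. -/
noncomputable def weightProj (M : GrMod 𝒜) (ξ : X) : M.carrier →ₗ[𝒯.T] 𝒯.weightSpace M ξ where
  toFun m := ⟨M.proj ξ m, M.proj_mem ξ m⟩
  map_add' m m' := Subtype.ext (map_add _ _ _)
  map_smul' t m := Subtype.ext <| by
    have := M.proj_smul (𝒯.T_degree_zero t t.2) ξ m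
    rw [sub_zero] at this
    exact this

/-- The degree-`ξ` part of `b m'`, for `b` of degree `x ≠ 0`, comes from degree `ξ - x`, which is
above `ξ` if `b ≠ 0`. Hence the projection to a maximal component factors through `M / A⁻_{<0} M`.
-/
theorem proj_eq_zero_of_mem_negRad {M : GrMod 𝒜} {ξ : X}
    (hM : ∀ x ∈ natCone I, x ≠ 0 → M.comp (x + ξ) = ⊥) {m : M.carrier} (hm : m ∈ 𝒯.negRad M) :
    M.proj ξ m = 0 := by
  refine negRad_induction (p := fun m => M.proj ξ m = 0) (fun x hx b hb hbx m => ?_) (map_zero _)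
    (fun m m' h h' => by rw [map_add, h, h', add_zero]) hm
  rw [M.proj_smul hbx]
  by_cases hb0 : b = 0
  · rw [hb0, zero_smul]
  · have h := hM (-x) (𝒯.neg_supp x b hb hbx hb0) (neg_ne_zero.2 hx)
    have h2 := M.proj_mem (ξ - x) m
    rw [show ξ - x = -x + ξ by abel, h, Submodule.mem_bot] at h2
    rw [show ξ - x = -x + ξ by abel, h2, smul_zero]

variable [FiniteDimensional K A]

instance (M : GrMod 𝒜) (ξ : X) : FiniteDimensional K (𝒯.weightSpace M ξ) :=
  FiniteDimensional.finiteDimensional_submodule (M.comp ξ)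

/-- Graded modules that are projective over `A⁻ T`, in terms of `M / A⁻_{<0} M`. -/
structure IsNegProjective (M : GrMod 𝒜) : Prop where
  projective : Module.Projective 𝒯.T (𝒯.negTop M)
  finrank_eq : Module.finrank K M.carrier =
    Module.finrank K 𝒯.neg * Module.finrank K (𝒯.negTop M)

theorem finrank_neg_pos [Nontrivial A] : 0 < Module.finrank K 𝒯.neg := Module.finrank_pos

theorem finrank_negTop_add_le {M N N' : GrMod 𝒜} (f : M ⟶ N) (f' : M ⟶ N')
    (h : ∀ n n', ∃ m, f.toLin m = n ∧ f'.toLin m = n') :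
    Module.finrank K (𝒯.negTop N) + Module.finrank K (𝒯.negTop N') ≤
      Module.finrank K (𝒯.negTop M) := by
  rw [← Module.finrank_prod]
  refine LinearMap.finrank_le_finrank_of_surjective
    (f := ((𝒯.negTopMap f).prod (𝒯.negTopMap f')).restrictScalars K) ?_
  rintro ⟨n, n'⟩
  obtain ⟨n, rfl⟩ := Submodule.mkQ_surjective _ n
  obtain ⟨n', rfl⟩ := Submodule.mkQ_surjective _ n'
  obtain ⟨m, rfl, rfl⟩ := h n n'
  exact ⟨Submodule.Quotient.mk m, rfl⟩

variable {𝒯} in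
-- Let `M'` be the complement of `M` in `P`. Then `dim P = dim M + dim M'` is at most `dim A⁻` times
-- the sum of the dimensions of the two tops, hence at most `dim A⁻` times that of the top of `P`,
-- which is `dim P`. Equality must hold for each summand.
theorem IsNegProjective.of_retract [Nontrivial A] {M P : GrMod 𝒜} (hP : 𝒯.IsNegProjective P)
    (s : M ⟶ P) (r : P ⟶ M) (hsr : s ≫ r = 𝟙 M) : 𝒯.IsNegProjective M := by
  have hsr' : ∀ m, r.toLin (s.toLin m) = m := GrMod.congr_toLin hsr
  constructor
  · have := hP.projective
    refine Module.Projective.of_split (𝒯.negTopMap s) (𝒯.negTopMap r) ?_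
    ext m
    exact congrArg Submodule.Quotient.mk (hsr' m)
  · let M' := P.sub _ (GrMod.isHomogeneous_ker r)
    -- The complementary idempotent `1 - s r`, viewed as a projection onto the kernel of `r`.
    obtain ⟨f, hf⟩ : ∃ f : P ⟶ M', f ≫ P.subι _ (GrMod.isHomogeneous_ker r) = 𝟙 P - r ≫ s := by
      refine GrMod.exists_lift _ _ fun m => ⟨⟨m - s.toLin (r.toLin m), ?_⟩, rfl⟩
      rw [LinearMap.mem_ker, map_sub, hsr', sub_self]
    have hf' : ∀ m, Subtype.val (p := (· ∈ LinearMap.ker r.toLin)) (f.toLin m) =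
      m - s.toLin (r.toLin m) := GrMod.congr_toLin hf
    have h1 := 𝒯.finrank_negTop_add_le r f fun n n' => by
      have hn' : r.toLin n'.1 = 0 := n'.2
      have h0 : r.toLin (s.toLin n + n'.1) = n := by rw [map_add, hsr', hn', add_zero]
      refine ⟨s.toLin n + n'.1, h0, Subtype.ext ?_⟩
      rw [hf', h0, add_sub_cancel_left]
    have h2 : Module.finrank K P.carrier = Module.finrank K M'.carrier +
        Module.finrank K M.carrier := GrMod.finrank_of_shortExact
      (S := ShortComplex.mk (P.subι _ (GrMod.isHomogeneous_ker r)) r (by ext m; exact m.2))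
      (GrMod.shortExact_of (Submodule.subtype_injective _) (fun m => ⟨_, hsr' m⟩)
        (fun m hm => ⟨⟨m, hm⟩, rfl⟩))
    have h3 := 𝒯.finrank_le_negTop M
    have h4 := 𝒯.finrank_le_negTop M'
    have h5 := hP.finrank_eq
    have h6 := Nat.mul_le_mul_left (Module.finrank K 𝒯.neg) h1
    rw [mul_add] at h6
    omega

/-- Induced modules are projective over `A⁻ T`. -/
theorem isNegProjective_inducedMod [Nontrivial A] (V : Type v) [AddCommGroup V] [Module K V]
    [FiniteDimensional K V] (d : X) : 𝒯.IsNegProjective (inducedMod V d) := by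
  let M := inducedMod (𝒜 := 𝒜) V d
  let ψ : 𝒯.pos ⊗[K] V →ₗ[K] 𝒯.negTop M := ((𝒯.negRad M).mkQ.restrictScalars K) ∘ₗ
    TensorProduct.lift (LinearMap.mk₂ K (fun (q : 𝒯.pos) v => (q : A) • indMk (𝒜 := 𝒜) V d v)
      (fun _ _ _ => add_smul _ _ _) (fun k n v => smul_assoc k (n : A) _)
      (fun n v v' => by rw [map_add, smul_add]) (fun k n v => by rw [map_smul, smul_comm]))
  -- The expected top of `A ⊗ V ≅ A⁻ ⊗ T ⊗ A⁺ ⊗ V` is `T ⊗ A⁺ ⊗ V`, which is free over `T`.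
  let φ : 𝒯.T ⊗[K] (𝒯.pos ⊗[K] V) →ₗ[𝒯.T] 𝒯.negTop M :=
    TensorProduct.AlgebraTensorModule.lift (LinearMap.toSpanSingleton 𝒯.T _ ψ)
  have hφ : ∀ (t : 𝒯.T) (q : 𝒯.pos) (v : V), φ (t ⊗ₜ (q ⊗ₜ v)) =
      Submodule.Quotient.mk (((t : A) * q) • indMk (𝒜 := 𝒜) V d v) := by
    intro t q v
    rw [mul_smul]
    rfl
  have hB : ∀ b ∈ 𝒯.posBorel, ∀ v, (Submodule.Quotient.mk (b • indMk (𝒜 := 𝒜) V d v) : 𝒯.negTop M) ∈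
      LinearMap.range φ := by
    intro b hb v
    refine 𝒯.posBorel_induction (p := fun b => (Submodule.Quotient.mk (b • indMk (𝒜 := 𝒜) V d v) :
      𝒯.negTop M) ∈ LinearMap.range φ) (fun t ht q hq => ⟨_, hφ ⟨t, ht⟩ ⟨q, hq⟩ v⟩)
      (fun a b ha hb => ?_) hb
    rw [add_smul, Submodule.Quotient.mk_add]
    exact Submodule.add_mem _ ha hb
  have hsurj : Function.Surjective φ := by
    intro z
    obtain ⟨z, rfl⟩ := Submodule.mkQ_surjective _ z
    refine inducedMod_induction (p := fun z => (Submodule.Quotient.mk z : 𝒯.negTop M) ∈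
      LinearMap.range φ) (fun a v => ?_) (fun x y hx hy => ?_) z
    · refine 𝒯.mul_induction (p := fun a => (Submodule.Quotient.mk (a • indMk (𝒜 := 𝒜) V d v) :
        𝒯.negTop M) ∈ LinearMap.range φ) (fun n hn b hb => ?_) (fun a b ha hb => ?_) a
      · obtain ⟨k, hk⟩ := exists_neg_smul_sub_mem hn
        have h := (Submodule.Quotient.eq (𝒯.negRad M)).2 (hk (M := M) (b • indMk V d v))
        rw [mul_smul, h, Submodule.Quotient.mk_smul]
        obtain ⟨z, hz⟩ := hB b hb v
        exact ⟨k • z, by rw [← hz, LinearMap.map_smul_of_tower]⟩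
      · rw [add_smul, Submodule.Quotient.mk_add]
        exact Submodule.add_mem _ ha hb
    · rw [Submodule.Quotient.mk_add]
      exact Submodule.add_mem _ hx hy
  have h1 : Module.finrank K A = Module.finrank K 𝒯.neg * Module.finrank K 𝒯.T *
      Module.finrank K 𝒯.pos := by
    rw [← (LinearEquiv.ofBijective _ 𝒯.mul_bijective).finrank_eq, Module.finrank_tensorProduct,
      Module.finrank_tensorProduct]
  have h2 : Module.finrank K M.carrier = Module.finrank K A * Module.finrank K V :=
    Module.finrank_tensorProduct
  have h3 := 𝒯.finrank_le_negTop M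
  have h4 : Module.finrank K (𝒯.T ⊗[K] (𝒯.pos ⊗[K] V)) = Module.finrank K 𝒯.T *
      (Module.finrank K 𝒯.pos * Module.finrank K V) := by
    rw [Module.finrank_tensorProduct, Module.finrank_tensorProduct]
  have h5 : Module.finrank K (𝒯.negTop M) ≤ Module.finrank K (𝒯.T ⊗[K] (𝒯.pos ⊗[K] V)) :=
    LinearMap.finrank_le_finrank_of_surjective (f := φ.restrictScalars K) hsurj
  have h6 : Module.finrank K M.carrier =
      Module.finrank K 𝒯.neg * Module.finrank K (𝒯.T ⊗[K] (𝒯.pos ⊗[K] V)) := by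
    rw [h2, h1, h4]
    ring
  -- Surjectivity of `φ` bounds the top from above and Nakayama's lemma bounds it from below;
  -- dividing by `dim A⁻ > 0` gives equality.
  have h7 : Module.finrank K (𝒯.T ⊗[K] (𝒯.pos ⊗[K] V)) = Module.finrank K (𝒯.negTop M) := by
    refine le_antisymm (Nat.le_of_mul_le_mul_left ?_ 𝒯.finrank_neg_pos) h5
    rw [← h6]
    exact h3
  refine ⟨?_, by rw [← h7]; exact h6⟩
  exact Module.Projective.of_equiv (LinearEquiv.ofBijective φ
    ⟨(LinearMap.injective_iff_surjective_of_finrank_eq_finrank (f := φ.restrictScalars K) h7).2 hsurj,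
      hsurj⟩)

theorem finrank_stdObj (V : FGModuleCat.{v} 𝒯.T) (d : X) :
    Module.finrank K (𝒯.stdObj V d).carrier = Module.finrank K 𝒯.neg * 𝒯.dimT V :=
  letI := 𝒯.restrictModule V.obj
  have := 𝒯.restrictModule_finite V.obj
  have := 𝒯.restrictModule_tower V.obj
  𝒯.finrank_properStandard V.obj d

variable {𝒯} in
/-- The submodule generated by a maximal weight space. -/
noncomputable def topMap (M : GrMod 𝒜) (ξ : X)
    (hM : ∀ x ∈ natCone I, x ≠ 0 → M.comp (x + ξ) = ⊥) :
    𝒯.stdObj ((𝒯.weightFunctor ξ).obj M) ξ ⟶ M :=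
  stdObjDesc (V := (𝒯.weightFunctor ξ).obj M) (LinearMap.id (M := 𝒯.weightSpace M ξ)) hM

variable {𝒯} in
theorem mem_range_topMap {M : GrMod 𝒜} {ξ : X}
    (hM : ∀ x ∈ natCone I, x ≠ 0 → M.comp (x + ξ) = ⊥) {m : M.carrier} (hm : m ∈ M.comp ξ) :
    m ∈ LinearMap.range (topMap (𝒯 := 𝒯) M ξ hM).toLin :=
  ⟨_, stdObjDesc_stdUnit (V := (𝒯.weightFunctor ξ).obj M) (LinearMap.id (M := 𝒯.weightSpace M ξ))
    hM ⟨m, hm⟩⟩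

variable {𝒯} in
-- Let `C` be the quotient by the image of `Δ(M_ξ)`. Then `dim M ≤ dim Δ(M_ξ) + dim C ≤ dim A⁻ ·
-- (dim M_ξ + dim (C / A⁻_{<0} C))`, and the surjection `Θ` bounds this by `dim A⁻ · dim (M /
-- A⁻_{<0} M) = dim M`. All inequalities are equalities: `Θ` is an isomorphism, `Δ(M_ξ)` embeds, and
-- both factors of the target of `Θ` are projective over `T`.
theorem IsNegProjective.quot_topMap [Nontrivial A] {M : GrMod 𝒜} (h : 𝒯.IsNegProjective M) {ξ : X}
    (hM : ∀ x ∈ natCone I, x ≠ 0 → M.comp (x + ξ) = ⊥) :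
    Module.Projective 𝒯.T (𝒯.weightSpace M ξ) ∧
    Function.Injective (topMap (𝒯 := 𝒯) M ξ hM).toLin ∧
    𝒯.IsNegProjective (M.quot _ (GrMod.isHomogeneous_range (topMap (𝒯 := 𝒯) M ξ hM))) := by
  let f := topMap (𝒯 := 𝒯) M ξ hM
  let C := M.quot _ (GrMod.isHomogeneous_range f)
  let π : M ⟶ C := M.quotπ _ _
  let Θ : 𝒯.negTop M →ₗ[𝒯.T] 𝒯.weightSpace M ξ × 𝒯.negTop C :=
    ((𝒯.negRad M).liftQ (𝒯.weightProj M ξ)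
      fun m hm => Subtype.ext (𝒯.proj_eq_zero_of_mem_negRad hM hm)).prod (𝒯.negTopMap π)
  have hΘ : Function.Surjective Θ := by
    rintro ⟨⟨v, hv⟩, c⟩
    obtain ⟨c, rfl⟩ := Submodule.mkQ_surjective _ c
    obtain ⟨m, rfl⟩ := M.quotπ_surjective _ _ c
    -- A correction inside `M_ξ` prescribes the component of degree `ξ` without changing the class
    -- in `C`.
    refine ⟨Submodule.Quotient.mk (m + (v - M.proj ξ m)), Prod.ext (Subtype.ext ?_) ?_⟩
    · change M.proj ξ (m + (v - M.proj ξ m)) = v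
      rw [map_add, M.proj_of_mem (Submodule.sub_mem _ hv (M.proj_mem ξ m)), add_sub_cancel]
    · refine congrArg Submodule.Quotient.mk ?_
      refine (map_add π.toLin _ _).trans (add_eq_left.2 ?_)
      exact (Submodule.Quotient.mk_eq_zero _).2
        (mem_range_topMap hM (Submodule.sub_mem _ hv (M.proj_mem ξ m)))
  have h1 : Module.finrank K (𝒯.weightSpace M ξ) + Module.finrank K (𝒯.negTop C) ≤
      Module.finrank K (𝒯.negTop M) := by
    rw [← Module.finrank_prod]
    exact LinearMap.finrank_le_finrank_of_surjective (f := Θ.restrictScalars K) hΘ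
  have h2 : Module.finrank K C.carrier + Module.finrank K (LinearMap.range f.toLinK) =
      Module.finrank K M.carrier :=
    Submodule.finrank_quotient_add_finrank (LinearMap.range f.toLinK)
  have h3 : Module.finrank K (𝒯.stdObj ((𝒯.weightFunctor ξ).obj M) ξ).carrier =
      Module.finrank K 𝒯.neg * Module.finrank K (𝒯.weightSpace M ξ) := by
    rw [finrank_stdObj]
    exact congrArg _ (𝒯.dimT_of (𝒯.weightSpace M ξ))
  have h4 := LinearMap.finrank_range_le f.toLinK
  have h5 := 𝒯.finrank_le_negTop C
  have h6 := h.finrank_eq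
  have h7 := Nat.mul_le_mul_left (Module.finrank K 𝒯.neg) h1
  rw [mul_add] at h7
  have h8 : Module.finrank K (𝒯.negTop M) =
      Module.finrank K (𝒯.weightSpace M ξ × 𝒯.negTop C) := by
    rw [Module.finrank_prod]
    refine le_antisymm (Nat.le_of_mul_le_mul_left ?_ 𝒯.finrank_neg_pos) h1
    rw [mul_add]
    omega
  have h9 : Module.Projective 𝒯.T (𝒯.weightSpace M ξ × 𝒯.negTop C) := by
    have := h.projective
    exact Module.Projective.of_equiv (LinearEquiv.ofBijective Θ
      ⟨(LinearMap.injective_iff_surjective_of_finrank_eq_finrank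
        (f := Θ.restrictScalars K) h8).2 hΘ, hΘ⟩)
  refine ⟨Module.Projective.of_split (LinearMap.inl 𝒯.T _ (𝒯.negTop C)) (LinearMap.fst _ _ _) rfl,
    ?_, Module.Projective.of_split (LinearMap.inr 𝒯.T (𝒯.weightSpace M ξ) _)
      (LinearMap.snd _ _ _) rfl, ?_⟩
  · have h10 := LinearMap.finrank_range_add_finrank_ker f.toLinK
    have h11 : Module.finrank K (LinearMap.ker f.toLinK) = 0 := by omega
    have h12 : LinearMap.ker f.toLinK = ⊥ := Submodule.finrank_eq_zero.1 h11
    have h13 : Function.Injective f.toLinK := LinearMap.ker_eq_bot.1 h12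
    exact h13
  · change Module.finrank K C.carrier = Module.finrank K 𝒯.neg * Module.finrank K (𝒯.negTop C)
    omega

end TriangularDecomposition

/-! ### Filtration by standard modules above a weight -/

namespace TriangularDecomposition

variable {K : Type u} [Field K] {A : Type v} [Ring A] [Algebra K A]
  {X : Type w} [AddCommGroup X] [DecidableEq X] {ι : Type*} {I : Module.Basis ι ℤ X}
  {𝒜 : X → Submodule K A} [GradedAlgebra 𝒜] (𝒯 : TriangularDecomposition I 𝒜)

/-- `M` is generated over `A⁻` by its components of degree `≥ w`. -/
def GeneratedAbove (w : X) (M : GrMod 𝒜) : Prop :=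
  ∀ S : Submodule K M.carrier, (∀ a ∈ 𝒯.neg, ∀ m ∈ S, a • m ∈ S) →
    (∀ x, x - w ∈ natCone I → M.comp x ≤ S) → S = ⊤

variable {𝒯} in
theorem GeneratedAbove.of_surjective {w : X} {M N : GrMod 𝒜} (h : 𝒯.GeneratedAbove w M)
    (f : M ⟶ N) (hf : Function.Surjective f.toLin) : 𝒯.GeneratedAbove w N := by
  intro S hS hN
  have h1 := h (S.comap f.toLinK) (fun a ha m hm => ?_) fun x hx m hm =>
    hN x hx (f.map_mem x m hm)
  · rw [eq_top_iff]
    intro n _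
    obtain ⟨m, rfl⟩ := hf n
    have h2 : m ∈ S.comap f.toLinK := h1 ▸ Submodule.mem_top
    exact h2
  · change f.toLin (a • m) ∈ S
    rw [map_smul]
    exact hS a ha _ hm

/-- As `A = A⁻ B⁺`, the module is generated over `A⁻` by `B⁺ V`, whose degrees are `≥ w`. -/
theorem generatedAbove_inducedMod (V : Type v) [AddCommGroup V] [Module K V]
    [FiniteDimensional K V] (w : X) : 𝒯.GeneratedAbove w (inducedMod V w) := by
  classical
  intro S hS hw
  rw [eq_top_iff]
  intro z _
  refine inducedMod_induction (p := (· ∈ S)) (fun a v => ?_) (fun x y hx hy => S.add_mem hx hy) z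
  refine 𝒯.mul_induction (p := fun a => a • indMk (𝒜 := 𝒜) V w v ∈ S) (fun n hn b hb => ?_)
    (fun a b ha hb => by rw [add_smul]; exact S.add_mem ha hb) a
  rw [mul_smul]
  refine hS n hn _ ?_
  rw [← DirectSum.sum_support_decompose 𝒜 b, Finset.sum_smul]
  refine S.sum_mem fun x _ => ?_
  by_cases h0 : (DirectSum.decompose 𝒜 b x : A) = 0
  · rw [h0, zero_smul]
    exact S.zero_mem
  · refine hw (x + w) ?_ ((inducedMod V w).smul_mem _ _ _ (SetLike.coe_mem _) _ (indMk_mem V w v))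
    rw [add_sub_cancel_right]
    exact 𝒯.posBorel_supp (𝒯.posBorel_graded hb x) (SetLike.coe_mem _) h0

variable {𝒯} in
-- By maximality of `ξ`, elements of `A⁻` act on the degree-`ξ` part as scalars, so the kernel of
-- the projection to that part is stable under `A⁻`. If `ξ` were not `≥ w`, it would contain all
-- generators and `M_ξ` would vanish.
theorem GeneratedAbove.le_of_maximal {w : X} {M : GrMod 𝒜} (h : 𝒯.GeneratedAbove w M) {ξ : X}
    (hM : ∀ x ∈ natCone I, x ≠ 0 → M.comp (x + ξ) = ⊥) (hξ : M.comp ξ ≠ ⊥) :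
    ξ - w ∈ natCone I := by
  by_contra hw
  have h1 := h (LinearMap.ker (M.proj ξ)) (fun n hn m hm => ?_) fun x hx m hm =>
    M.proj_of_mem_ne (by rintro rfl; exact hw hx) hm
  · refine hξ (GrMod.comp_eq_bot_iff.2 fun m => ?_)
    have h2 : m ∈ LinearMap.ker (M.proj ξ) := h1 ▸ Submodule.mem_top
    exact h2
  · obtain ⟨k, hk⟩ := exists_neg_smul_sub_mem hn
    have h3 := 𝒯.proj_eq_zero_of_mem_negRad hM (hk m)
    have h4 : M.proj ξ m = 0 := hm
    rw [map_sub, LinearMap.map_smul, h4, smul_zero, sub_zero] at h3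
    exact h3

/-- The submodule generated by the components of degree not `≤ w`. -/
def upper (w : Weight I) (M : GrMod 𝒜) : Submodule A M.carrier :=
  Submodule.span A {m | ∃ x, x ∉ weightsLE w ∧ m ∈ M.comp x}

theorem isHomogeneous_upper (w : Weight I) (M : GrMod 𝒜) : M.IsHomogeneous (upper w M) :=
  GrMod.isHomogeneous_span M fun _ ⟨x, _, hm⟩ => ⟨x, hm⟩

omit [GradedAlgebra 𝒜] in
theorem mem_upper {w : Weight I} {M : GrMod 𝒜} {x : X} (hx : x ∉ weightsLE w) {m : M.carrier}
    (hm : m ∈ M.comp x) : m ∈ upper w M := Submodule.subset_span ⟨x, hx, hm⟩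

omit [GradedAlgebra 𝒜] in
theorem upper_le_iff {w : Weight I} {M : GrMod 𝒜} {N : Submodule A M.carrier} :
    upper w M ≤ N ↔ ∀ x, x ∉ weightsLE w → ∀ m ∈ M.comp x, m ∈ N := by
  refine Submodule.span_le.trans ⟨fun h x hx m hm => h ⟨x, hx, hm⟩, ?_⟩
  rintro h m ⟨x, hx, hm⟩
  exact h x hx m hm

omit [GradedAlgebra 𝒜] in
theorem upper_le_ker {w : Weight I} {M N : GrMod 𝒜} (f : M ⟶ N)
    (hN : GrMod.supportedIn (weightsLE w) N) : upper w M ≤ LinearMap.ker f.toLin := by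
  refine upper_le_iff.2 fun x hx m hm => ?_
  by_contra h
  exact hx (hN x (GrMod.comp_ne_bot_of_mem (f.map_mem x m hm) h))

omit [GradedAlgebra 𝒜] in
theorem map_upper {w : Weight I} {M N : GrMod 𝒜} (f : M ⟶ N) {m : M.carrier}
    (hm : m ∈ upper w M) : f.toLin m ∈ upper w N := by
  have h : upper w M ≤ (upper w N).comap f.toLin :=
    upper_le_iff.2 fun x hx m hm => mem_upper hx (f.map_mem x m hm)
  exact h hm

omit [GradedAlgebra 𝒜] in
theorem exists_mem_upper {w : Weight I} {M N : GrMod 𝒜} (f : M ⟶ N)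
    (hf : Function.Surjective f.toLin) {n : N.carrier} (hn : n ∈ upper w N) :
    ∃ m ∈ upper w M, f.toLin m = n := by
  have h : upper w N ≤ (upper w M).map f.toLin := by
    refine upper_le_iff.2 fun x hx n hn => ?_
    obtain ⟨m, hm, rfl⟩ := GrMod.exists_preimage_mem f hf hn
    exact ⟨m, mem_upper hx hm, rfl⟩
  exact h hn

variable [FiniteDimensional K A]

/-- The standard modules of projective `T`-modules, of degree `> w`. -/
def projStandardAbove (w : Weight I) : ObjectProperty (GrMod 𝒜) := fun N =>
  ∃ (ξ : Weight I) (V : FGModuleCat.{v} 𝒯.T), w < ξ ∧ Module.Projective 𝒯.T V.obj ∧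
    Nonempty (N ≅ 𝒯.stdObj V ξ.val)

/-- Induction on the dimension. A maximal degree `ξ` not `≤ w` contributes the submodule `Δ(M_ξ)`
with `M_ξ` projective over `T`. Both hypotheses pass to the quotient `C`, and `upper w M` is an
extension of `upper w C` by `Δ(M_ξ)`. -/
theorem isFilteredBy_upper [Nontrivial A] (w : Weight I) (n : ℕ) : ∀ (M : GrMod 𝒜),
    Module.finrank K M.carrier ≤ n → 𝒯.IsNegProjective M → 𝒯.GeneratedAbove w.val M →
    IsFilteredBy (𝒯.projStandardAbove w) (M.sub _ (isHomogeneous_upper w M)) := by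
  induction n with
  | zero =>
    intro M hM _ _
    refine .zero (GrMod.isZero_iff.2 fun m => Subtype.ext ?_)
    exact GrMod.isZero_iff.1 (GrMod.finrank_eq_zero_iff.1 (Nat.le_zero.1 hM)) m.1
  | succ n ih =>
    intro M hn h hw
    by_cases hx : ∃ x, x ∉ weightsLE w ∧ M.comp x ≠ ⊥
    swap
    · push Not at hx
      refine .zero (GrMod.isZero_iff.2 fun m => Subtype.ext ?_)
      have h1 : upper w M ≤ ⊥ := upper_le_iff.2 fun x hxw m hm => by
        rw [hx x hxw] at hm
        exact hm
      exact h1 m.2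
    obtain ⟨x, hxw, hx⟩ := hx
    obtain ⟨ξ, hξ, hξx, hM⟩ := M.exists_maximal_weight I hx
    have hξw : ξ ∉ weightsLE w := fun h => hxw (le_trans (α := Weight I) hξx h)
    -- Not being `≤ w` does not alone give `> w` in a partial order; generation in degrees `≥ w`
    -- supplies the comparison.
    have hlt : w < (ξ : Weight I) := by
      refine lt_of_le_of_ne (hw.le_of_maximal hM hξ) ?_
      rintro rfl
      exact hξw (le_refl (α := Weight I) _)
    obtain ⟨hproj, hinj, hquot⟩ := h.quot_topMap hM
    let f := topMap (𝒯 := 𝒯) M ξ hM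
    let C := M.quot _ (GrMod.isHomogeneous_range f)
    let π : M ⟶ C := M.quotπ _ _
    have hπ : Function.Surjective π.toLin := M.quotπ_surjective _ _
    have hπ0 : ∀ m, π.toLin m = 0 ↔ m ∈ LinearMap.range f.toLin :=
      fun m => Submodule.Quotient.mk_eq_zero _
    -- The dimension drops because the nonzero component `M_ξ` dies in `C`.
    have hC : Module.finrank K C.carrier ≤ n := by
      have h1 : Module.finrank K C.carrier ≤ Module.finrank K M.carrier :=
        LinearMap.finrank_le_finrank_of_surjective (f := π.toLinK) hπ
      rcases h1.lt_or_eq with h1 | h1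
      · omega
      · exfalso
        apply hξ
        have h2 : Function.Injective π.toLinK :=
          (LinearMap.injective_iff_surjective_of_finrank_eq_finrank h1.symm).2 hπ
        rw [Submodule.eq_bot_iff]
        intro m hm
        exact h2 (((hπ0 m).2 (mem_range_topMap hM hm)).trans (map_zero _).symm)
    have hfu : ∀ z, f.toLin z ∈ upper w M := by
      intro z
      refine stdObj_induction (p := fun z => f.toLin z ∈ upper w M) (fun n hn v => ?_)
        (fun x y hx hy => by rw [map_add]; exact Submodule.add_mem _ hx hy) z
      rw [map_smul]
      exact Submodule.smul_mem _ _ (mem_upper hξw (f.map_mem ξ _ (𝒯.stdUnit _ ξ v).2))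
    let q : M.sub _ (isHomogeneous_upper w M) ⟶ C.sub _ (isHomogeneous_upper w C) :=
      ⟨π.toLin.restrict fun m hm => map_upper π hm, fun x m hm => π.map_mem x m.1 hm⟩
    have hq : ∀ m, (q.toLin m).1 = π.toLin m.1 := fun _ => rfl
    refine GrMod.isFilteredBy_of_surjective (ih C hC hquot (hw.of_surjective π hπ)) q ?_ ?_
    · rintro ⟨c, hc⟩
      obtain ⟨m, hm, hmc⟩ := exists_mem_upper π hπ hc
      exact ⟨⟨m, hm⟩, Subtype.ext hmc⟩
    · refine IsFilteredBy.of_prop ⟨ξ, (𝒯.weightFunctor ξ).obj M, hlt, hproj, ⟨Iso.symm ?_⟩⟩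
      refine GrMod.isoOfBijective (M := 𝒯.stdObj ((𝒯.weightFunctor ξ).obj M) ξ)
        ⟨LinearMap.codRestrict (LinearMap.ker q.toLin) (LinearMap.codRestrict (upper w M) f.toLin hfu)
          fun z => Subtype.ext ((hπ0 _).2 ⟨z, rfl⟩), fun x z hz => f.map_mem x z hz⟩ ⟨?_, ?_⟩
      · intro z z' hz
        exact hinj (congrArg (fun z => Subtype.val (Subtype.val z)) hz)
      · rintro ⟨⟨m, hm⟩, hm'⟩
        have h1 : π.toLin m = 0 := congrArg Subtype.val hm'
        obtain ⟨z, rfl⟩ := (hπ0 m).1 h1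
        exact ⟨z, rfl⟩

end TriangularDecomposition

theorem IsFilteredBy.map {C D : Type*} [Category* C] [Category* D] [Abelian C] [Abelian D]
    (F : C ⥤ D) [F.PreservesZeroMorphisms] [PreservesFiniteLimits F] [PreservesFiniteColimits F]
    {Q : ObjectProperty C} {Q' : ObjectProperty D} (hQ : ∀ M, Q M → Q' (F.obj M)) {M : C}
    (h : IsFilteredBy Q M) : IsFilteredBy Q' (F.obj M) := by
  induction h with
  | zero h => exact .zero (F.map_isZero h)
  | step hS _ h₃ ih => exact .step (hS.map_of_exact F) ih (hQ _ h₃)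

namespace GrMod

variable {K : Type u} [Field K] {A : Type v} [Ring A] [Algebra K A] {X : Type w}
  [AddCommGroup X] [DecidableEq X] {𝒜 : X → Submodule K A} [FiniteDimensional K A]

/-- Each subquotient of a filtration may itself be refined, by splicing. -/
theorem isFilteredBy_trans {Q Q' : ObjectProperty (GrMod 𝒜)}
    (hQ : ∀ N, Q N → IsFilteredBy Q' N) {M : GrMod 𝒜} (h : IsFilteredBy Q M) :
    IsFilteredBy Q' M := by
  induction h with
  | zero h => exact .zero h
  | @step S hS _ h₃ ih =>
    have := hS.mono_f
    have := hS.epi_g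
    refine isFilteredBy_of_surjective (hQ _ h₃) S.g (surjective_of_epi S.g) (ih.of_iso ?_)
    refine isoOfBijective (N := S.X₂.sub _ (isHomogeneous_ker S.g))
      ⟨S.f.toLin.codRestrict _ fun m => congr_toLin S.zero m, fun x m hm => S.f.map_mem x m hm⟩
      ⟨fun m m' h => injective_of_mono S.f (congrArg Subtype.val h), ?_⟩
    rintro ⟨m, hm⟩
    obtain ⟨l, rfl⟩ := exists_of_shortExact hS hm
    exact ⟨l, rfl⟩

end GrMod

namespace TriangularDecomposition

variable {K : Type u} [Field K] {A : Type v} [Ring A] [Algebra K A]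
  {X : Type w} [AddCommGroup X] [DecidableEq X] {ι : Type*} {I : Module.Basis ι ℤ X}
  {𝒜 : X → Submodule K A} [GradedAlgebra 𝒜] (𝒯 : TriangularDecomposition I 𝒜)
  [FiniteDimensional K A]

/-! ### Filtrations of projective `T`-modules -/

theorem exists_epi_simpleT (V : FGModuleCat.{v} 𝒯.T) [Nontrivial V.obj] (ξ : X) :
    ∃ (l : 𝒯.Label) (f : V ⟶ 𝒯.simpleT l), l.weight = ξ ∧ Epi f := by
  obtain ⟨N, hN⟩ := IsCoatomic.exists_coatom (Submodule 𝒯.T V.obj)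
  have := isSimpleModule_iff_isCoatom.2 hN
  let S : SimpleMod K 𝒯.T :=
    { carrier := V.obj ⧸ N
      moduleK := 𝒯.restrictModule _
      isScalarTower := 𝒯.restrictModule_tower _ }
  let lam : Irr K 𝒯.T := Quotient.mk _ S
  obtain ⟨e⟩ : Nonempty (lam.rep.carrier ≃ₗ[𝒯.T] S.carrier) := Quotient.exact (Quotient.out_eq lam)
  refine ⟨⟨lam, ξ⟩, FGModuleCat.ofHom (V := V.obj) (e.symm.toLinearMap ∘ₗ N.mkQ), rfl, ?_⟩
  exact (FGModuleCat.epi_iff _).2 (e.symm.surjective.comp N.mkQ_surjective)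

omit [FiniteDimensional K A] in
theorem nontrivial_simpleT (l : 𝒯.Label) : Nontrivial (𝒯.simpleT l).obj :=
  IsSimpleModule.nontrivial 𝒯.T l.type.rep.carrier

omit [FiniteDimensional K A] in
theorem isZero_of_subsingleton (V : FGModuleCat.{v} 𝒯.T) [Subsingleton V.obj] : IsZero V :=
  (IsZero.iff_id_eq_zero _).2 (FGModuleCat.hom_ext (LinearMap.ext fun _ => Subsingleton.elim _ _))

/-- A nonzero projective module has a simple quotient. It maps onto the projective cover of that
quotient by essentiality, and the map splits, so the kernel is projective of smaller dimension. -/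
theorem isFilteredBy_projT (ξ : X) (n : ℕ) : ∀ (V : FGModuleCat.{v} 𝒯.T), 𝒯.dimT V ≤ n →
    Projective V →
    IsFilteredBy (fun W => ∃ l : 𝒯.Label, l.weight = ξ ∧ Nonempty (W ≅ 𝒯.projT l)) V := by
  induction n with
  | zero =>
    intro V hV _
    let := 𝒯.restrictModule V.obj
    have := 𝒯.restrictModule_finite V.obj
    have : Subsingleton V.obj := Module.finrank_zero_iff.1 (Nat.le_zero.1 hV)
    exact .zero (𝒯.isZero_of_subsingleton V)
  | succ n ih =>
    intro V hV _
    rcases subsingleton_or_nontrivial V.obj with h | h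
    · exact .zero (𝒯.isZero_of_subsingleton V)
    obtain ⟨l, f, hl, hf⟩ := 𝒯.exists_epi_simpleT V ξ
    have hc := 𝒯.isProjectiveCover_coverT l
    have := hc.projective
    have := hc.epi
    let g : V ⟶ 𝒯.projT l := Projective.factorThru f (𝒯.coverT l)
    have hg : g ≫ 𝒯.coverT l = f := Projective.factorThru_comp _ _
    have hgepi : Epi g := hc.essential g (by rw [hg]; exact hf)
    let S : ShortComplex (FGModuleCat.{v} 𝒯.T) := ShortComplex.mk (kernel.ι g) g (kernel.condition g)
    have hS : S.ShortExact :=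
      { exact := ShortComplex.exact_kernel g
        mono_f := inferInstanceAs (Mono (kernel.ι g))
        epi_g := hgepi }
    have hproj : Projective (kernel g) := by
      let σ := hS.splittingOfProjective
      exact (Retract.mk (kernel.ι g) σ.r σ.f_r).projective
    refine IsFilteredBy.step hS (ih _ ?_ hproj) ⟨l, hl, ⟨Iso.refl _⟩⟩
    rcases (𝒯.dimT_le_of_mono (kernel.ι g)).lt_or_eq with h1 | h1
    · change 𝒯.dimT (kernel g) ≤ n
      omega
    · exfalso
      have := 𝒯.isIso_of_mono_of_dimT (kernel.ι g) h1
      have hg0 : g = 0 := by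
        rw [← cancel_epi (kernel.ι g), kernel.condition, comp_zero]
      have hf0 : f = 0 := by rw [← hg, hg0, zero_comp]
      have hs := (FGModuleCat.epi_iff f).1 hf
      have := 𝒯.nontrivial_simpleT l
      obtain ⟨v, hv⟩ := exists_ne (0 : (𝒯.simpleT l).obj)
      obtain ⟨m, rfl⟩ := hs v
      rw [hf0] at hv
      exact hv rfl

theorem isFilteredBy_stdObj (ξ : Weight I) (V : FGModuleCat.{v} 𝒯.T) [Module.Projective 𝒯.T V.obj] :
    IsFilteredBy (fun N => ∃ l : 𝒯.Label, l.weight = ξ.val ∧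
      Nonempty (N ≅ 𝒯.stdObj (𝒯.projT l) l.weight)) (𝒯.stdObj V ξ.val) := by
  have h := 𝒯.isFilteredBy_projT ξ.val _ V le_rfl (FGModuleCat.projective_of_module_projective V)
  have h1 : PreservesFiniteLimits (𝒯.stdFunctor ξ ⋙ (serreLE 𝒯.simple 𝒯.deg ξ).ι) :=
    comp_preservesFiniteLimits _ _
  have h2 : PreservesFiniteColimits (𝒯.stdFunctor ξ ⋙ (serreLE 𝒯.simple 𝒯.deg ξ).ι) :=
    comp_preservesFiniteColimits _ _
  refine h.map (𝒯.stdFunctor ξ ⋙ (serreLE 𝒯.simple 𝒯.deg ξ).ι) ?_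
  rintro W ⟨l, hl, ⟨e⟩⟩
  refine ⟨l, hl, ⟨?_⟩⟩
  rw [hl]
  exact (𝒯.stdFunctor ξ ⋙ (serreLE 𝒯.simple 𝒯.deg ξ).ι).mapIso e

/-! ### Projective covers and standard modules -/

/-- The canonical map from the standard to the proper standard module, composed with the projection
to the simple head. -/
theorem exists_stdObj_to_simple (l : 𝒯.Label) (V : FGModuleCat.{v} 𝒯.T) (f : V ⟶ 𝒯.simpleT l) :
    ∃ e : 𝒯.stdObj V l.weight ⟶ 𝒯.simple l, ∀ v,
      e.toLin (𝒯.stdUnit V l.weight v) = 𝒯.simpleWeight l (f.hom.hom v) := by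
  have hM : ∀ x ∈ natCone I, x ≠ 0 → (𝒯.simple l).comp (x + l.weight) = ⊥ :=
    comp_eq_bot_of_supportedIn (I := I) (ξ := l.weight) fun _ hx => 𝒯.simple_support l hx
  exact ⟨_, stdObjDesc_stdUnit ((𝒯.simpleWeight l).toLinearMap ∘ₗ f.hom.hom) hM⟩

theorem surjective_to_simple {l : 𝒯.Label} {M : GrMod 𝒜} (f : M ⟶ 𝒯.simple l)
    (h : ∃ m, f.toLin m ≠ 0) : Function.Surjective f.toLin := by
  have := 𝒯.simple_simple l
  obtain ⟨m, hm⟩ := h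
  have hf : f ≠ 0 := by
    rintro rfl
    exact hm rfl
  have : Epi f := epi_of_nonzero_to_simple hf
  exact GrMod.surjective_of_epi f

end TriangularDecomposition

/-- Essentiality descends from `P` to its quotient `D`: pulling `g` back along `π` gives a map into
`P`, to which essentiality of the cover applies. -/
theorem IsProjectiveCover.epi_of_epi_comp {C : Type*} [Category* C] [Abelian C] {P D L N : C}
    {π : P ⟶ D} [Epi π] {c : D ⟶ L} (h : IsProjectiveCover (π ≫ c)) (g : N ⟶ D)
    (hg : Epi (g ≫ c)) : Epi g := by
  have h1 : pullback.snd g π ≫ π ≫ c = pullback.fst g π ≫ g ≫ c := by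
    rw [← Category.assoc, ← pullback.condition, Category.assoc]
  have h2 : Epi (pullback.snd g π) := h.essential _ (by rw [h1]; exact epi_comp _ _)
  have h3 : Epi (pullback.fst g π ≫ g) := by
    rw [pullback.condition]
    exact epi_comp _ _
  exact epi_of_epi (pullback.fst g π) g

namespace TriangularDecomposition

variable {K : Type u} [Field K] {A : Type v} [Ring A] [Algebra K A]
  {X : Type w} [AddCommGroup X] [DecidableEq X] {ι : Type*} {I : Module.Basis ι ℤ X}
  {𝒜 : X → Submodule K A} [GradedAlgebra 𝒜] (𝒯 : TriangularDecomposition I 𝒜)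
  [FiniteDimensional K A]

omit [FiniteDimensional K A] in
theorem nontrivial_of_label (l : 𝒯.Label) : Nontrivial A := by
  by_contra h
  rw [not_nontrivial_iff_subsingleton] at h
  have h1 : Subsingleton 𝒯.T := inferInstance
  have := Module.subsingleton 𝒯.T l.type.rep.carrier
  exact not_nontrivial _ (IsSimpleModule.nontrivial 𝒯.T l.type.rep.carrier)

theorem coverT_surjective (l : 𝒯.Label) : Function.Surjective (𝒯.coverT l).hom.hom :=
  (FGModuleCat.epi_iff _).1 (𝒯.isProjectiveCover_coverT l).epi

/-- The projection from the standard module to its simple head. -/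
theorem exists_stdObj_top (l : 𝒯.Label) :
    ∃ e : 𝒯.stdObj (𝒯.projT l) l.weight ⟶ 𝒯.simple l, Function.Surjective e.toLin ∧
      ∀ v, e.toLin (𝒯.stdUnit (𝒯.projT l) l.weight v) =
        𝒯.simpleWeight l ((𝒯.coverT l).hom.hom v) := by
  obtain ⟨e, he⟩ := 𝒯.exists_stdObj_to_simple l _ (𝒯.coverT l)
  refine ⟨e, 𝒯.surjective_to_simple e ?_, he⟩
  have := 𝒯.nontrivial_simpleT l
  obtain ⟨s, hs⟩ := exists_ne (0 : (𝒯.simpleT l).obj)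
  obtain ⟨v, rfl⟩ := 𝒯.coverT_surjective l s
  refine ⟨(𝒯.stdUnit (𝒯.projT l) l.weight v).1, fun h => hs ?_⟩
  rw [he] at h
  exact (𝒯.simpleWeight l).injective ((Subtype.ext h).trans (map_zero _).symm)

/-- The projection from the standard module to its simple head is essential. -/
theorem surjective_of_comp_stdObj_top {l : 𝒯.Label} {M : GrMod 𝒜}
    {p : M ⟶ 𝒯.stdObj (𝒯.projT l) l.weight} {e : 𝒯.stdObj (𝒯.projT l) l.weight ⟶ 𝒯.simple l}
    (he : ∀ v, e.toLin (𝒯.stdUnit (𝒯.projT l) l.weight v) =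
      𝒯.simpleWeight l ((𝒯.coverT l).hom.hom v))
    (h : Function.Surjective (p ≫ e).toLin) : Function.Surjective p.toLin := by
  let E := LinearEquiv.ofBijective _ (𝒯.stdUnit_bijective (𝒯.projT l) l.weight)
  -- The effect of `p` in the top degree is read as a `T`-linear map to the projective cover, whose
  -- essentiality makes it surjective; the top degree generates the standard module.
  obtain ⟨φ, hφ⟩ : ∃ φ : 𝒯.weightSpace M l.weight →ₗ[𝒯.T] (𝒯.projT l).obj,
      ∀ m, 𝒯.stdUnit (𝒯.projT l) l.weight (φ m) = 𝒯.weightMap p l.weight m :=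
    ⟨E.symm.toLinearMap ∘ₗ 𝒯.weightMap p l.weight, fun m => E.apply_symm_apply _⟩
  let f : FGModuleCat.of 𝒯.T (𝒯.weightSpace M l.weight) ⟶ 𝒯.projT l :=
    ObjectProperty.homMk (ModuleCat.ofHom φ)
  have hs : Function.Surjective fun m => (𝒯.coverT l).hom.hom (φ m) := by
    intro s
    obtain ⟨m, hm, hms⟩ := GrMod.exists_preimage_mem (p ≫ e) h (𝒯.simpleWeight l s).2
    refine ⟨⟨m, hm⟩, (𝒯.simpleWeight l).injective (Subtype.ext ?_)⟩
    rw [← he, hφ, ← hms]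
    rfl
  have hf : Epi f := by
    apply (𝒯.isProjectiveCover_coverT l).essential
    rw [FGModuleCat.epi_iff]
    exact hs
  have hfs : Function.Surjective φ := (FGModuleCat.epi_iff f).1 hf
  intro z
  refine stdObj_induction (p := fun z => ∃ m, p.toLin m = z) (fun n _ v => ?_) ?_ z
  · obtain ⟨m, rfl⟩ := hfs v
    exact ⟨n • m.1, by rw [hφ, map_smul]; rfl⟩
  · rintro _ _ ⟨a, rfl⟩ ⟨b, rfl⟩
    exact ⟨a + b, map_add _ _ _⟩

/-- Among modules with degrees `≤ w`, maps out of `Δ(λ, w)` are `T`-linear maps out of a projective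
`T`-module. Hence the surjection from `P(λ, w)` modulo `upper` to `Δ(λ, w)` has a section. The
section is an epimorphism by essentiality, so the surjection is injective. -/
theorem ker_eq_upper (l : 𝒯.Label) (p : 𝒯.proj l ⟶ 𝒯.stdObj (𝒯.projT l) l.weight)
    (e : 𝒯.stdObj (𝒯.projT l) l.weight ⟶ 𝒯.simple l) (hpe : p ≫ e = 𝒯.cover l) (he : Epi e)
    (hp : Function.Surjective p.toLin) : upper l.degree (𝒯.proj l) = LinearMap.ker p.toLin := by
  have hsupp := 𝒯.stdObj_mem_supportedIn (𝒯.projT l) l.degree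
  have hle : upper l.degree (𝒯.proj l) ≤ LinearMap.ker p.toLin := upper_le_ker p hsupp
  refine le_antisymm hle ?_
  let D := (𝒯.proj l).quot _ (isHomogeneous_upper l.degree (𝒯.proj l))
  let π : 𝒯.proj l ⟶ D := GrMod.quotπ _ _ _
  have hπ : Function.Surjective π.toLin := GrMod.quotπ_surjective _ _ _
  let q : D ⟶ 𝒯.stdObj (𝒯.projT l) l.weight := GrMod.quotDesc _ _ p hle
  have hq : ∀ m, q.toLin (π.toLin m) = p.toLin m := fun _ => rfl
  have hqsurj : Function.Surjective q.toLin := fun z => by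
    obtain ⟨m, rfl⟩ := hp z
    exact ⟨_, hq m⟩
  have hD : GrMod.supportedIn (weightsLE l.degree) D := by
    intro x hx
    by_contra hxw
    refine hx ((Submodule.eq_bot_iff _).2 fun d hd => ?_)
    obtain ⟨m, hm, rfl⟩ := GrMod.exists_preimage_mem π hπ hd
    exact (Submodule.Quotient.mk_eq_zero _).2 (mem_upper hxw hm)
  have := (𝒯.isProjectiveCover_coverT l).projective
  have := FGModuleCat.module_projective_of_projective (𝒯.projT l)
  obtain ⟨h, hh⟩ := Module.projective_lifting_property (𝒯.weightMap q l.weight)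
    (𝒯.stdUnit (𝒯.projT l) l.weight) (𝒯.weightMap_surjective hqsurj l.weight)
  let s : 𝒯.stdObj (𝒯.projT l) l.weight ⟶ D := stdObjDesc h (comp_eq_bot_of_supportedIn hD)
  have hs : s ≫ q = 𝟙 _ := stdObj_hom_ext fun v =>
    (congrArg q.toLin (stdObjDesc_stdUnit h (comp_eq_bot_of_supportedIn hD) v)).trans
      (congrArg Subtype.val (LinearMap.congr_fun hh v))
  have hπepi : Epi π := GrMod.epi_of_surjective π hπ
  have hcov : IsProjectiveCover (π ≫ q ≫ e) := by
    have : π ≫ q ≫ e = 𝒯.cover l := hpe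
    rw [this]
    exact 𝒯.isProjectiveCover_cover l
  have hsepi : Epi s := hcov.epi_of_epi_comp s (by rwa [← Category.assoc, hs, Category.id_comp])
  intro m hm
  obtain ⟨z, hz⟩ := GrMod.surjective_of_epi s (π.toLin m)
  have h1 : z = 0 := by
    have h2 : q.toLin (s.toLin z) = z := GrMod.congr_toLin hs z
    rw [hz, hq] at h2
    exact h2.symm.trans hm
  rw [h1, map_zero] at hz
  exact (Submodule.Quotient.mk_eq_zero _).1 hz.symm

/-- The kernel of `P(λ) ⟶ Δ(λ)` is filtered by standard modules `Δ(μ)` with `μ > λ`. -/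
theorem isFilteredBy_kernel (l : 𝒯.Label) (p : 𝒯.proj l ⟶ 𝒯.stdObj (𝒯.projT l) l.weight)
    (h : upper l.degree (𝒯.proj l) = LinearMap.ker p.toLin) :
    IsFilteredBy (fun N => ∃ m : 𝒯.Label, l < m ∧
      Nonempty (N ≅ 𝒯.stdObj (𝒯.projT m) m.weight)) (kernel p) := by
  have := 𝒯.nontrivial_of_label l
  have := 𝒯.finite_simple l.type.rep
  obtain ⟨s, q, hsq⟩ := 𝒯.proj_retract l
  have h1 : 𝒯.IsNegProjective (𝒯.proj l) := (𝒯.isNegProjective_inducedMod _ _).of_retract s q hsq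
  have h2 : 𝒯.GeneratedAbove l.weight (𝒯.proj l) :=
    (𝒯.generatedAbove_inducedMod _ _).of_surjective q fun m => ⟨_, GrMod.congr_toLin hsq m⟩
  have h3 := 𝒯.isFilteredBy_upper l.degree _ (𝒯.proj l) le_rfl h1 h2
  have h4 : ∀ (N : Submodule A (𝒯.proj l).carrier) (hN : (𝒯.proj l).IsHomogeneous N),
      N = LinearMap.ker p.toLin → Nonempty ((𝒯.proj l).sub N hN ≅ kernel p) := by
    rintro N hN rfl
    exact ⟨(GrMod.kernelIso p).symm⟩
  obtain ⟨i⟩ := h4 _ (isHomogeneous_upper l.degree _) h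
  refine GrMod.isFilteredBy_trans ?_ (h3.of_iso i)
  rintro N ⟨ξ, V, hξ, hV, ⟨i⟩⟩
  refine ((𝒯.isFilteredBy_stdObj ξ V).mono ?_).of_iso i.symm
  rintro M ⟨m, rfl, hm⟩
  exact ⟨m, hξ, hm⟩

/-- The cover of `L(λ, w)` lifts through `Δ(λ, w)` by projectivity, and the lift is onto because
`Δ(λ, w) ⟶ L(λ, w)` is essential. -/
theorem exists_proj_to_stdObj (l : 𝒯.Label) :
    ∃ p : 𝒯.proj l ⟶ 𝒯.stdObj (𝒯.projT l) l.weight, Epi p ∧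
      IsFilteredBy (fun N => ∃ m : 𝒯.Label, l < m ∧
        Nonempty (N ≅ 𝒯.stdObj (𝒯.projT m) m.weight)) (kernel p) := by
  have hc := 𝒯.isProjectiveCover_cover l
  have := hc.projective
  have := hc.epi
  obtain ⟨e, hesurj, he⟩ := 𝒯.exists_stdObj_top l
  have hepi : Epi e := GrMod.epi_of_surjective e hesurj
  obtain ⟨p, hp⟩ : ∃ p, p ≫ e = 𝒯.cover l := ⟨_, Projective.factorThru_comp _ _⟩
  have hsurj : Function.Surjective p.toLin := 𝒯.surjective_of_comp_stdObj_top he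
    (by rw [hp]; exact GrMod.surjective_of_epi _)
  exact ⟨p, GrMod.epi_of_surjective p hsurj,
    𝒯.isFilteredBy_kernel l p (𝒯.ker_eq_upper l p e hp hepi hsurj)⟩

end TriangularDecomposition

namespace TriangularDecomposition

variable {K : Type u} [Field K] {A : Type v} [Ring A] [Algebra K A]
  {X : Type w} [AddCommGroup X] [DecidableEq X] {ι : Type*} {I : Module.Basis ι ℤ X}
  {𝒜 : X → Submodule K A} [GradedAlgebra 𝒜] (𝒯 : TriangularDecomposition I 𝒜)
  [FiniteDimensional K A]

/-! ### The standard stratification -/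

theorem finite_fibers (ξ : Weight I) : (𝒯.deg ⁻¹' {ξ}).Finite := by
  have : Finite (Irr K 𝒯.T) := finite_irr
  refine Set.Finite.of_injOn (f := Label.type) (t := Set.univ) (fun _ _ => trivial) ?_
    Set.finite_univ
  intro l hl l' hl' h
  exact Label.ext h (hl.trans hl'.symm)

/-- The simple object of a layer. -/
noncomputable def layerSimpleIso (l : 𝒯.Label) :
    (𝒯.layerEquiv l.degree).inverse.obj (𝒯.simpleT l) ≅ layerSimple 𝒯.simple 𝒯.deg l :=
  (𝒯.layerEquiv l.degree).inverse.mapIso (FGModuleCat.isoOfEquiv (𝒯.simpleWeight l)) ≪≫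
    (𝒯.layerIso l.degree).app (simpleLE 𝒯.simple 𝒯.deg l)

/-- Standard objects as standard modules. -/
noncomputable def layerStdIso (l : 𝒯.Label) :
    ((𝒯.layerStd l.degree).obj ((𝒯.layerEquiv l.degree).inverse.obj (𝒯.projT l))).obj ≅
      𝒯.stdObj (𝒯.projT l) l.weight :=
  (serreLE 𝒯.simple 𝒯.deg l.degree).ι.mapIso ((𝒯.stdFunctor l.degree).mapIso
    ((𝒯.layerEquiv l.degree).counitIso.app (𝒯.projT l)))

theorem kernel_comp_iso_hom {C : Type*} [Category* C] [Abelian C] {M N N' : C} (p : M ⟶ N)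
    (e : N ≅ N') : Nonempty (kernel p ≅ kernel (p ≫ e.hom)) :=
  ⟨(kernelCompMono p e.hom).symm⟩

/-- The category of graded modules is standardly stratified. -/
noncomputable def stratification [Finite ι] : StandardStratification 𝒯.simple 𝒯.deg K where
  finite_length := GrMod.finite_length
  enoughProjectives := enoughProjectives
  simple := 𝒯.simple_simple
  simple_injective := 𝒯.simple_injective
  simple_surjective := 𝒯.simple_surjective
  end_simple := 𝒯.end_simple
  interval_finite := Weight.finite_Icc I
  finite_fibers := 𝒯.finite_fibers
  lt_iff _ _ := Iff.rfl
  standardization := 𝒯.layerStd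
  adj := 𝒯.layerAdj
  standardization_left_exact _ := inferInstance
  standardization_right_exact _ := inferInstance
  layerProj l := (𝒯.layerEquiv l.degree).inverse.obj (𝒯.projT l)
  layerCover l := (𝒯.layerEquiv l.degree).inverse.map (𝒯.coverT l) ≫ (𝒯.layerSimpleIso l).hom
  isProjectiveCover_layerCover l :=
    ((𝒯.isProjectiveCover_coverT l).map_equivalence (𝒯.layerEquiv l.degree).symm).comp_iso
      (𝒯.layerSimpleIso l)
  proj := 𝒯.proj
  cover := 𝒯.cover
  isProjectiveCover_cover := 𝒯.isProjectiveCover_cover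
  exists_filtration l := by
    obtain ⟨p, hp, h⟩ := 𝒯.exists_proj_to_stdObj l
    refine ⟨p ≫ (𝒯.layerStdIso l).inv, epi_comp _ _, ?_⟩
    obtain ⟨e⟩ := kernel_comp_iso_hom p (𝒯.layerStdIso l).symm
    refine (h.mono ?_).of_iso e
    rintro N ⟨m, hm, ⟨i⟩⟩
    exact ⟨m, hm, ⟨i ≪≫ (𝒯.layerStdIso m).symm⟩⟩

/-- Over a semisimple ring the simple module is itself projective, and a projective cover of a
projective object is an isomorphism. -/
theorem isIso_coverT [IsSemisimpleRing 𝒯.T] (l : 𝒯.Label) : IsIso (𝒯.coverT l) := by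
  have : Module.Projective 𝒯.T (𝒯.simpleT l).obj :=
    Module.projective_of_isSemisimpleRing 𝒯.T l.type.rep.carrier
  have := FGModuleCat.projective_of_module_projective (𝒯.simpleT l)
  exact (𝒯.isProjectiveCover_coverT l).isIso_of_projective

theorem isIso_standardToProper [Finite ι] [IsSemisimpleRing 𝒯.T] (l : 𝒯.Label) :
    IsIso (𝒯.stratification.standardToProper l) := by
  have := 𝒯.isIso_coverT l
  have h : IsIso (𝒯.stratification.layerCover l) := inferInstanceAs
    (IsIso ((𝒯.layerEquiv l.degree).inverse.map (𝒯.coverT l) ≫ (𝒯.layerSimpleIso l).hom))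
  exact inferInstanceAs (IsIso ((serreLE 𝒯.simple 𝒯.deg l.degree).ι.map
    ((𝒯.stratification.standardization l.degree).map (𝒯.stratification.layerCover l))))

/-- If `T` is semisimple then the kernel of `Δ(λ, w) ⟶ L(λ, w)` has degrees `< w`. -/
theorem kernel_supportedIn [IsSemisimpleRing 𝒯.T] (l : 𝒯.Label)
    {e : 𝒯.stdObj (𝒯.projT l) l.weight ⟶ 𝒯.simple l}
    (he : ∀ v, e.toLin (𝒯.stdUnit (𝒯.projT l) l.weight v) =
      𝒯.simpleWeight l ((𝒯.coverT l).hom.hom v)) :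
    GrMod.supportedIn (weightsLT l.degree) (kernel e) := by
  refine (GrMod.supportedIn (weightsLT l.degree)).prop_of_iso (GrMod.kernelIso e).symm ?_
  intro x hx
  refine ⟨𝒯.stdObj_support _ _ (GrMod.comp_ne_bot_of_injective
    (f := GrMod.subι _ _ (GrMod.isHomogeneous_ker e)) (Submodule.subtype_injective _) hx), ?_⟩
  rintro rfl
  refine hx ((Submodule.eq_bot_iff _).2 ?_)
  rintro ⟨m, hm⟩ hmx
  apply Subtype.ext
  obtain ⟨v, hv⟩ := (𝒯.stdUnit_bijective (𝒯.projT l) l.weight).2 ⟨m, hmx⟩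
  have hv' : m = (𝒯.stdUnit (𝒯.projT l) l.weight v).1 := (congrArg Subtype.val hv).symm
  have h1 : (𝒯.simpleWeight l ((𝒯.coverT l).hom.hom v)).1 = 0 := by
    rw [← he, ← hv']
    exact hm
  have h2 : (𝒯.coverT l).hom.hom v = 0 :=
    (𝒯.simpleWeight l).injective ((Subtype.ext h1).trans (map_zero _).symm)
  -- Semisimplicity enters here: in degree `w` the map to `L(λ, w)` is the cover of `λ`, which is
  -- now injective.
  have := 𝒯.isIso_coverT l
  have h3 : v = 0 := (FGModuleCat.mono_iff (𝒯.coverT l)).1 inferInstance (h2.trans (map_zero _).symm)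
  change m = 0
  rw [hv', h3, map_zero]
  rfl

theorem isHighestWeight [Finite ι] [IsSemisimpleRing 𝒯.T] :
    IsHighestWeight 𝒯.simple K 𝒯.stratification.standard where
  finite_length := GrMod.finite_length
  enoughProjectives := enoughProjectives
  interval_finite l l' := by
    -- Labels in an interval have weights in a finite interval, and only finitely many labels share
    -- a weight.
    refine ((Weight.finite_Icc I l.degree l'.degree).preimage' (f := 𝒯.deg)
      fun ξ _ => 𝒯.finite_fibers ξ).subset ?_
    have h : ∀ {a b : 𝒯.Label}, a ≤ b → a.degree ≤ b.degree := by
      rintro a b (rfl | h)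
      exacts [le_rfl, h.le]
    exact fun m hm => ⟨h hm.1, h hm.2⟩
  simple := 𝒯.simple_simple
  simple_injective := 𝒯.simple_injective
  simple_surjective := 𝒯.simple_surjective
  finite_hom _ _ := GrMod.finite_hom _ _
  standard_top l := by
    obtain ⟨e, hesurj, he⟩ := 𝒯.exists_stdObj_top l
    have := GrMod.epi_of_surjective e hesurj
    have hepi : Epi ((𝒯.layerStdIso l).hom ≫ e) := epi_comp _ _
    refine ⟨(𝒯.layerStdIso l).hom ≫ e, hepi, ?_⟩
    have h : serreLT 𝒯.simple 𝒯.deg l.degree (kernel e) := by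
      rw [serreLT_eq]
      exact 𝒯.kernel_supportedIn l he
    exact (serreLT 𝒯.simple 𝒯.deg l.degree).prop_of_iso
      (kernelIsIsoComp (𝒯.layerStdIso l).hom e).symm h
  standard_filtration l := ⟨_, _, 𝒯.stratification.isProjectiveCover_cover l,
    𝒯.stratification.exists_filtration l⟩

end TriangularDecomposition

theorem mainTheorem12 {K : Type u} [Field K] {A : Type v} [Ring A] [Algebra K A]
    [FiniteDimensional K A] {X : Type w} [AddCommGroup X] [DecidableEq X]
    {ι : Type*} [Finite ι] (I : Module.Basis ι ℤ X)
    (𝒜 : X → Submodule K A) [GradedAlgebra 𝒜] (𝒯 : TriangularDecomposition I 𝒜) :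
    ∃ S : StandardStratification 𝒯.simple
        (TriangularDecomposition.Label.degree : 𝒯.Label → Weight I) K,
      IsSemisimpleRing 𝒯.T →
        (∀ l, IsIso (S.standardToProper l)) ∧ IsHighestWeight 𝒯.simple K S.standard :=
  ⟨𝒯.stratification, fun _ => ⟨𝒯.isIso_standardToProper, 𝒯.isHighestWeight⟩⟩
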